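/- **Definitions.** Let $k\ge 1$. A real matrix $A$ has *special rows* $(x_1,\dots,x_{k-1})$ if the set of vectors obtained by restricting the columns of $A$ to these rows is exactly $\{\mathbf 0,e_1,\dots,e_{k-1}\}\subseteq\mathbb R^{k-1}$ (repetitions allowed; for $k=1$ this only says that $A$ has a column). Put $e_0:=\mathbf 0$. For $0\le j\le k-1$ let $A[j]$ be the submatrix of $A$ consisting of the non-special rows and of the columns whose restriction to the special rows is $e_j$. The *$1$-product* $A\otimes B$ is the matrix whose columns are the concatenations of each column of $A$ with each column of $B$. If $S_1,S_2$ are real matrices with special rows $x=(x_1,\dots,x_{k-1})$ and $y=(y_1,\dots,y_{k-1})$, their *$k$-product* is $$(S_1,x)\otimes_k(S_2,y):=\begin{pmatrix} S_1[0]\otimes S_2[0] & S_1[1]\otimes S_2[1] & \cdots & S_1[k-1]\otimes S_2[k-1]\\ e_0\cdots e_0 & e_1\cdots e_1&\cdots& e_{k-1}\cdots e_{k-1}\end{pmatrix}.$$ Two matrices are *isomorphic* if one arises from the other by permuting rows and columns. A real $m\times n$ matrix $S$ is a *$k$-product* if it is isomorphic to some $(S_1,x)\otimes_k(S_2,y)$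 in which each of $S_1,S_2$ has fewer than $m$ rows (for $k=1$ this says that $S_1$ and $S_2$ are non-empty); it is a *$k$-product in the strict sense* if $S_1,S_2$ can moreover be chosen to have fewer than $n$ columns each. **Theorem.** Let $k\ge1$ be a constant. There is an algorithm (a real RAM program, with unit cost for arithmetic operations on and comparisons of real numbers) that, given any $m,n$ and any $S\in\mathbb R^{m\times n}$, halts after a number of steps that is polynomial in $m$ and $n$ and determines whether $S$ is a $k$-product. In case it is, the algorithm outputs two matrices $S_1,S_2$ with fewer rows than $S$ and, if $k\ge2$, special rows $x_1,\dots,x_{k-1}$ of $S_1$ and $y_1,\dots,y_{k-1}$ of $S_2$, such that $S$ is isomorphic to $(S_1,x_1,\dots,x_{k-1})\otimes_k(S_2,y_1,\dots,y_{k-1})$. There is also such an algorithm for $k$-products in the strict sense, whose output matrices have fewer rows and fewer columns than $S$. -/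

import Mathlib

namespace KProd

/-! ### Products of matrices -/

section Products

variable {r : ℕ} {ρ ρ₁ ρ₂ γ γ₁ γ₂ : Type}

/-- The `1`-product: each column of `A` is concatenated with each column of `B`. -/
def oneProduct (A : Matrix ρ₁ γ₁ ℝ) (B : Matrix ρ₂ γ₂ ℝ) : Matrix (ρ₁ ⊕ ρ₂) (γ₁ × γ₂) ℝ :=
  fun i c => Sum.elim (fun a => A a c.1) (fun b => B b c.2) i

/-- Two matrices are isomorphic if one is obtained from the other by permuting rows and columns. -/
def Isomorphic {ρ' γ' : Type} (A : Matrix ρ γ ℝ) (B : Matrix ρ' γ' ℝ) : Prop :=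
  ∃ (e : ρ ≃ ρ') (f : γ ≃ γ'), A = B.submatrix e f

/-- The vectors `0` (for `none`) and `e_l` (for `some l`) of `ℝ^r`. -/
def simplexVertex : Option (Fin r) → Fin r → ℝ
  | none => 0
  | some l => Pi.single l 1

/-- The ordered rows `x` are special rows of `S`: the columns of `S`, restricted to these rows,
are exactly the vectors `0, e_1, …, e_r`, possibly repeated. -/
def SpecialRows (S : Matrix ρ γ ℝ) (x : Fin r → ρ) : Prop :=
  Set.range (fun (c : γ) (l : Fin r) => S (x l) c) = Set.range (simplexVertex (r := r))

/-- The rows that are not among `x`. -/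
abbrev OtherRow (x : Fin r → ρ) : Type := {i : ρ // i ∉ Set.range x}

/-- The columns of `S` which, restricted to the rows `x`, equal `simplexVertex j`. -/
abbrev BlockCol (S : Matrix ρ γ ℝ) (x : Fin r → ρ) (j : Option (Fin r)) : Type :=
  {c : γ // ∀ l, S (x l) c = simplexVertex j l}

/-- The submatrix `S[j]`, without the rows `x`. -/
def block (S : Matrix ρ γ ℝ) (x : Fin r → ρ) (j : Option (Fin r)) :
    Matrix (OtherRow x) (BlockCol S x j) ℝ :=
  S.submatrix Subtype.val Subtype.val

/-- The `(r+1)`-product of `(S₁, x)` and `(S₂, y)`: the blocks `S₁[j] ⊗ S₂[j]` side by side, with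
`r` further rows which are equal to `simplexVertex j` below the `j`-th block. -/
def kProduct (S₁ : Matrix ρ₁ γ₁ ℝ) (x : Fin r → ρ₁) (S₂ : Matrix ρ₂ γ₂ ℝ) (y : Fin r → ρ₂) :
    Matrix ((OtherRow x ⊕ OtherRow y) ⊕ Fin r)
      (Σ j : Option (Fin r), BlockCol S₁ x j × BlockCol S₂ y j) ℝ :=
  fun i c => Sum.elim
    (fun a => oneProduct (block S₁ x c.1) (block S₂ y c.1) a c.2)
    (fun l => simplexVertex c.1 l) i

end Products

/-- Two real matrices, each with an ordered `(k-1)`-tuple of rows. -/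
structure Factors (k : ℕ) where
  m₁ : ℕ
  n₁ : ℕ
  m₂ : ℕ
  n₂ : ℕ
  S₁ : Matrix (Fin m₁) (Fin n₁) ℝ
  S₂ : Matrix (Fin m₂) (Fin n₂) ℝ
  x : Fin (k - 1) → Fin m₁
  y : Fin (k - 1) → Fin m₂

/-- `S` is, up to permuting rows and columns, the `k`-product of the two factors with respect to
the given special rows, and each factor has fewer rows than `S`. (The last condition says that
both factors have a row that is not special. For `k = 1` it says, together with the nonemptiness
of the column sets contained in `SpecialRows`, that both factors are nonempty.) -/
def IsFactorization {k m n : ℕ} (S : Matrix (Fin m) (Fin n) ℝ) (F : Factors k) : Prop :=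
  SpecialRows F.S₁ F.x ∧ SpecialRows F.S₂ F.y ∧ F.m₁ < m ∧ F.m₂ < m ∧
    Isomorphic S (kProduct F.S₁ F.x F.S₂ F.y)

/-- The same, and each factor also has fewer columns than `S`. -/
def IsStrictFactorization {k m n : ℕ} (S : Matrix (Fin m) (Fin n) ℝ) (F : Factors k) : Prop :=
  IsFactorization S F ∧ F.n₁ < n ∧ F.n₂ < n

/-! ### Real RAM programs

The memory consists of arrays of natural numbers (for counting and addressing) and of arrays of
real numbers, with indirect addressing. A program mentions finitely many arrays. Natural numbers
can be added, subtracted (with truncation) and compared; real numbers can be added, subtracted,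
multiplied, divided and compared; the real constants are `0` and `1`. There is no conversion
between the two kinds of numbers. Every operation, memory access and test takes one step. -/

/-- Memory contents: `s.nat a i` and `s.real a i` are the `i`-th cells of the `a`-th arrays. -/
structure State where
  nat : ℕ → ℕ → ℕ
  real : ℕ → ℕ → ℝ

def State.setNat (s : State) (a i v : ℕ) : State :=
  { s with nat := Function.update s.nat a (Function.update (s.nat a) i v) }

def State.setReal (s : State) (a i : ℕ) (v : ℝ) : State :=
  { s with real := Function.update s.real a (Function.update (s.real a) i v) }

inductive NatExpr
  | const (c : ℕ)
  | read (a : ℕ) (i : NatExpr)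
  | add (e f : NatExpr)
  | sub (e f : NatExpr)

def NatExpr.eval (s : State) : NatExpr → ℕ
  | .const c => c
  | .read a i => s.nat a (i.eval s)
  | .add e f => e.eval s + f.eval s
  | .sub e f => e.eval s - f.eval s

def NatExpr.cost : NatExpr → ℕ
  | .const _ => 1
  | .read _ i => i.cost + 1
  | .add e f => e.cost + f.cost + 1
  | .sub e f => e.cost + f.cost + 1

inductive RealExpr
  | zero
  | one
  | read (a : ℕ) (i : NatExpr)
  | add (e f : RealExpr)
  | sub (e f : RealExpr)
  | mul (e f : RealExpr)
  | div (e f : RealExpr)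

noncomputable def RealExpr.eval (s : State) : RealExpr → ℝ
  | .zero => 0
  | .one => 1
  | .read a i => s.real a (i.eval s)
  | .add e f => e.eval s + f.eval s
  | .sub e f => e.eval s - f.eval s
  | .mul e f => e.eval s * f.eval s
  | .div e f => e.eval s / f.eval s

def RealExpr.cost : RealExpr → ℕ
  | .zero => 1
  | .one => 1
  | .read _ i => i.cost + 1
  | .add e f => e.cost + f.cost + 1
  | .sub e f => e.cost + f.cost + 1
  | .mul e f => e.cost + f.cost + 1
  | .div e f => e.cost + f.cost + 1

inductive Test
  | natEq (e f : NatExpr)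
  | natLt (e f : NatExpr)
  | realEq (e f : RealExpr)
  | realLt (e f : RealExpr)
  | not (b : Test)
  | and (b c : Test)

def Test.Holds (s : State) : Test → Prop
  | .natEq e f => e.eval s = f.eval s
  | .natLt e f => e.eval s < f.eval s
  | .realEq e f => e.eval s = f.eval s
  | .realLt e f => e.eval s < f.eval s
  | .not b => ¬ b.Holds s
  | .and b c => b.Holds s ∧ c.Holds s

def Test.cost : Test → ℕ
  | .natEq e f => e.cost + f.cost + 1
  | .natLt e f => e.cost + f.cost + 1
  | .realEq e f => e.cost + f.cost + 1
  | .realLt e f => e.cost + f.cost + 1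
  | .not b => b.cost + 1
  | .and b c => b.cost + c.cost + 1

inductive Program
  | skip
  | setNat (a : ℕ) (i e : NatExpr)
  | setReal (a : ℕ) (i : NatExpr) (e : RealExpr)
  | seq (p q : Program)
  | ite (b : Test) (p q : Program)
  | while (b : Test) (p : Program)

/-- `Runs p s s' t`: started in the memory `s`, the program `p` halts with the memory `s'` after
exactly `t` steps. -/
inductive Runs : Program → State → State → ℕ → Prop
  | skip (s : State) : Runs .skip s s 1
  | setNat (s : State) (a : ℕ) (i e : NatExpr) :
      Runs (.setNat a i e) s (s.setNat a (i.eval s) (e.eval s)) (i.cost + e.cost + 1)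
  | setReal (s : State) (a : ℕ) (i : NatExpr) (e : RealExpr) :
      Runs (.setReal a i e) s (s.setReal a (i.eval s) (e.eval s)) (i.cost + e.cost + 1)
  | seq {p q : Program} {s s' s'' : State} {t u : ℕ} :
      Runs p s s' t → Runs q s' s'' u → Runs (.seq p q) s s'' (t + u)
  | iteTrue {b : Test} {p q : Program} {s s' : State} {t : ℕ} :
      b.Holds s → Runs p s s' t → Runs (.ite b p q) s s' (b.cost + t + 1)
  | iteFalse {b : Test} {p q : Program} {s s' : State} {t : ℕ} :
      ¬ b.Holds s → Runs q s s' t → Runs (.ite b p q) s s' (b.cost + t + 1)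
  | whileTrue {b : Test} {p : Program} {s s' s'' : State} {t u : ℕ} :
      b.Holds s → Runs p s s' t → Runs (.while b p) s' s'' u →
        Runs (.while b p) s s'' (b.cost + t + u + 1)
  | whileFalse {b : Test} {p : Program} {s : State} :
      ¬ b.Holds s → Runs (.while b p) s s (b.cost + 1)

/-- A program has at most one run from a given memory. -/
theorem Runs.deterministic {p : Program} {s s₁ s₂ : State} {t₁ t₂ : ℕ}
    (h₁ : Runs p s s₁ t₁) (h₂ : Runs p s s₂ t₂) : s₁ = s₂ ∧ t₁ = t₂ := by
  induction h₁ generalizing s₂ t₂ with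
  | skip | setNat | setReal => cases h₂; exact ⟨rfl, rfl⟩
  | seq _ _ ih ih' =>
    cases h₂ with
    | seq a b =>
      obtain ⟨rfl, rfl⟩ := ih a
      obtain ⟨rfl, rfl⟩ := ih' b
      exact ⟨rfl, rfl⟩
  | iteTrue hb _ ih =>
    cases h₂ with
    | iteTrue _ a => obtain ⟨rfl, rfl⟩ := ih a; exact ⟨rfl, rfl⟩
    | iteFalse hb' _ => exact absurd hb hb'
  | iteFalse hb _ ih =>
    cases h₂ with
    | iteTrue hb' _ => exact absurd hb' hb
    | iteFalse _ a => obtain ⟨rfl, rfl⟩ := ih a; exact ⟨rfl, rfl⟩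
  | whileTrue hb _ _ ih ih' =>
    cases h₂ with
    | whileTrue _ a b =>
      obtain ⟨rfl, rfl⟩ := ih a
      obtain ⟨rfl, rfl⟩ := ih' b
      exact ⟨rfl, rfl⟩
    | whileFalse hb' => exact absurd hb hb'
  | whileFalse hb =>
    cases h₂ with
    | whileTrue hb' _ _ => exact absurd hb' hb
    | whileFalse _ => exact ⟨rfl, rfl⟩

/-! ### Input, output and the recognition problem -/

/-- The initial memory on input `S`: natural array `0` is `m, n, 0, 0, …`, real array `0` lists
the entries of `S` row by row, and all other cells are `0`. -/
def inputState {m n : ℕ} (S : Matrix (Fin m) (Fin n) ℝ) : State where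
  nat a i := if a = 0 then (if i = 0 then m else if i = 1 then n else 0) else 0
  real a i :=
    if h : a = 0 ∧ i / n < m ∧ 0 < n then S ⟨i / n, h.2.1⟩ ⟨i % n, Nat.mod_lt i h.2.2⟩ else 0

/-- The real array `a` starts with the entries of `A`, listed row by row. -/
def State.HoldsMatrix (s : State) (a : ℕ) {m n : ℕ} (A : Matrix (Fin m) (Fin n) ℝ) : Prop :=
  ∀ (i : Fin m) (j : Fin n), s.real a (i * n + j) = A i j

/-- The output convention for factors: cells `1, …, 4` of natural array `1` hold the sizes of the
factors, real arrays `1` and `2` hold their entries, and natural arrays `2` and `3` hold the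
indices (starting from `0`) of their special rows. -/
def State.HoldsFactors (s : State) {k : ℕ} (F : Factors k) : Prop :=
  s.nat 1 1 = F.m₁ ∧ s.nat 1 2 = F.n₁ ∧ s.nat 1 3 = F.m₂ ∧ s.nat 1 4 = F.n₂ ∧
    s.HoldsMatrix 1 F.S₁ ∧ s.HoldsMatrix 2 F.S₂ ∧
    (∀ l : Fin (k - 1), s.nat 2 l = F.x l) ∧ (∀ l : Fin (k - 1), s.nat 3 l = F.y l)

/-- On every real matrix `S`, with `m` rows and `n` columns say, the program `p` halts within a
number of steps that is polynomial in `m` and `n`. If there are factors `F` with `Q S F`, it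
answers `1` (in cell `0` of natural array `1`) and outputs such factors; otherwise it
answers `0`. -/
def Program.FindsFactorsInPolyTime (p : Program) (k : ℕ)
    (Q : ∀ {m n : ℕ}, Matrix (Fin m) (Fin n) ℝ → Factors k → Prop) : Prop :=
  ∃ C d : ℕ, ∀ (m n : ℕ) (S : Matrix (Fin m) (Fin n) ℝ),
    ∃ (s : State) (t : ℕ), Runs p (inputState S) s t ∧ t ≤ C * (m + n + 1) ^ d ∧
      ((∃ F : Factors k, Q S F) → s.nat 1 0 = 1 ∧ ∃ F : Factors k, s.HoldsFactors F ∧ Q S F) ∧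
      ((¬ ∃ F : Factors k, Q S F) → s.nat 1 0 = 0)

end KProd

namespace KProd

/-! ### Running times -/

/-! Fix `k - 1` rows as special rows; the columns with a given restriction to them form a block. If
`S` is a product with these special rows, the columns of a block are all pairs of a column of the
first and one of the second factor. For a uniformly random column, the rows `A` of the first factor
are therefore independent of the rows `B` of the second one, given the special rows (`CondIndep`).

Conversely, independence determines a factorization once the multiplicities can be divided up. In a
block of `N` columns, let the second factor have `b` columns. Then `b` must divide the size of every
class of columns that agree on `A`, and `N / b` the size of every class of columns that agree on `B`
(`ValidSplit`). Keeping the fraction `1 / b` of each `A`-class and the fraction `b / N` of each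
`B`-class gives factors whose product contains every column vector as often as `S` does
(`RowSplit.isomorphic`). Such a `b` always exists, for example the greatest common divisor of the
sizes of the `A`-classes, because by independence `N` divides every product of the sizes of an
`A`-class and a `B`-class (`CondIndep.exists_validSplit`).

So the task is to find `z`, `A` and `B`. As `k` is constant, all choices of `z` can be tried. For
fixed `z` there is a finest partition of the rows into sets independent of the rest, and every set
independent of its complement is a union of its classes. It is computed row by row: a new row `p` is
merged with exactly those classes that are no longer independent of the other rows when `p` is
included (`FinestLabels.next`, based on the rule `CondIndep.contract`). In any splitting, `A` can be
replaced by a single class inside it, so it suffices to try the class of each row `w`.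

For the strict version, some block needs `b ≥ 2` and some block `b < N`. If both sides vary inside
blocks, this holds for every valid choice; if one side is constant on all blocks, the old numbers
stay valid for a class inside that side (`RowSplit.exists_label_strict`). Finally it suffices to
guess one block and its number, and to use the smallest valid numbers in all other blocks
(`RowSplit.exists_guess_strict`).

The search is written in a small language with bounded sums (`BExpr`) and bounded loops (`Cmd`).
Each construct compiles to a program with a polynomial time bound, so the running time needs no
analysis of the algorithm and only its meaning has to be followed. Real numbers are only copied and
tested for equality. -/

/-- `T` is bounded by a polynomial on the positive integers. -/
def PolyBounded (T : ℕ → ℕ) : Prop := ∃ C d : ℕ, ∀ N, 1 ≤ N → T N ≤ C * N ^ d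

theorem PolyBounded.const (c : ℕ) : PolyBounded fun _ => c := ⟨c, 0, by simp⟩

theorem PolyBounded.id : PolyBounded fun N => N := ⟨1, 1, by simp⟩

theorem PolyBounded.add {T U : ℕ → ℕ} (hT : PolyBounded T) (hU : PolyBounded U) :
    PolyBounded fun N => T N + U N := by
  obtain ⟨C, d, h⟩ := hT
  obtain ⟨D, e, h'⟩ := hU
  refine ⟨C + D, d + e, fun N hN => ?_⟩
  have h1 : N ^ d ≤ N ^ (d + e) := Nat.pow_le_pow_right hN (by omega)
  have h2 : N ^ e ≤ N ^ (d + e) := Nat.pow_le_pow_right hN (by omega)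
  calc T N + U N ≤ C * N ^ d + D * N ^ e := add_le_add (h N hN) (h' N hN)
    _ ≤ C * N ^ (d + e) + D * N ^ (d + e) := by gcongr
    _ = (C + D) * N ^ (d + e) := by ring

theorem PolyBounded.mul {T U : ℕ → ℕ} (hT : PolyBounded T) (hU : PolyBounded U) :
    PolyBounded fun N => T N * U N := by
  obtain ⟨C, d, h⟩ := hT
  obtain ⟨D, e, h'⟩ := hU
  refine ⟨C * D, d + e, fun N hN => ?_⟩
  calc T N * U N ≤ (C * N ^ d) * (D * N ^ e) := Nat.mul_le_mul (h N hN) (h' N hN)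
    _ = C * D * N ^ (d + e) := by ring

/-- The program halts in `s'` within `T` steps. -/
def RunsWithin (p : Program) (s s' : State) (T : ℕ) : Prop := ∃ t ≤ T, Runs p s s' t

theorem RunsWithin.mono {p : Program} {s s' : State} {T U : ℕ} (h : RunsWithin p s s' T)
    (hTU : T ≤ U) : RunsWithin p s s' U := by
  obtain ⟨t, ht, h⟩ := h
  exact ⟨t, ht.trans hTU, h⟩

theorem RunsWithin.seq {p q : Program} {s s' s'' : State} {T U : ℕ} (h : RunsWithin p s s' T)
    (h' : RunsWithin q s' s'' U) : RunsWithin (.seq p q) s s'' (T + U) := by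
  obtain ⟨t, ht, h⟩ := h
  obtain ⟨u, hu, h'⟩ := h'
  exact ⟨t + u, add_le_add ht hu, h.seq h'⟩

theorem RunsWithin.setNat (s : State) (a : ℕ) (i e : NatExpr) :
    RunsWithin (.setNat a i e) s (s.setNat a (i.eval s) (e.eval s)) (i.cost + e.cost + 1) :=
  ⟨_, le_rfl, .setNat s a i e⟩

theorem RunsWithin.iteTrue {b : Test} {p q : Program} {s s' : State} {T : ℕ} (hb : b.Holds s)
    (h : RunsWithin p s s' T) : RunsWithin (.ite b p q) s s' (b.cost + T + 1) := by
  obtain ⟨t, ht, h⟩ := h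
  exact ⟨_, by omega, .iteTrue hb h⟩

theorem RunsWithin.iteFalse {b : Test} {p q : Program} {s s' : State} {T : ℕ} (hb : ¬ b.Holds s)
    (h : RunsWithin q s s' T) : RunsWithin (.ite b p q) s s' (b.cost + T + 1) := by
  obtain ⟨t, ht, h⟩ := h
  exact ⟨_, by omega, .iteFalse hb h⟩

/-- A loop whose `i`-th pass leads from the invariant `I i` to `I (i + 1)`. -/
theorem RunsWithin.while_of_invariant {b : Test} {p : Program} {K T : ℕ} (I : ℕ → State → Prop)
    (step : ∀ i < K, ∀ s, I i s → b.Holds s ∧ ∃ s', RunsWithin p s s' T ∧ I (i + 1) s')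
    (halts : ∀ s, I K s → ¬ b.Holds s) {s : State} (hs : I 0 s) :
    ∃ s', RunsWithin (.while b p) s s' (K * (T + b.cost + 1) + b.cost + 1) ∧ I K s' := by
  -- The induction is on the number `j` of passes still to come, because `Runs` unfolds a loop at
  -- its first pass.
  suffices H : ∀ j i, i + j = K → ∀ s, I i s →
      ∃ s', RunsWithin (.while b p) s s' (j * (T + b.cost + 1) + b.cost + 1) ∧ I K s' from
    H K 0 (by omega) s hs
  intro j
  induction j with
  | zero =>
    rintro i rfl s hs
    exact ⟨s, ⟨b.cost + 1, by omega, .whileFalse (halts s hs)⟩, hs⟩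
  | succ j ih =>
    intro i hi s hs
    obtain ⟨hb, s', ⟨t, ht, h⟩, hs'⟩ := step i (by omega) s hs
    obtain ⟨s'', ⟨u, hu, h'⟩, hs''⟩ := ih (i + 1) (by omega) s' hs'
    refine ⟨s'', ⟨_, ?_, .whileTrue hb h h'⟩, hs''⟩
    rw [Nat.succ_mul]
    omega

/-! ### Memories -/

@[simp] theorem State.setNat_nat (s : State) (a i v b j : ℕ) :
    (s.setNat a i v).nat b j = if b = a ∧ j = i then v else s.nat b j := by
  unfold State.setNat
  by_cases h : b = a
  · subst h
    by_cases h' : j = i <;> simp [h']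
  · simp [h]

theorem State.setNat_nat_of_ne (s : State) {a b : ℕ} (i v : ℕ) (h : b ≠ a) :
    (s.setNat a i v).nat b = s.nat b := by
  funext j
  simp [h]

@[simp] theorem State.setNat_real (s : State) (a i v : ℕ) : (s.setNat a i v).real = s.real := rfl

@[simp] theorem State.setReal_nat (s : State) (a i : ℕ) (v : ℝ) :
    (s.setReal a i v).nat = s.nat := rfl

@[simp] theorem State.setReal_real (s : State) (a i : ℕ) (v : ℝ) (b j : ℕ) :
    (s.setReal a i v).real b j = if b = a ∧ j = i then v else s.real b j := by
  unfold State.setReal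
  by_cases h : b = a
  · subst h
    by_cases h' : j = i <;> simp [h']
  · simp [h]

theorem State.ext' {s s' : State} (hn : ∀ a i, s.nat a i = s'.nat a i)
    (hr : ∀ a i, s.real a i = s'.real a i) : s = s' := by
  cases s; cases s'
  simp only [State.mk.injEq]
  exact ⟨funext fun a => funext (hn a), funext fun a => funext (hr a)⟩

/-- The memories agree except for the natural arrays with number at least `L`. -/
def State.AgreeBelow (L : ℕ) (s s' : State) : Prop :=
  (∀ a < L, ∀ i, s'.nat a i = s.nat a i) ∧ s'.real = s.real

theorem State.AgreeBelow.refl (L : ℕ) (s : State) : s.AgreeBelow L s :=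
  ⟨fun _ _ _ => rfl, rfl⟩

theorem State.AgreeBelow.trans {L : ℕ} {s s' s'' : State} (h : s.AgreeBelow L s')
    (h' : s'.AgreeBelow L s'') : s.AgreeBelow L s'' :=
  ⟨fun a ha i => (h'.1 a ha i).trans (h.1 a ha i), h'.2.trans h.2⟩

theorem State.AgreeBelow.mono {L L' : ℕ} {s s' : State} (h : s.AgreeBelow L' s') (hL : L ≤ L') :
    s.AgreeBelow L s' :=
  ⟨fun a ha i => h.1 a (by omega) i, h.2⟩

theorem State.AgreeBelow.setNat_scratch {L : ℕ} (s : State) {a : ℕ} (ha : L ≤ a) (i v : ℕ) :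
    s.AgreeBelow L (s.setNat a i v) :=
  ⟨fun b hb j => by rw [State.setNat_nat_of_ne _ _ _ (by omega)], rfl⟩

theorem State.AgreeBelow.setNat {L : ℕ} {s s' : State} (h : s.AgreeBelow L s') (a i v : ℕ) :
    (s.setNat a i v).AgreeBelow L (s'.setNat a i v) :=
  ⟨fun b hb j => by simp only [State.setNat_nat, h.1 b hb], h.2⟩

theorem State.AgreeBelow.setReal {L : ℕ} {s s' : State} (h : s.AgreeBelow L s') (a i : ℕ)
    (v : ℝ) : (s.setReal a i v).AgreeBelow L (s'.setReal a i v) :=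
  ⟨h.1, by funext b j; simp only [State.setReal_real, h.2]⟩

/-- The size of the input matrix, measured by `m + n + 1`. -/
def State.size (s : State) : ℕ := s.nat 0 0 + s.nat 0 1 + 1

theorem State.nat_zero_le_size (s : State) (b : Fin 2) : s.nat 0 b ≤ s.size := by
  unfold State.size
  fin_cases b <;> simp <;> omega

theorem State.AgreeBelow.size_eq {L : ℕ} {s s' : State} (h : s.AgreeBelow L s') (hL : 0 < L) :
    s'.size = s.size := by
  simp only [State.size, h.1 0 hL]

/-! ### Bounded expressions -/

/-- Expressions with natural values. `sum v b e` is the sum of the values of `e` when cell `0` of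
array `v` runs through the numbers below the number `b` of rows (`b = 0`) or columns (`b = 1`) of
the input. -/
inductive BExpr
  | const (c : ℕ)
  | read (a : ℕ) (i : BExpr)
  | add (e f : BExpr)
  | sub (e f : BExpr)
  | mul (e f : BExpr)
  | lt (e f : BExpr)
  | eq (e f : BExpr)
  | realEq (e f : BExpr)
  | realZero (e : BExpr)
  | realOne (e : BExpr)
  | ite (b e f : BExpr)
  | sum (v : ℕ) (b : Fin 2) (e : BExpr)

open Classical in
/-- The value. The first factor of a product is cut off at the input size, tests have the values
`0` and `1`, and real cells are read from the input array. -/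
noncomputable def BExpr.eval : BExpr → State → ℕ
  | .const c, _ => c
  | .read a i, s => s.nat a (i.eval s)
  | .add e f, s => e.eval s + f.eval s
  | .sub e f, s => e.eval s - f.eval s
  -- The machine cannot multiply natural numbers, so a product is computed by repeated addition. The
  -- cut-off bounds the number of additions by the input size.
  | .mul e f, s => min (e.eval s) s.size * f.eval s
  | .lt e f, s => if e.eval s < f.eval s then 1 else 0
  | .eq e f, s => if e.eval s = f.eval s then 1 else 0
  | .realEq e f, s => if s.real 0 (e.eval s) = s.real 0 (f.eval s) then 1 else 0
  | .realZero e, s => if s.real 0 (e.eval s) = 0 then 1 else 0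
  | .realOne e, s => if s.real 0 (e.eval s) = 1 then 1 else 0
  | .ite b e f, s => if b.eval s = 0 then f.eval s else e.eval s
  | .sum v b e, s => ∑ i ∈ Finset.range (s.nat 0 b), e.eval (s.setNat v 0 i)

/-- All arrays used by the expression have numbers below `L`, and array `0` is not a variable. -/
def BExpr.Below (L : ℕ) : BExpr → Prop
  | .const _ => True
  | .read a i => a < L ∧ i.Below L
  | .add e f | .sub e f | .mul e f | .lt e f | .eq e f | .realEq e f => e.Below L ∧ f.Below L
  | .realZero e | .realOne e => e.Below L
  | .ite b e f => b.Below L ∧ e.Below L ∧ f.Below L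
  | .sum v _ e => v < L ∧ v ≠ 0 ∧ e.Below L

theorem BExpr.Below.mono {L L' : ℕ} (hL : L ≤ L') {e : BExpr} (h : e.Below L) : e.Below L' := by
  induction e with
  | const => trivial
  | read a i ih => exact ⟨h.1.trans_le hL, ih h.2⟩
  | add e f ihe ihf | sub e f ihe ihf | mul e f ihe ihf | lt e f ihe ihf | eq e f ihe ihf
  | realEq e f ihe ihf => exact ⟨ihe h.1, ihf h.2⟩
  | realZero e ih | realOne e ih => exact ih h
  | ite b e f ihb ihe ihf => exact ⟨ihb h.1, ihe h.2.1, ihf h.2.2⟩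
  | sum v b e ih => exact ⟨h.1.trans_le hL, h.2.1, ih h.2.2⟩

/-- This makes compilation compositional: code for one subexpression may leave anything in the
scratch arrays from `L` on without affecting the value of the next one. -/
theorem BExpr.eval_congr {L : ℕ} (hL : 0 < L) (e : BExpr) (h : e.Below L) {s s' : State}
    (hs : s.AgreeBelow L s') : e.eval s' = e.eval s := by
  induction e generalizing s s' with
  | const => rfl
  | read a i ih => simp only [BExpr.eval, ih h.2 hs, hs.1 a h.1]
  | add e f ihe ihf | sub e f ihe ihf | lt e f ihe ihf | eq e f ihe ihf =>
    simp only [BExpr.eval, ihe h.1 hs, ihf h.2 hs]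
  | mul e f ihe ihf => simp only [BExpr.eval, ihe h.1 hs, ihf h.2 hs, hs.size_eq hL]
  | realEq e f ihe ihf => simp only [BExpr.eval, ihe h.1 hs, ihf h.2 hs, hs.2]
  | realZero e ih | realOne e ih => simp only [BExpr.eval, ih h hs, hs.2]
  | ite b e f ihb ihe ihf => simp only [BExpr.eval, ihb h.1 hs, ihe h.2.1 hs, ihf h.2.2 hs]
  | sum v b e ih =>
    simp only [BExpr.eval, hs.1 0 hL]
    exact Finset.sum_congr rfl fun i _ => ih h.2.2 (hs.setNat v 0 i)

/-! ### Compiling bounded expressions -/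

/-- A program evaluates the function `f` into cell `0` of array `L` in polynomial time, changing
only arrays from `L` on. -/
def Evaluable (L : ℕ) (f : State → ℕ) : Prop :=
  ∃ (p : Program) (T : ℕ → ℕ), PolyBounded T ∧ ∀ s, ∃ s', RunsWithin p s s' (T s.size) ∧
    s.AgreeBelow L s' ∧ s'.nat L 0 = f s

/-- The scratch arrays form a stack: the second operand is evaluated one level higher, so the first
value survives in array `L` until `q` combines the two. -/
theorem Evaluable.binary {L : ℕ} (hL : 0 < L) {f g h : State → ℕ} (hf : Evaluable L f)
    (hg : Evaluable (L + 1) g) (hg' : ∀ s s', s.AgreeBelow L s' → g s' = g s)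
    (q : Program) (c : ℕ)
    (hq : ∀ s s', s.AgreeBelow L s' → s'.nat L 0 = f s → s'.nat (L + 1) 0 = g s →
      ∃ s'', RunsWithin q s' s'' c ∧ s'.AgreeBelow L s'' ∧ s''.nat L 0 = h s) :
    Evaluable L h := by
  obtain ⟨p₁, T₁, hT₁, h₁⟩ := hf
  obtain ⟨p₂, T₂, hT₂, h₂⟩ := hg
  refine ⟨.seq p₁ (.seq p₂ q), fun N => T₁ N + (T₂ N + c), hT₁.add (hT₂.add (.const c)), ?_⟩
  intro s
  obtain ⟨s₁, hr₁, ha₁, hv₁⟩ := h₁ s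
  obtain ⟨s₂, hr₂, ha₂, hv₂⟩ := h₂ s₁
  have ha : s.AgreeBelow L s₂ := ha₁.trans (ha₂.mono (by omega))
  obtain ⟨s₃, hr₃, ha₃, hv₃⟩ := hq s s₂ ha ((ha₂.1 L (by omega) 0).trans hv₁)
    (hv₂.trans (hg' _ _ ha₁))
  rw [ha₁.size_eq hL] at hr₂
  exact ⟨s₃, hr₁.seq (hr₂.seq hr₃), ha.trans ha₃, hv₃⟩

/-- The program that stores a natural number in cell `0` of array `L`. -/
def storeAt (L : ℕ) (e : NatExpr) : Program := .setNat L (.const 0) e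

theorem exists_storeAt_run (L : ℕ) (e : NatExpr) (s : State) :
    ∃ s', RunsWithin (storeAt L e) s s' (e.cost + 2) ∧ s.AgreeBelow L s' ∧
      s'.nat L 0 = e.eval s :=
  ⟨s.setNat L 0 (e.eval s), (RunsWithin.setNat s L (.const 0) e).mono (by simp [NatExpr.cost]; omega),
    .setNat_scratch s le_rfl _ _, by simp⟩

/-- The program that stores the truth value of a test in cell `0` of array `L`. -/
def storeTestAt (L : ℕ) (b : Test) : Program :=
  .ite b (storeAt L (.const 1)) (storeAt L (.const 0))

open Classical in
theorem exists_storeTestAt_run (L : ℕ) (b : Test) (s : State) :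
    ∃ s', RunsWithin (storeTestAt L b) s s' (b.cost + 4) ∧ s.AgreeBelow L s' ∧
      s'.nat L 0 = if b.Holds s then 1 else 0 := by
  by_cases h : b.Holds s
  · obtain ⟨s', hr, ha, hv⟩ := exists_storeAt_run L (.const 1) s
    exact ⟨s', (RunsWithin.iteTrue h hr).mono (by simp [NatExpr.cost]), ha, by simp [h, hv, NatExpr.eval]⟩
  · obtain ⟨s', hr, ha, hv⟩ := exists_storeAt_run L (.const 0) s
    exact ⟨s', (RunsWithin.iteFalse h hr).mono (by simp [NatExpr.cost]), ha, by simp [h, hv, NatExpr.eval]⟩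

/-- Reading cell `0` of array `a`. -/
abbrev cell (a : ℕ) : NatExpr := .read a (.const 0)

theorem Evaluable.binary_store {L : ℕ} (hL : 0 < L) {f g h : State → ℕ} (hf : Evaluable L f)
    (hg : Evaluable (L + 1) g) (hg' : ∀ s s', s.AgreeBelow L s' → g s' = g s) (e : NatExpr)
    (he : ∀ s s', s.AgreeBelow L s' → s'.nat L 0 = f s → s'.nat (L + 1) 0 = g s →
      e.eval s' = h s) :
    Evaluable L h :=
  hf.binary hL hg hg' (storeAt L e) _ fun s s' ha h₁ h₂ => by
    obtain ⟨s'', hr, ha', hv⟩ := exists_storeAt_run L e s'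
    exact ⟨s'', hr, ha', hv.trans (he s s' ha h₁ h₂)⟩

open Classical in
theorem Evaluable.binary_test {L : ℕ} (hL : 0 < L) {f g h : State → ℕ} (hf : Evaluable L f)
    (hg : Evaluable (L + 1) g) (hg' : ∀ s s', s.AgreeBelow L s' → g s' = g s) (b : Test)
    (hb : ∀ s s', s.AgreeBelow L s' → s'.nat L 0 = f s → s'.nat (L + 1) 0 = g s →
      (if b.Holds s' then 1 else 0) = h s) :
    Evaluable L h :=
  hf.binary hL hg hg' (storeTestAt L b) _ fun s s' ha h₁ h₂ => by
    obtain ⟨s'', hr, ha', hv⟩ := exists_storeTestAt_run L b s'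
    exact ⟨s'', hr, ha', hv.trans (hb s s' ha h₁ h₂)⟩

theorem Evaluable.const (L c : ℕ) : Evaluable L fun _ => c :=
  ⟨storeAt L (.const c), fun _ => 3, .const 3, fun s => exists_storeAt_run L (.const c) s⟩

/-- Repeated addition, with the counter in array `L + 2` and the accumulated sum in array `L + 3`.
The second conjunct of the loop test realizes the cut-off at the input size. -/
theorem Evaluable.mul {L : ℕ} (hL : 0 < L) {f g : State → ℕ} (hf : Evaluable L f)
    (hg : Evaluable (L + 1) g) (hg' : ∀ s s', s.AgreeBelow L s' → g s' = g s) :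
    Evaluable L fun s => min (f s) s.size * g s := by
  obtain ⟨p₁, T₁, hT₁, h₁⟩ := hf
  obtain ⟨p₂, T₂, hT₂, h₂⟩ := hg
  let b : Test := .and (.natLt (cell (L + 2)) (cell L))
    (.natLt (cell (L + 2)) (.add (.add (.read 0 (.const 0)) (.read 0 (.const 1))) (.const 1)))
  let body : Program := .seq (storeAt (L + 3) (.add (cell (L + 3)) (cell (L + 1))))
    (storeAt (L + 2) (.add (cell (L + 2)) (.const 1)))
  let setup : Program := .seq (storeAt (L + 2) (.const 0)) (storeAt (L + 3) (.const 0))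
  refine ⟨.seq p₁ (.seq p₂ (.seq setup (.seq (.while b body) (storeAt L (cell (L + 3)))))),
    fun N => T₁ N + (T₂ N + (6 + ((N * (20 + b.cost + 1) + (b.cost + 1)) + 4))), ?_, ?_⟩
  · exact hT₁.add (hT₂.add ((PolyBounded.const _).add
      (((PolyBounded.id.mul (.const _)).add (.const _)).add (.const _))))
  intro s
  obtain ⟨s₁, hr₁, ha₁, hv₁⟩ := h₁ s
  obtain ⟨s₂, hr₂, ha₂, hv₂⟩ := h₂ s₁
  rw [ha₁.size_eq hL] at hr₂
  rw [hg' _ _ ha₁] at hv₂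
  have ha : s.AgreeBelow L s₂ := ha₁.trans (ha₂.mono (by omega))
  have hv : s₂.nat L 0 = f s := (ha₂.1 L (by omega) 0).trans hv₁
  let I : ℕ → State → Prop := fun i u => s.AgreeBelow L u ∧ u.nat L 0 = f s ∧
    u.nat (L + 1) 0 = g s ∧ u.nat (L + 2) 0 = i ∧ u.nat (L + 3) 0 = i * g s
  have hI : I 0 ((s₂.setNat (L + 2) 0 0).setNat (L + 3) 0 0) := by
    refine ⟨ha.trans ((State.AgreeBelow.setNat_scratch _ (by omega) _ _).trans
      (.setNat_scratch _ (by omega) _ _)), ?_, ?_, ?_, ?_⟩ <;> simp [hv, hv₂]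
  obtain ⟨s₄, hr₄, hs₄⟩ := RunsWithin.while_of_invariant (b := b) (p := body)
    (K := min (f s) s.size) (T := 20) I (by
      rintro i hi u ⟨hu, hu₁, hu₂, hu₃, hu₄⟩
      have hsz := hu.size_eq hL
      refine ⟨?_, (u.setNat (L + 3) 0 (i * g s + g s)).setNat (L + 2) 0 (i + 1), ?_, ?_⟩
      · simp only [State.size] at hi hsz
        simp only [b, Test.Holds, NatExpr.eval, hu₁, hu₃]
        omega
      · have e1 := RunsWithin.setNat u (L + 3) (.const 0) (.add (cell (L + 3)) (cell (L + 1)))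
        have e2 := RunsWithin.setNat (u.setNat (L + 3) 0 (i * g s + g s)) (L + 2) (.const 0)
          (.add (cell (L + 2)) (.const 1))
        simp only [NatExpr.eval, hu₂, hu₄] at e1
        simp only [NatExpr.eval, State.setNat_nat, hu₃] at e2
        simp only [Nat.add_left_cancel_iff, Nat.reduceEqDiff, false_and, if_false] at e2
        exact (e1.seq e2).mono (by simp [NatExpr.cost])
      · refine ⟨hu.trans ((State.AgreeBelow.setNat_scratch _ (by omega) _ _).trans
          (.setNat_scratch _ (by omega) _ _)), ?_, ?_, ?_, ?_⟩ <;> simp [hu₁, hu₂, Nat.succ_mul])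
    (by
      rintro u ⟨hu, hu₁, hu₂, hu₃, hu₄⟩
      have hsz := hu.size_eq hL
      simp only [State.size] at hsz hu₃
      simp only [b, Test.Holds, NatExpr.eval, hu₁, hu₃]
      omega) hI
  obtain ⟨s₅, hr₅, ha₅, hv₅⟩ := exists_storeAt_run L (cell (L + 3)) s₄
  refine ⟨s₅, hr₁.seq (hr₂.seq (RunsWithin.seq (T := 6) ?_ ((hr₄.mono ?_).seq hr₅))),
    hs₄.1.trans ha₅, ?_⟩
  · exact (RunsWithin.seq (.setNat _ _ _ _) (.setNat _ _ _ _)).mono (by simp [NatExpr.cost])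
  · have : min (f s) s.size ≤ s.size := min_le_right _ _
    have := Nat.mul_le_mul_right (20 + b.cost + 1) this
    omega
  · rw [hv₅]
    exact hs₄.2.2.2.2

theorem Evaluable.ite {L : ℕ} (hL : 0 < L) {b f g : State → ℕ} (hb : Evaluable L b)
    (hf : Evaluable L f) (hg : Evaluable L g) (hf' : ∀ s s', s.AgreeBelow L s' → f s' = f s)
    (hg' : ∀ s s', s.AgreeBelow L s' → g s' = g s) :
    Evaluable L fun s => if b s = 0 then g s else f s := by
  obtain ⟨p₁, T₁, hT₁, h₁⟩ := hb
  obtain ⟨p₂, T₂, hT₂, h₂⟩ := hf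
  obtain ⟨p₃, T₃, hT₃, h₃⟩ := hg
  refine ⟨.seq p₁ (.ite (.natEq (cell L) (.const 0)) p₃ p₂),
    fun N => T₁ N + ((T₂ N + T₃ N) + 5), hT₁.add ((hT₂.add hT₃).add (.const _)), fun s => ?_⟩
  obtain ⟨s₁, hr₁, ha₁, hv₁⟩ := h₁ s
  obtain ⟨s₂, hr₂, ha₂, hv₂⟩ := h₂ s₁
  obtain ⟨s₃, hr₃, ha₃, hv₃⟩ := h₃ s₁
  rw [ha₁.size_eq hL] at hr₂ hr₃
  rw [hf' _ _ ha₁] at hv₂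
  rw [hg' _ _ ha₁] at hv₃
  by_cases h : b s = 0
  · refine ⟨s₃, hr₁.seq ((RunsWithin.iteTrue ?_ hr₃).mono ?_), ha₁.trans ha₃, by simp [h, hv₃]⟩
    · simp [Test.Holds, NatExpr.eval, hv₁, h]
    · simp [Test.cost, NatExpr.cost]; omega
  · refine ⟨s₂, hr₁.seq ((RunsWithin.iteFalse ?_ hr₂).mono ?_), ha₁.trans ha₂, by simp [h, hv₂]⟩
    · simp [Test.Holds, NatExpr.eval, hv₁, h]
    · simp [Test.cost, NatExpr.cost]; omega

/-- The variable `v` lies below `L` and must come out unchanged, so its old content is saved in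
array `L + 1` and restored after the loop. Array `L` holds the partial sum, and the summand is
evaluated at level `L + 2`, above both. -/
theorem Evaluable.sum {L : ℕ} {f : State → ℕ} {v : ℕ} (hv0 : v ≠ 0) (hvL : v < L)
    (b : Fin 2) (hf : Evaluable (L + 2) f) (hf' : ∀ s s', s.AgreeBelow L s' → f s' = f s) :
    Evaluable L fun s => ∑ i ∈ Finset.range (s.nat 0 b), f (s.setNat v 0 i) := by
  obtain ⟨p, T, hT, hp⟩ := hf
  have hL : 0 < L := by omega
  let t : Test := .natLt (cell v) (.read 0 (.const b))
  let body : Program := .seq p (.seq (storeAt L (.add (cell L) (cell (L + 2))))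
    (storeAt v (.add (cell v) (.const 1))))
  let setup : Program := .seq (storeAt (L + 1) (cell v))
    (.seq (storeAt L (.const 0)) (storeAt v (.const 0)))
  refine ⟨.seq setup (.seq (.while t body) (storeAt v (cell (L + 1)))),
    fun N => 12 + ((N * ((T N + 20) + t.cost + 1) + (t.cost + 1)) + 4), ?_, ?_⟩
  · exact (PolyBounded.const _).add (((PolyBounded.id.mul (((hT.add (.const _)).add
      (.const _)).add (.const _))).add (.const _)).add (.const _))
  intro s
  let I : ℕ → State → Prop := fun i u => (s.setNat v 0 i).AgreeBelow L u ∧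
    u.nat (L + 1) 0 = s.nat v 0 ∧
    u.nat L 0 = ∑ j ∈ Finset.range i, f (s.setNat v 0 j)
  -- Two memories that agree up to the content of the loop variable agree after it is overwritten
  -- with the same number.
  have hset : ∀ (u u' : State) (i j k : ℕ), (u.setNat v 0 i).AgreeBelow L u' → k = j →
      (u.setNat v 0 j).AgreeBelow L (u'.setNat v 0 k) := by
    rintro u u' i j k h rfl
    refine ⟨fun a ha l => ?_, h.2⟩
    have := h.1 a ha l
    simp only [State.setNat_nat] at this ⊢
    split_ifs with h1
    · rfl
    · simpa [h1] using this
  have hself : (s.setNat v 0 (s.nat v 0)) = s := by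
    refine State.ext' (fun a l => ?_) fun _ _ => rfl
    simp only [State.setNat_nat]
    split_ifs with h
    · rw [h.1, h.2]
    · rfl
  have hI : I 0 (((s.setNat (L + 1) 0 (s.nat v 0)).setNat L 0 0).setNat v 0 0) := by
    refine ⟨hset _ _ (s.nat v 0) _ _ ?_ rfl, ?_, ?_⟩
    · rw [hself]
      exact (State.AgreeBelow.setNat_scratch _ (by omega) _ _).trans
        (.setNat_scratch _ (by omega) _ _)
    · have : L + 1 ≠ v := by omega
      simp [this]
    · have : L ≠ v := by omega
      simp [this]
  obtain ⟨s₄, hr₄, hs₄⟩ := RunsWithin.while_of_invariant (b := t) (p := body)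
    (K := s.nat 0 b) (T := T s.size + 20) I (by
      rintro i hi u ⟨hu, hu₁, hu₂⟩
      have hb : ∀ j, u.nat 0 j = s.nat 0 j := fun j => by simp [hu.1 0 hL, hv0.symm]
      have hsz : u.size = s.size := by simp [State.size, hb]
      have huv : u.nat v 0 = i := by simp [hu.1 v hvL]
      obtain ⟨u', hr, ha, hv⟩ := hp u
      rw [hsz] at hr
      refine ⟨?_, (u'.setNat L 0 ((∑ j ∈ Finset.range i, f (s.setNat v 0 j))
        + f (s.setNat v 0 i))).setNat v 0 (i + 1), ?_, ?_⟩
      · simpa [t, Test.Holds, NatExpr.eval, huv, hb] using hi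
      · refine (hr.seq (U := 20) ?_)
        have e1 := RunsWithin.setNat u' L (.const 0) (.add (cell L) (cell (L + 2)))
        have e2 := RunsWithin.setNat (u'.setNat L 0 ((∑ j ∈ Finset.range i, f (s.setNat v 0 j))
          + f (s.setNat v 0 i))) v (.const 0) (.add (cell v) (.const 1))
        have hvL' : v ≠ L := by omega
        simp only [NatExpr.eval, ha.1 L (by omega), hu₂, hv, hf' _ _ hu] at e1
        simp only [NatExpr.eval, State.setNat_nat, hvL', false_and, if_false,
          ha.1 v (by omega), huv] at e2
        exact (e1.seq e2).mono (by simp [NatExpr.cost])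
      · refine ⟨hset _ _ i _ _ (hu.trans ((ha.mono (by omega)).trans
          (.setNat_scratch _ le_rfl _ _))) rfl, ?_, ?_⟩
        · have : L + 1 ≠ v := by omega
          simp [this, ha.1 (L + 1) (by omega), hu₁]
        · have : L ≠ v := by omega
          simp [this, Finset.sum_range_succ])
    (by
      rintro u ⟨hu, hu₁, hu₂⟩
      have hb : ∀ j, u.nat 0 j = s.nat 0 j := fun j => by simp [hu.1 0 hL, hv0.symm]
      have huv : u.nat v 0 = s.nat 0 b := by simp [hu.1 v hvL]
      simp [t, Test.Holds, NatExpr.eval, huv, hb]) hI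
  obtain ⟨h₁, h₂, h₃⟩ := hs₄
  refine ⟨s₄.setNat v 0 (s.nat v 0), RunsWithin.seq (T := 12) ?_ ((hr₄.mono ?_).seq ?_), ?_, ?_⟩
  · have e1 := RunsWithin.setNat s (L + 1) (.const 0) (cell v)
    have e2 := RunsWithin.setNat (s.setNat (L + 1) 0 (s.nat v 0)) L (.const 0) (.const 0)
    have e3 := RunsWithin.setNat ((s.setNat (L + 1) 0 (s.nat v 0)).setNat L 0 0) v
      (.const 0) (.const 0)
    exact (e1.seq (e2.seq e3)).mono (by simp [NatExpr.cost])
  · have := Nat.mul_le_mul_right (T s.size + 20 + t.cost + 1) (s.nat_zero_le_size b)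
    omega
  · have e1 := RunsWithin.setNat s₄ v (.const 0) (cell (L + 1))
    simp only [NatExpr.eval, h₂] at e1
    exact e1.mono (by simp [NatExpr.cost])
  · have := hset _ _ _ _ _ h₁ (rfl : s.nat v 0 = s.nat v 0)
    rwa [hself] at this
  · have : L ≠ v := by omega
    simp [this, h₃]

theorem BExpr.evaluable (e : BExpr) : ∀ L, 0 < L → e.Below L → Evaluable L e.eval := by
  induction e with
  | const c => exact fun L _ _ => Evaluable.const L c
  | read a i ih =>
    intro L hL h
    -- A unary operation is treated as a binary one with a dummy second operand.
    refine (ih L hL h.2).binary_store hL (Evaluable.const (L + 1) 0) (fun _ _ _ => rfl)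
      (.read a (cell L)) fun s s' ha h₁ _ => ?_
    simp [NatExpr.eval, BExpr.eval, h₁, ha.1 a h.1]
  | add e f ihe ihf =>
    intro L hL h
    refine (ihe L hL h.1).binary_store hL (ihf (L + 1) (by omega) (h.2.mono (by omega)))
      (fun s s' hs => BExpr.eval_congr hL f h.2 hs) (.add (cell L) (cell (L + 1)))
      fun s s' ha h₁ h₂ => ?_
    simp [NatExpr.eval, BExpr.eval, h₁, h₂]
  | sub e f ihe ihf =>
    intro L hL h
    refine (ihe L hL h.1).binary_store hL (ihf (L + 1) (by omega) (h.2.mono (by omega)))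
      (fun s s' hs => BExpr.eval_congr hL f h.2 hs) (.sub (cell L) (cell (L + 1)))
      fun s s' ha h₁ h₂ => ?_
    simp [NatExpr.eval, BExpr.eval, h₁, h₂]
  | mul e f ihe ihf =>
    intro L hL h
    exact (ihe L hL h.1).mul hL (ihf (L + 1) (by omega) (h.2.mono (by omega)))
      (fun s s' hs => BExpr.eval_congr hL f h.2 hs)
  | lt e f ihe ihf =>
    intro L hL h
    refine (ihe L hL h.1).binary_test hL (ihf (L + 1) (by omega) (h.2.mono (by omega)))
      (fun s s' hs => BExpr.eval_congr hL f h.2 hs) (.natLt (cell L) (cell (L + 1)))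
      fun s s' ha h₁ h₂ => ?_
    simp [Test.Holds, NatExpr.eval, BExpr.eval, h₁, h₂]
  | eq e f ihe ihf =>
    intro L hL h
    refine (ihe L hL h.1).binary_test hL (ihf (L + 1) (by omega) (h.2.mono (by omega)))
      (fun s s' hs => BExpr.eval_congr hL f h.2 hs) (.natEq (cell L) (cell (L + 1)))
      fun s s' ha h₁ h₂ => ?_
    simp [Test.Holds, NatExpr.eval, BExpr.eval, h₁, h₂]
  | realEq e f ihe ihf =>
    intro L hL h
    refine (ihe L hL h.1).binary_test hL (ihf (L + 1) (by omega) (h.2.mono (by omega)))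
      (fun s s' hs => BExpr.eval_congr hL f h.2 hs)
      (.realEq (.read 0 (cell L)) (.read 0 (cell (L + 1)))) fun s s' ha h₁ h₂ => ?_
    simp [Test.Holds, RealExpr.eval, NatExpr.eval, BExpr.eval, h₁, h₂, ha.2]
  | realZero e ih =>
    intro L hL h
    refine (ih L hL h).binary_test hL (Evaluable.const (L + 1) 0) (fun _ _ _ => rfl)
      (.realEq (.read 0 (cell L)) .zero) fun s s' ha h₁ _ => ?_
    simp [Test.Holds, RealExpr.eval, NatExpr.eval, BExpr.eval, h₁, ha.2]
  | realOne e ih =>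
    intro L hL h
    refine (ih L hL h).binary_test hL (Evaluable.const (L + 1) 0) (fun _ _ _ => rfl)
      (.realEq (.read 0 (cell L)) .one) fun s s' ha h₁ _ => ?_
    simp [Test.Holds, RealExpr.eval, NatExpr.eval, BExpr.eval, h₁, ha.2]
  | ite b e f ihb ihe ihf =>
    intro L hL h
    exact (ihb L hL h.1).ite hL (ihe L hL h.2.1) (ihf L hL h.2.2)
      (fun s s' hs => BExpr.eval_congr hL e h.2.1 hs)
      (fun s s' hs => BExpr.eval_congr hL f h.2.2 hs)
  | sum v b e ih =>
    intro L hL h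
    exact Evaluable.sum h.2.1 h.1 b (ih (L + 2) (by omega) (h.2.2.mono (by omega)))
      (fun s s' hs => BExpr.eval_congr hL e h.2.2 hs)

end KProd

namespace KProd

/-! ### Commands with bounded loops -/

/-- Commands. `copyReal a i e` copies cell `e` of the input array to cell `i` of the real array
`a`; in `loop v b c`, cell `0` of array `v` runs through the numbers below the number of rows
(`b = 0`) or columns (`b = 1`) of the input. -/
inductive Cmd
  | skip
  | setNat (a : ℕ) (i e : BExpr)
  | copyReal (a : ℕ) (i e : BExpr)
  | seq (c d : Cmd)
  | ite (b : BExpr) (c d : Cmd)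
  | loop (v : ℕ) (b : Fin 2) (c : Cmd)

/-- The composition of `f 0`, …, `f (k - 1)`, in this order. -/
def iterateUpTo (f : ℕ → State → State) : ℕ → State → State
  | 0, s => s
  | k + 1, s => f k (iterateUpTo f k s)

/-- The memory after the execution of a command. -/
noncomputable def Cmd.exec : Cmd → State → State
  | .skip, s => s
  | .setNat a i e, s => s.setNat a (i.eval s) (e.eval s)
  | .copyReal a i e, s => s.setReal a (i.eval s) (s.real 0 (e.eval s))
  | .seq c d, s => d.exec (c.exec s)
  | .ite b c d, s => if b.eval s = 0 then d.exec s else c.exec s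
  | .loop v b c, s => iterateUpTo (fun i s => c.exec (s.setNat v 0 i)) (s.nat 0 b) s

/-- The command changes no natural arrays but those from `W`, and no real arrays but those
from `R`. -/
def Cmd.WritesOnly (W R : Set ℕ) : Cmd → Prop
  | .skip => True
  | .setNat a _ _ => a ∈ W
  | .copyReal a _ _ => a ∈ R
  | .seq c d | .ite _ c d => c.WritesOnly W R ∧ d.WritesOnly W R
  | .loop v _ c => v ∈ W ∧ c.WritesOnly W R

/-- All natural arrays used by the command have numbers below `L`, and the input arrays are not
overwritten. -/
def Cmd.Below (L : ℕ) : Cmd → Prop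
  | .skip => True
  | .setNat a i e => a < L ∧ a ≠ 0 ∧ i.Below L ∧ e.Below L
  | .copyReal a i e => a ≠ 0 ∧ i.Below L ∧ e.Below L
  | .seq c d => c.Below L ∧ d.Below L
  | .ite b c d => b.Below L ∧ c.Below L ∧ d.Below L
  | .loop v _ c => v < L ∧ v ≠ 0 ∧ c.Below L

/-- The natural arrays outside `W` and the real arrays outside `R` are the same. -/
def State.SameOutside (W R : Set ℕ) (s s' : State) : Prop :=
  (∀ a ∉ W, ∀ i, s'.nat a i = s.nat a i) ∧ ∀ a ∉ R, ∀ i, s'.real a i = s.real a i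

theorem State.SameOutside.refl (W R : Set ℕ) (s : State) : s.SameOutside W R s :=
  ⟨fun _ _ _ => rfl, fun _ _ _ => rfl⟩

theorem State.SameOutside.trans {W R : Set ℕ} {s s' s'' : State} (h : s.SameOutside W R s')
    (h' : s'.SameOutside W R s'') : s.SameOutside W R s'' :=
  ⟨fun a ha i => (h'.1 a ha i).trans (h.1 a ha i), fun a ha i => (h'.2 a ha i).trans (h.2 a ha i)⟩

theorem State.SameOutside.mono {W R W' R' : Set ℕ} {s s' : State} (h : s.SameOutside W R s')
    (hW : W ⊆ W') (hR : R ⊆ R') : s.SameOutside W' R' s' :=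
  ⟨fun a ha i => h.1 a (fun h => ha (hW h)) i, fun a ha i => h.2 a (fun h => ha (hR h)) i⟩

theorem State.SameOutside.setNat {W R : Set ℕ} (s : State) {a : ℕ} (ha : a ∈ W) (i v : ℕ) :
    s.SameOutside W R (s.setNat a i v) :=
  ⟨fun b hb j => by rw [State.setNat_nat_of_ne]; rintro rfl; exact hb ha, fun _ _ _ => rfl⟩

theorem iterateUpTo_induction {f : ℕ → State → State} {s : State} (P : ℕ → State → Prop)
    (h0 : P 0 s) {K : ℕ} (step : ∀ i < K, ∀ u, P i u → P (i + 1) (f i u)) :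
    P K (iterateUpTo f K s) := by
  induction K with
  | zero => exact h0
  | succ K ih => exact step K (by omega) _ (ih fun i hi => step i (by omega))

theorem Cmd.exec_sameOutside {W R : Set ℕ} (c : Cmd) (h : c.WritesOnly W R) (s : State) :
    s.SameOutside W R (c.exec s) := by
  induction c generalizing s with
  | skip => exact .refl W R s
  | setNat a i e => exact .setNat s h _ _
  | copyReal a i e =>
    refine ⟨fun _ _ _ => rfl, fun b hb j => ?_⟩
    have : b ≠ a := by rintro rfl; exact hb h
    simp [Cmd.exec, this]
  | seq c d ihc ihd => exact (ihc h.1 s).trans (ihd h.2 _)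
  | ite b c d ihc ihd =>
    simp only [Cmd.exec]
    split_ifs
    · exact ihd h.2 s
    · exact ihc h.1 s
  | loop v b c ih =>
    exact iterateUpTo_induction (fun _ u => s.SameOutside W R u) (.refl W R s)
      fun i _ u hu => hu.trans ((State.SameOutside.setNat u h.1 _ _).trans (ih h.2 _))

theorem Cmd.Below.writesOnly {L : ℕ} {c : Cmd} (h : c.Below L) :
    c.WritesOnly {a | a < L ∧ a ≠ 0} {a | a ≠ 0} := by
  induction c with
  | skip => trivial
  | setNat a i e => exact ⟨h.1, h.2.1⟩
  | copyReal a i e => exact h.1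
  | seq c d ihc ihd => exact ⟨ihc h.1, ihd h.2⟩
  | ite b c d ihc ihd => exact ⟨ihc h.2.1, ihd h.2.2⟩
  | loop v b c ih => exact ⟨⟨h.1, h.2.1⟩, ih h.2.2⟩

theorem Cmd.Below.mono {L L' : ℕ} (hL : L ≤ L') {c : Cmd} (h : c.Below L) : c.Below L' := by
  induction c with
  | skip => trivial
  | setNat a i e => exact ⟨h.1.trans_le hL, h.2.1, h.2.2.1.mono hL, h.2.2.2.mono hL⟩
  | copyReal a i e => exact ⟨h.1, h.2.1.mono hL, h.2.2.mono hL⟩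
  | seq c d ihc ihd => exact ⟨ihc h.1, ihd h.2⟩
  | ite b c d ihc ihd => exact ⟨h.1.mono hL, ihc h.2.1, ihd h.2.2⟩
  | loop v b c ih => exact ⟨h.1.trans_le hL, h.2.1, ih h.2.2⟩

theorem Cmd.exec_congr {L : ℕ} (hL : 0 < L) (c : Cmd) (h : c.Below L) {s s' : State}
    (hs : s.AgreeBelow L s') : (c.exec s).AgreeBelow L (c.exec s') := by
  induction c generalizing s s' with
  | skip => exact hs
  | setNat a i e =>
    simp only [Cmd.exec, BExpr.eval_congr hL i h.2.2.1 hs, BExpr.eval_congr hL e h.2.2.2 hs]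
    exact hs.setNat _ _ _
  | copyReal a i e =>
    simp only [Cmd.exec, BExpr.eval_congr hL i h.2.1 hs, BExpr.eval_congr hL e h.2.2 hs, hs.2]
    exact hs.setReal _ _ _
  | seq c d ihc ihd => exact ihd h.2 (ihc h.1 hs)
  | ite b c d ihc ihd =>
    simp only [Cmd.exec, BExpr.eval_congr hL b h.1 hs]
    split_ifs
    · exact ihd h.2.2 hs
    · exact ihc h.2.1 hs
  | loop v b c ih =>
    simp only [Cmd.exec, hs.1 0 hL]
    generalize s.nat 0 b = K
    induction K with
    | zero => exact hs
    | succ K ihK => exact ih h.2.2 (ihK.setNat v 0 K)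

/-! ### Compiling commands -/

/-- A program executes the function `f` in polynomial time, up to arrays from `L` on. -/
def Executable (L : ℕ) (f : State → State) : Prop :=
  ∃ (p : Program) (T : ℕ → ℕ), PolyBounded T ∧ ∀ s, ∃ s', RunsWithin p s s' (T s.size) ∧
    (f s).AgreeBelow L s'

/-- The true counter is kept in array `L` and copied to `v` at the start of each pass. By `hfL` and
the compilation at level `L + 1`, the body leaves array `L` alone, so it is even free to change `v`.
-/
theorem Executable.loop {L : ℕ} {f : State → State} {v : ℕ} (hv0 : v ≠ 0) (hvL : v < L)
    (b : Fin 2) (hf : Executable (L + 1) f)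
    (hf' : ∀ s s', s.AgreeBelow L s' → (f s).AgreeBelow L (f s'))
    (hf₀ : ∀ s i, (f s).nat 0 i = s.nat 0 i) (hfL : ∀ s i, (f s).nat L i = s.nat L i) :
    Executable L fun s => iterateUpTo (fun i s => f (s.setNat v 0 i)) (s.nat 0 b) s := by
  obtain ⟨p, T, hT, hp⟩ := hf
  have hL : 0 < L := by omega
  let t : Test := .natLt (cell L) (.read 0 (.const b))
  let body : Program := .seq (storeAt v (cell L)) (.seq p (storeAt L (.add (cell L) (.const 1))))
  refine ⟨.seq (storeAt L (.const 0)) (.while t body),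
    fun N => 3 + (N * ((4 + (T N + 6)) + t.cost + 1) + (t.cost + 1)), ?_, ?_⟩
  · exact (PolyBounded.const _).add ((PolyBounded.id.mul ((((PolyBounded.const _).add
      (hT.add (.const _))).add (.const _)).add (.const _))).add (.const _))
  intro s
  -- Array `0` is not changed, so the loop bound can be read again in every test.
  have hloop : ∀ i j, (iterateUpTo (fun i s => f (s.setNat v 0 i)) i s).nat 0 j = s.nat 0 j := by
    intro i j
    induction i with
    | zero => rfl
    | succ i ih => simp [iterateUpTo, hf₀, hv0.symm, ih]
  let I : ℕ → State → Prop := fun i u =>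
    (iterateUpTo (fun i s => f (s.setNat v 0 i)) i s).AgreeBelow L u ∧ u.nat L 0 = i
  obtain ⟨s₁, hr₁, hs₁⟩ := RunsWithin.while_of_invariant (b := t) (p := body)
    (K := s.nat 0 b) (T := 4 + (T s.size + 6)) (s := s.setNat L 0 0) I (by
      rintro i hi u ⟨hu, huL⟩
      have hb : ∀ j, u.nat 0 j = s.nat 0 j := fun j => by rw [hu.1 0 hL, hloop]
      obtain ⟨u', hr, ha⟩ := hp (u.setNat v 0 i)
      have hsz : (u.setNat v 0 i).size = s.size := by simp [State.size, hb, hv0.symm]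
      have huL' : u'.nat L 0 = i := by
        have : L ≠ v := by omega
        rw [ha.1 L (by omega), hfL]
        simp [this, huL]
      rw [hsz] at hr
      refine ⟨?_, u'.setNat L 0 (i + 1), ?_, ?_, ?_⟩
      · simpa [t, Test.Holds, NatExpr.eval, huL, hb] using hi
      · have e1 := RunsWithin.setNat u v (.const 0) (cell L)
        have e2 := RunsWithin.setNat u' L (.const 0) (.add (cell L) (.const 1))
        simp only [NatExpr.eval, huL] at e1
        simp only [NatExpr.eval, huL'] at e2
        exact e1.seq (hr.seq e2)
      · exact (hf' _ _ (hu.setNat v 0 i)).trans ((ha.mono (by omega)).trans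
          (.setNat_scratch _ le_rfl _ _))
      · simp)
    (by
      rintro u ⟨hu, huL⟩
      have hb : ∀ j, u.nat 0 j = s.nat 0 j := fun j => by rw [hu.1 0 hL, hloop]
      simp [t, Test.Holds, NatExpr.eval, huL, hb])
    ⟨.setNat_scratch _ le_rfl _ _, by simp⟩
  refine ⟨s₁, RunsWithin.seq (RunsWithin.setNat s L (.const 0) (.const 0)) (hr₁.mono ?_), hs₁.1⟩
  have := Nat.mul_le_mul_right (4 + (T s.size + 6) + t.cost + 1) (s.nat_zero_le_size b)
  omega

theorem Cmd.executable (c : Cmd) : ∀ L, 0 < L → c.Below L → Executable L c.exec := by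
  induction c with
  | skip => exact fun L _ _ => ⟨.skip, fun _ => 1, .const 1, fun s => ⟨s, ⟨1, le_rfl, .skip s⟩, .refl L s⟩⟩
  | setNat a i e =>
    intro L hL h
    obtain ⟨p₁, T₁, hT₁, h₁⟩ := i.evaluable L hL h.2.2.1
    obtain ⟨p₂, T₂, hT₂, h₂⟩ := e.evaluable (L + 1) (by omega) (h.2.2.2.mono (by omega))
    refine ⟨.seq p₁ (.seq p₂ (.setNat a (cell L) (cell (L + 1)))), fun N => T₁ N + (T₂ N + 5),
      hT₁.add (hT₂.add (.const _)), fun s => ?_⟩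
    obtain ⟨s₁, hr₁, ha₁, hv₁⟩ := h₁ s
    obtain ⟨s₂, hr₂, ha₂, hv₂⟩ := h₂ s₁
    have ha : s.AgreeBelow L s₂ := ha₁.trans (ha₂.mono (by omega))
    rw [ha₁.size_eq hL] at hr₂
    rw [BExpr.eval_congr hL e h.2.2.2 ha₁] at hv₂
    have e1 := RunsWithin.setNat s₂ a (cell L) (cell (L + 1))
    simp only [NatExpr.eval, hv₂, ha₂.1 L (by omega), hv₁] at e1
    exact ⟨_, hr₁.seq (hr₂.seq e1), ha.setNat _ _ _⟩
  | copyReal a i e =>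
    intro L hL h
    obtain ⟨p₁, T₁, hT₁, h₁⟩ := i.evaluable L hL h.2.1
    obtain ⟨p₂, T₂, hT₂, h₂⟩ := e.evaluable (L + 1) (by omega) (h.2.2.mono (by omega))
    refine ⟨.seq p₁ (.seq p₂ (.setReal a (cell L) (.read 0 (cell (L + 1))))),
      fun N => T₁ N + (T₂ N + 6), hT₁.add (hT₂.add (.const _)), fun s => ?_⟩
    obtain ⟨s₁, hr₁, ha₁, hv₁⟩ := h₁ s
    obtain ⟨s₂, hr₂, ha₂, hv₂⟩ := h₂ s₁
    have ha : s.AgreeBelow L s₂ := ha₁.trans (ha₂.mono (by omega))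
    rw [ha₁.size_eq hL] at hr₂
    rw [BExpr.eval_congr hL e h.2.2 ha₁] at hv₂
    have e1 : RunsWithin _ _ _ 6 := ⟨_, le_rfl, .setReal s₂ a (cell L) (.read 0 (cell (L + 1)))⟩
    simp only [NatExpr.eval, RealExpr.eval, hv₂, ha₂.1 L (by omega), hv₁, ha.2] at e1
    exact ⟨_, hr₁.seq (hr₂.seq e1), ha.setReal _ _ _⟩
  | seq c d ihc ihd =>
    intro L hL h
    obtain ⟨p₁, T₁, hT₁, h₁⟩ := ihc L hL h.1
    obtain ⟨p₂, T₂, hT₂, h₂⟩ := ihd L hL h.2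
    refine ⟨.seq p₁ p₂, fun N => T₁ N + T₂ N, hT₁.add hT₂, fun s => ?_⟩
    obtain ⟨s₁, hr₁, ha₁⟩ := h₁ s
    obtain ⟨s₂, hr₂, ha₂⟩ := h₂ s₁
    -- The input sizes are never overwritten, so the time bound of the second command refers to the
    -- same size as that of the first.
    have hsz : s₁.size = s.size := by
      have := (c.exec_sameOutside h.1.writesOnly s).1 0 (by simp)
      rw [ha₁.size_eq hL]
      simp [State.size, this]
    rw [hsz] at hr₂
    exact ⟨s₂, hr₁.seq hr₂, (Cmd.exec_congr hL d h.2 ha₁).trans ha₂⟩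
  | ite b c d ihc ihd =>
    intro L hL h
    obtain ⟨p₁, T₁, hT₁, h₁⟩ := b.evaluable L hL h.1
    obtain ⟨p₂, T₂, hT₂, h₂⟩ := ihc L hL h.2.1
    obtain ⟨p₃, T₃, hT₃, h₃⟩ := ihd L hL h.2.2
    refine ⟨.seq p₁ (.ite (.natEq (cell L) (.const 0)) p₃ p₂),
      fun N => T₁ N + ((T₂ N + T₃ N) + 5), hT₁.add ((hT₂.add hT₃).add (.const _)), fun s => ?_⟩
    obtain ⟨s₁, hr₁, ha₁, hv₁⟩ := h₁ s
    obtain ⟨s₂, hr₂, ha₂⟩ := h₂ s₁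
    obtain ⟨s₃, hr₃, ha₃⟩ := h₃ s₁
    rw [ha₁.size_eq hL] at hr₂ hr₃
    by_cases hb : b.eval s = 0
    · refine ⟨s₃, hr₁.seq ((RunsWithin.iteTrue ?_ hr₃).mono ?_), ?_⟩
      · simp [Test.Holds, NatExpr.eval, hv₁, hb]
      · simp [Test.cost, NatExpr.cost]; omega
      · simpa [Cmd.exec, hb] using (Cmd.exec_congr hL d h.2.2 ha₁).trans ha₃
    · refine ⟨s₂, hr₁.seq ((RunsWithin.iteFalse ?_ hr₂).mono ?_), ?_⟩
      · simp [Test.Holds, NatExpr.eval, hv₁, hb]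
      · simp [Test.cost, NatExpr.cost]; omega
      · simpa [Cmd.exec, hb] using (Cmd.exec_congr hL c h.2.1 ha₁).trans ha₂
  | loop v b c ih =>
    intro L hL h
    have hw := fun s => (c.exec_sameOutside h.2.2.writesOnly s).1
    exact Executable.loop h.2.1 h.1 b (ih (L + 1) (by omega) (h.2.2.mono (by omega)))
      (fun s s' hs => Cmd.exec_congr hL c h.2.2 hs) (fun s => hw s 0 (by simp))
      (fun s => hw s L (by simp))

end KProd

namespace KProd

/-! ### Conditional independence of sets of rows -/

section Independence

variable {ρ γ : Type}

/-- The columns `c` and `d` agree on the rows from `T`. -/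
def Agree (S : Matrix ρ γ ℝ) (T : Set ρ) (c d : γ) : Prop := ∀ i ∈ T, S i c = S i d

variable {S : Matrix ρ γ ℝ} {Z A B C T T' : Set ρ} {c d e : γ}

theorem Agree.refl (S : Matrix ρ γ ℝ) (T : Set ρ) (c : γ) : Agree S T c c := fun _ _ => rfl

theorem Agree.symm (h : Agree S T c d) : Agree S T d c := fun i hi => (h i hi).symm

theorem agree_comm : Agree S T c d ↔ Agree S T d c := ⟨Agree.symm, Agree.symm⟩

theorem Agree.trans (h : Agree S T c d) (h' : Agree S T d e) : Agree S T c e :=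
  fun i hi => (h i hi).trans (h' i hi)

theorem Agree.mono (h : Agree S T c d) (hT : T' ⊆ T) : Agree S T' c d :=
  fun i hi => h i (hT hi)

theorem agree_union : Agree S (T ∪ T') c d ↔ Agree S T c d ∧ Agree S T' c d :=
  ⟨fun h => ⟨h.mono Set.subset_union_left, h.mono Set.subset_union_right⟩,
    fun h i hi => hi.elim (h.1 i) (h.2 i)⟩

/-- The right-hand sides may be exchanged for columns that agree. -/
theorem Agree.congr_right (h : Agree S T c d) : Agree S T e c ↔ Agree S T e d :=
  ⟨fun h' => h'.trans h, fun h' => h'.trans h.symm⟩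

variable [Fintype γ]

theorem card_filter_univ_congr {α : Type} [Fintype α] {P Q : α → Prop} {hP : DecidablePred P}
    {hQ : DecidablePred Q} (h : ∀ e, P e ↔ Q e) :
    Finset.card {e | P e} = Finset.card {e | Q e} := by
  congr 1
  ext e
  simp [h]

open Classical in
/-- The number of columns that agree with `c` on `Z`. -/
noncomputable def blockCount (S : Matrix ρ γ ℝ) (Z : Set ρ) (c : γ) : ℕ :=
  Finset.card {e | Agree S Z e c}

open Classical in
/-- The number of columns that agree with `c` on `Z` and `A`. -/
noncomputable def sideCount (S : Matrix ρ γ ℝ) (Z A : Set ρ) (c : γ) : ℕ :=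
  Finset.card {e | Agree S Z e c ∧ Agree S A e c}

open Classical in
/-- The number of columns that agree with `c` on `Z` and `A` and with `d` on `B`. -/
noncomputable def jointCount (S : Matrix ρ γ ℝ) (Z A B : Set ρ) (c d : γ) : ℕ :=
  Finset.card {e | Agree S Z e c ∧ Agree S A e c ∧ Agree S B e d}

/-- For a uniformly distributed column, the restrictions to `A` and to `B` are independent given
the restriction to `Z`. -/
def CondIndep (S : Matrix ρ γ ℝ) (Z A B : Set ρ) : Prop :=
  -- The identity between probabilities is multiplied out to one between natural numbers. The
  -- columns `c` and `d` of one block stand for a value on `A` and a value on `B`; no column need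
  -- have both.
  ∀ c d, Agree S Z c d →
    blockCount S Z c * jointCount S Z A B c d = sideCount S Z A c * sideCount S Z B d

/-! ### Rules for conditional independence -/

theorem blockCount_pos (S : Matrix ρ γ ℝ) (Z : Set ρ) (c : γ) : 0 < blockCount S Z c :=
  Finset.card_pos.mpr ⟨c, by simp [Agree.refl]⟩

theorem sideCount_pos (S : Matrix ρ γ ℝ) (Z A : Set ρ) (c : γ) : 0 < sideCount S Z A c :=
  Finset.card_pos.mpr ⟨c, by simp [Agree.refl]⟩

theorem blockCount_congr (h : Agree S Z c d) : blockCount S Z c = blockCount S Z d := by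
  exact card_filter_univ_congr fun e => h.congr_right

theorem sideCount_congr (h : Agree S Z c d) (h' : Agree S A c d) :
    sideCount S Z A c = sideCount S Z A d := by
  exact card_filter_univ_congr fun e => and_congr h.congr_right h'.congr_right

theorem CondIndep.symm (h : CondIndep S Z A B) : CondIndep S Z B A := by
  intro c d hcd
  have := h d c hcd.symm
  rw [blockCount_congr hcd, mul_comm (sideCount S Z B c), ← this]
  congr 1
  refine card_filter_univ_congr fun e => ?_
  rw [hcd.congr_right]
  tauto

/-- Marginalization: the columns with a given value on `C` are sorted by their value on `B`, and the
identities for these values are added up. -/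
theorem CondIndep.mono_right (h : CondIndep S Z A B) (hC : C ⊆ B) : CondIndep S Z A C := by
  classical
  intro c d hcd
  -- The restriction of a column to `B`, extended by zero, serves as the key for sorting.
  let g : γ → ρ → ℝ := fun e i => if i ∈ B then S i e else 0
  have hg : ∀ e f, g e = g f ↔ Agree S B e f := by
    intro e f
    refine ⟨fun h i hi => by simpa [g, hi] using congrFun h i, fun h => funext fun i => ?_⟩
    by_cases hi : i ∈ B
    · simp [g, hi, h i hi]
    · simp [g, hi]
  let F : Finset γ := {e | Agree S Z e d ∧ Agree S C e d}
  have h1 : sideCount S Z C d = ∑ v ∈ F.image g, Finset.card {e ∈ F | g e = v} :=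
    Finset.card_eq_sum_card_image g F
  have h2 : jointCount S Z A C c d = ∑ v ∈ F.image g, Finset.card
      {e ∈ ({e | Agree S Z e c ∧ Agree S A e c ∧ Agree S C e d} : Finset γ) | g e = v} := by
    refine Finset.card_eq_sum_card_fiberwise fun e he => Finset.mem_image_of_mem g ?_
    simp only [Finset.coe_filter, Finset.mem_univ, true_and, Set.mem_ofPred_eq] at he
    simp only [F, Finset.mem_filter, Finset.mem_univ, true_and]
    exact ⟨he.1.trans hcd, he.2.2⟩
  rw [h1, h2, Finset.mul_sum, Finset.mul_sum]
  refine Finset.sum_congr rfl fun v hv => ?_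
  obtain ⟨f, hf, rfl⟩ := Finset.mem_image.mp hv
  simp only [F, Finset.mem_filter, Finset.mem_univ, true_and] at hf
  convert h c f (hcd.trans hf.1.symm) using 2
  · unfold jointCount
    congr 1
    ext e
    simp only [Finset.mem_filter, Finset.mem_univ, true_and, hg]
    exact ⟨fun h => ⟨h.1.1, h.1.2.1, h.2⟩, fun h => ⟨⟨h.1, h.2.1, (h.2.2.mono hC).trans hf.2⟩, h.2.2⟩⟩
  · unfold sideCount
    congr 1
    ext e
    simp only [F, Finset.mem_filter, Finset.mem_univ, true_and, hg]
    exact ⟨fun h => ⟨h.1.1.trans hf.1.symm, h.2⟩,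
      fun h => ⟨⟨h.1.trans hf.1, (h.2.mono hC).trans hf.2⟩, h.2⟩⟩

theorem CondIndep.mono (h : CondIndep S Z A B) {A' B' : Set ρ} (hA : A' ⊆ A) (hB : B' ⊆ B) :
    CondIndep S Z A' B' :=
  (h.mono_right hB).symm.mono_right hA |>.symm

/-- Every combination of values on independent sets of rows is attained. -/
theorem CondIndep.exists_agree (h : CondIndep S Z A B) (hcd : Agree S Z c d) :
    ∃ e, Agree S Z e c ∧ Agree S A e c ∧ Agree S B e d := by
  have : 0 < jointCount S Z A B c d := by
    refine Nat.pos_of_ne_zero fun h0 => ?_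
    have := h c d hcd
    rw [h0, mul_zero] at this
    exact (Nat.mul_pos (sideCount_pos S Z A c) (sideCount_pos S Z B d)).ne this
  obtain ⟨e, he⟩ := Finset.card_pos.mp this
  exact ⟨e, by simpa using he⟩

/-- In terms of probabilities given `Z`: `P(a, b, c) = P(a, b) P(c) = P(a) P(b) P(c) = P(a) P(b,
c)`. This is the rule on which the finest partition rests. -/
theorem CondIndep.contract (h : CondIndep S Z A B) (h' : CondIndep S Z (A ∪ B) C) :
    CondIndep S Z A (B ∪ C) := by
  intro c d hcd
  -- The second hypothesis can only be applied to a single column that has the value of `c` on `A`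
  -- and that of `d` on `B`; the first one provides it.
  obtain ⟨e, heZ, heA, heB⟩ := h.exists_agree hcd
  have hed : Agree S Z e d := heZ.trans hcd
  have h1 := h c d hcd
  have h2 := h' e d hed
  have h3 := (h'.mono Set.subset_union_right subset_rfl : CondIndep S Z B C) d d (.refl S Z d)
  have e1 : sideCount S Z (A ∪ B) e = jointCount S Z A B c d := by
    refine card_filter_univ_congr fun f => ?_
    rw [agree_union, heZ.congr_right, heA.congr_right, heB.congr_right]
  have e2 : jointCount S Z (A ∪ B) C e d = jointCount S Z A (B ∪ C) c d := by
    refine card_filter_univ_congr fun f => ?_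
    rw [agree_union, agree_union, heZ.congr_right, heA.congr_right, heB.congr_right, and_assoc]
  have e3 : jointCount S Z B C d d = sideCount S Z (B ∪ C) d := by
    refine card_filter_univ_congr fun f => ?_
    rw [agree_union]
  rw [e1, e2, blockCount_congr heZ] at h2
  rw [e3, ← blockCount_congr hcd] at h3
  refine Nat.eq_of_mul_eq_mul_left (blockCount_pos S Z c) ?_
  calc blockCount S Z c * (blockCount S Z c * jointCount S Z A (B ∪ C) c d)
      = (blockCount S Z c * jointCount S Z A B c d) * sideCount S Z C d := by rw [h2]; ring
    _ = sideCount S Z A c * (sideCount S Z B d * sideCount S Z C d) := by rw [h1]; ring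
    _ = blockCount S Z c * (sideCount S Z A c * sideCount S Z (B ∪ C) d) := by rw [← h3]; ring

/-- Rows that are constant on each block may be added. -/
theorem CondIndep.union_of_const (h : CondIndep S Z A B)
    (hC : ∀ c d, Agree S Z c d → Agree S C c d) : CondIndep S Z A (B ∪ C) := by
  intro c d hcd
  rw [show sideCount S Z (B ∪ C) d = sideCount S Z B d from ?_,
    show jointCount S Z A (B ∪ C) c d = jointCount S Z A B c d from ?_]
  · exact h c d hcd
  · refine card_filter_univ_congr fun e => ?_
    rw [agree_union]
    exact ⟨fun h => ⟨h.1, h.2.1, h.2.2.1⟩, fun h => ⟨h.1, h.2.1, h.2.2, hC _ _ (h.1.trans hcd)⟩⟩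
  · refine card_filter_univ_congr fun e => ?_
    rw [agree_union]
    exact ⟨fun h => ⟨h.1, h.2.1⟩, fun h => ⟨h.1, h.2, hC _ _ h.1⟩⟩

theorem CondIndep.empty (S : Matrix ρ γ ℝ) (Z A : Set ρ) : CondIndep S Z A ∅ := by
  intro c d hcd
  have : ∀ e f, Agree S ∅ e f := fun e f i hi => hi.elim
  rw [mul_comm, blockCount_congr hcd]
  congr 1
  · exact card_filter_univ_congr fun e => by simp [this]
  · exact card_filter_univ_congr fun e => by simp [this]

theorem CondIndep.of_const (hC : ∀ c d, Agree S Z c d → Agree S C c d) : CondIndep S Z A C := by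
  simpa using (CondIndep.empty S Z A).union_of_const hC

end Independence

/-! ### The finest partition into independent sets -/

section Labels

variable {m : ℕ} {γ : Type} [Fintype γ]

/-- The rows before `p` with label `l`. -/
def labelClass (m : ℕ) (lab : ℕ → ℕ) (p l : ℕ) : Set (Fin m) := {i | i < p ∧ lab i = l}

/-- The rows before `p` with another label than `l`. -/
def labelRest (m : ℕ) (lab : ℕ → ℕ) (p l : ℕ) : Set (Fin m) := {i | i < p ∧ lab i ≠ l}

/-- `lab` describes the finest partition of the rows before `p` into independent sets. -/
structure FinestLabels (S : Matrix (Fin m) γ ℝ) (Z : Set (Fin m)) (lab : ℕ → ℕ) (p : ℕ) :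
    Prop where
  lt : ∀ i < p, lab i < p
  indep : ∀ l, CondIndep S Z (labelClass m lab p l) (labelRest m lab p l)
  finest : ∀ X Y : Set (Fin m), X ∪ Y = {i : Fin m | (i : ℕ) < p} → Disjoint X Y →
    CondIndep S Z X Y → ∀ i j : Fin m, i < p → j < p → lab i = lab j → i ∈ X → j ∈ X

open Classical in
/-- The labels after row `p` has been taken into account. -/
noncomputable def nextLabels (S : Matrix (Fin m) γ ℝ) (Z : Set (Fin m)) (lab : ℕ → ℕ) (p : ℕ)
    (i : ℕ) : ℕ :=
  if i = p then p
  -- All classes that row `p` makes dependent on the other rows are merged with it at once; the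
  -- others keep their labels.
  else if i < p ∧ ¬ CondIndep S Z (labelClass m lab p (lab i))
    (labelRest m lab p (lab i) ∪ {j | j = p}) then p
  else lab i

variable {S : Matrix (Fin m) γ ℝ} {Z : Set (Fin m)} {lab : ℕ → ℕ} {p : ℕ}

theorem FinestLabels.zero (S : Matrix (Fin m) γ ℝ) (Z : Set (Fin m)) (lab : ℕ → ℕ) :
    FinestLabels S Z lab 0 := by
  refine ⟨by simp, fun l => ?_, by simp⟩
  have : labelRest m lab 0 l = ∅ := by simp [labelRest]
  rw [this]
  exact .empty S Z _

/-- The complement of a finite union of sets that are independent of the rest is independent of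
that union. -/
theorem CondIndep.biUnion {ρ : Type} {S : Matrix ρ γ ℝ} {Z : Set ρ} {ι : Type} (I : Finset ι) (X : ι → Set ρ)
    (R : Set ρ) (hX : (I : Set ι).PairwiseDisjoint X)
    (hR : ∀ l ∈ I, Disjoint R (X l))
    (h : ∀ l ∈ I, CondIndep S Z (X l) (((⋃ k ∈ I, X k) ∪ R) \ X l)) :
    CondIndep S Z R (⋃ k ∈ I, X k) := by
  classical
  induction I using Finset.induction_on generalizing R with
  | empty => simpa using CondIndep.empty S Z R
  | insert l I hl ih =>
    have hU : (⋃ k ∈ insert l I, X k) = (⋃ k ∈ I, X k) ∪ X l := by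
      simp [Finset.mem_insert, Set.iUnion_or, Set.iUnion_union_distrib, Set.union_comm]
    have hdis : Disjoint (⋃ k ∈ I, X k) (X l) := by
      simp only [Set.disjoint_iUnion_left]
      intro k hk
      exact hX (by simp [hk]) (by simp) (by rintro rfl; exact hl hk)
    -- The induction hypothesis is used with `X l` moved from the union to the remainder.
    -- Contraction then joins `X l` to the other sets again.
    have h1 : CondIndep S Z (R ∪ X l) (⋃ k ∈ I, X k) := by
      refine ih (R ∪ X l) (hX.subset (by simp)) (fun k hk => ?_) fun k hk => ?_
      · refine Set.disjoint_union_left.mpr ⟨hR k (by simp [hk]), ?_⟩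
        exact hX (by simp) (by simp [hk]) (by rintro rfl; exact hl hk)
      · refine (h k (by simp [hk])).mono subset_rfl (Set.sdiff_subset_sdiff_left ?_)
        rw [hU]
        intro i hi
        simp only [Set.mem_union] at hi ⊢
        tauto
    have h2 : CondIndep S Z R (X l) := by
      refine ((h l (by simp)).mono subset_rfl ?_).symm
      exact Set.subset_sdiff.mpr ⟨Set.subset_union_right, hR l (by simp)⟩
    have h3 : CondIndep S Z R (X l ∪ ⋃ k ∈ I, X k) := h2.contract h1
    rw [hU, Set.union_comm]
    exact h3

/-- A surviving class is independent of the rest by the test that it passed, and the class of `p` is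
the complement of the surviving ones, to which `CondIndep.biUnion` applies. The new partition is
finest because a class inside a part that does not contain `p` passes the test, so every merged row
lies in the same part as `p`. -/
theorem FinestLabels.next (h : FinestLabels S Z lab p) (hp : p < m) :
    FinestLabels S Z (nextLabels S Z lab p) (p + 1) := by
  classical
  let good : ℕ → Prop := fun l => CondIndep S Z (labelClass m lab p l)
    (labelRest m lab p l ∪ {j | j = p})
  have hlt : ∀ i < p, nextLabels S Z lab p i = if good (lab i) then lab i else p := by
    intro i hi
    have : i ≠ p := by omega
    simp only [nextLabels, this, if_false, hi, true_and, good]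
    split_ifs <;> tauto
  have hself : nextLabels S Z lab p p = p := by simp [nextLabels]
  -- the classes with labels other than `p` are the old ones that are still independent
  have hclass : ∀ l < p, (good l ∧ labelClass m (nextLabels S Z lab p) (p + 1) l =
      labelClass m lab p l ∧ labelRest m (nextLabels S Z lab p) (p + 1) l =
        labelRest m lab p l ∪ {j | j = p}) ∨
      labelClass m (nextLabels S Z lab p) (p + 1) l = ∅ := by
    intro l hl
    by_cases hg : good l
    · refine .inl ⟨hg, ?_, ?_⟩
      · ext i
        simp only [labelClass, Set.mem_ofPred_eq]
        rcases lt_trichotomy (i : ℕ) p with hi | hi | hi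
        · rw [hlt i hi]
          split_ifs with hgi
          · exact ⟨fun h => ⟨hi, h.2⟩, fun h => ⟨by omega, h.2⟩⟩
          · exact ⟨fun h => by omega, fun h => by rw [h.2] at hgi; exact (hgi hg).elim⟩
        · rw [hi, hself]; omega
        · omega
      · ext i
        simp only [labelRest, Set.mem_ofPred_eq, Set.mem_union]
        rcases lt_trichotomy (i : ℕ) p with hi | hi | hi
        · rw [hlt i hi]
          split_ifs with hgi
          · exact ⟨fun h => .inl ⟨hi, h.2⟩, fun h => ⟨by omega, by omega⟩⟩
          · refine ⟨fun _ => .inl ⟨hi, ?_⟩, fun _ => ⟨by omega, by omega⟩⟩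
            rintro rfl
            exact hgi hg
        · rw [hi, hself]; omega
        · omega
    · refine .inr ?_
      ext i
      simp only [labelClass, Set.mem_ofPred_eq, Set.mem_empty_iff_false, iff_false, not_and]
      intro hi
      rcases lt_or_eq_of_le (Nat.lt_succ_iff.mp hi) with hi | hi
      · rw [hlt i hi]
        split_ifs with hgi
        · rintro rfl; exact hg hgi
        · omega
      · rw [hi, hself]; omega
  have hle : ∀ i < p + 1, nextLabels S Z lab p i < p + 1 := by
    intro i hi
    rcases lt_or_eq_of_le (Nat.lt_succ_iff.mp hi) with hi | hi
    · rw [hlt i hi]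
      have := h.lt i hi
      split_ifs <;> omega
    · rw [hi, hself]; omega
  have hindep : ∀ l < p, CondIndep S Z (labelClass m (nextLabels S Z lab p) (p + 1) l)
      (labelRest m (nextLabels S Z lab p) (p + 1) l) := by
    intro l hl
    rcases hclass l hl with ⟨hg, e1, e2⟩ | e1
    · rw [e1, e2]; exact hg
    · rw [e1]; exact (CondIndep.empty S Z _).symm
  refine ⟨hle, fun l => ?_, ?_⟩
  · rcases lt_trichotomy l p with hl | rfl | hl
    · exact hindep l hl
    -- The label equal to the new row: this class is the remainder after all classes with smaller
    -- labels are removed.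
    · have key := CondIndep.biUnion (S := S) (Z := Z) (Finset.range l)
        (fun k => labelClass m (nextLabels S Z lab l) (l + 1) k)
        (labelClass m (nextLabels S Z lab l) (l + 1) l) ?_ ?_ ?_
      · refine key.mono subset_rfl fun i hi => ?_
        have := hle i hi.1
        have hne : nextLabels S Z lab l i ≠ l := hi.2
        simp only [Set.mem_iUnion, Finset.mem_range]
        exact ⟨nextLabels S Z lab l i, by omega, hi.1, rfl⟩
      · intro k _ k' _ hkk
        exact Set.disjoint_left.mpr fun i hi hi' => hkk (hi.2.symm.trans hi'.2)
      · intro k hk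
        have := Finset.mem_range.mp hk
        exact Set.disjoint_left.mpr fun i hi hi' => by
          have := hi.2.symm.trans hi'.2
          omega
      · intro k hk
        refine (hindep k (Finset.mem_range.mp hk)).mono subset_rfl ?_
        rintro i ⟨hi, hik⟩
        have hi1 : (i : ℕ) < l + 1 := by
          rcases hi with hi | hi
          · simp only [Set.mem_iUnion] at hi
            obtain ⟨_, _, hi⟩ := hi
            exact hi.1
          · exact hi.1
        exact ⟨hi1, fun h => hik ⟨hi1, h⟩⟩
    · have : labelClass m (nextLabels S Z lab p) (p + 1) l = ∅ := by
        ext i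
        simp only [labelClass, Set.mem_ofPred_eq, Set.mem_empty_iff_false, iff_false, not_and]
        intro hi
        have := hle i hi
        omega
      rw [this]
      exact (CondIndep.empty S Z _).symm
  · -- a set that avoids row `p` contains no relabelled row
    have avoid : ∀ X Y : Set (Fin m), X ∪ Y = {i : Fin m | (i : ℕ) < p + 1} → Disjoint X Y →
        CondIndep S Z X Y → ⟨p, hp⟩ ∈ Y → ∀ i : Fin m, i < p → i ∈ X → good (lab i) := by
      intro X Y hXY hd hind hpY i hi hiX
      have hXp : ∀ j ∈ X, (j : ℕ) < p := by
        intro j hj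
        have h1 : (j : ℕ) < p + 1 := by
          have : j ∈ X ∪ Y := .inl hj
          rwa [hXY] at this
        rcases lt_or_eq_of_le (Nat.lt_succ_iff.mp h1) with h2 | h2
        · exact h2
        · have : j = ⟨p, hp⟩ := Fin.ext h2
          subst this
          exact (Set.disjoint_left.mp hd hj hpY).elim
      -- Without row `p`, the two parts form an independent partition of the earlier rows, which the
      -- old labels refine.
      have hsub : labelClass m lab p (lab i) ⊆ X := by
        intro j hj
        have hmem : ∀ k : Fin m, (k : ℕ) < p → k ∈ X ∪ Y := by
          intro k hk
          rw [hXY]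
          exact Nat.lt_succ_of_lt hk
        refine h.finest X (Y ∩ {i | (i : ℕ) < p}) ?_ (hd.mono_right Set.inter_subset_left)
          (hind.mono subset_rfl Set.inter_subset_left) i j hi hj.1 hj.2.symm hiX
        ext k
        simp only [Set.mem_union, Set.mem_inter_iff, Set.mem_ofPred_eq]
        constructor
        · rintro (hk | hk)
          · exact hXp k hk
          · exact hk.2
        · intro hk
          rcases hmem k hk with h | h
          · exact .inl h
          · exact .inr ⟨h, hk⟩
      -- The class is independent of the rest of `X`, and `X` is independent of `Y`. By contraction
      -- the class is independent of both together, which include row `p` and all other earlier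
      -- rows.
      have h1 : CondIndep S Z (labelClass m lab p (lab i)) (X \ labelClass m lab p (lab i)) := by
        refine (h.indep (lab i)).mono subset_rfl fun j hj => ⟨hXp j hj.1, fun hl => ?_⟩
        exact hj.2 ⟨hXp j hj.1, hl⟩
      have h2 := h1.contract (C := Y) (by rwa [Set.union_sdiff_cancel hsub])
      refine h2.mono subset_rfl fun j hj => ?_
      have hjXY : j ∈ X ∪ Y := by
        rw [hXY]
        rcases hj with hj | hj
        · exact Nat.lt_succ_of_lt hj.1
        · have : (j : ℕ) = p := hj
          simp [this]
      rcases hjXY with hjX | hjY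
      · refine .inl ⟨hjX, fun hjc => ?_⟩
        rcases hj with hj | hj
        · exact hj.2 hjc.2
        · exact (hXp j hjX).ne hj
      · exact .inr hjY
    have main : ∀ X Y : Set (Fin m), X ∪ Y = {i : Fin m | (i : ℕ) < p + 1} → Disjoint X Y →
        CondIndep S Z X Y → ⟨p, hp⟩ ∈ Y → ∀ i j : Fin m, i < p + 1 → j < p + 1 →
        nextLabels S Z lab p i = nextLabels S Z lab p j → i ∈ X → j ∈ X := by
      intro X Y hXY hd hind hpY i j hi hj hij hiX
      have hip : (i : ℕ) < p := by
        rcases lt_or_eq_of_le (Nat.lt_succ_iff.mp hi) with h2 | h2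
        · exact h2
        · have : i = ⟨p, hp⟩ := Fin.ext h2
          subst this
          exact (Set.disjoint_left.mp hd hiX hpY).elim
      have hgi := avoid X Y hXY hd hind hpY i hip hiX
      have hli := h.lt i hip
      rw [hlt i hip, if_pos hgi] at hij
      rcases lt_or_eq_of_le (Nat.lt_succ_iff.mp hj) with hjp | hjp
      · rw [hlt j hjp] at hij
        split_ifs at hij with hgj
        · by_contra hjX
          refine hjX (h.finest X (Y ∩ {i | (i : ℕ) < p}) ?_ (hd.mono_right Set.inter_subset_left)
            (hind.mono subset_rfl Set.inter_subset_left) i j hip hjp hij hiX)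
          ext k
          simp only [Set.mem_union, Set.mem_inter_iff, Set.mem_ofPred_eq]
          constructor
          · rintro (hk | hk)
            · have h1 : (k : ℕ) < p + 1 := by
                have : k ∈ X ∪ Y := .inl hk
                rwa [hXY] at this
              have h2 : (k : ℕ) ≠ p := by
                rintro h2
                have : k = ⟨p, hp⟩ := Fin.ext h2
                subst this
                exact Set.disjoint_left.mp hd hk hpY
              omega
            · exact hk.2
          · intro hk
            have : k ∈ X ∪ Y := by
              rw [hXY]
              exact Nat.lt_succ_of_lt hk
            rcases this with h | h
            · exact .inl h
            · exact .inr ⟨h, hk⟩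
        · omega
      · rw [hjp, hself] at hij
        omega
    intro X Y hXY hd hind i j hi hj hij hiX
    have hpm : (⟨p, hp⟩ : Fin m) ∈ X ∪ Y := by
      rw [hXY]
      exact Nat.lt_succ_self p
    rcases hpm with hpX | hpY
    -- If `p` lies in `X`, the argument is applied to `Y`: a row `j` of `Y` with the label of `i`
    -- would put `i` into `Y` as well.
    · by_contra hjX
      have hjY : j ∈ Y := by
        have : j ∈ X ∪ Y := by rw [hXY]; exact hj
        exact this.resolve_left hjX
      have := main Y X (by rw [Set.union_comm, hXY]) hd.symm hind.symm hpX j i hj hi hij.symm hjY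
      exact Set.disjoint_left.mp hd hiX this
    · exact main X Y hXY hd hind hpY i j hi hj hij hiX

end Labels

end KProd

namespace KProd

/-! ### Splitting blocks of columns -/

section Split

variable {ρ γ : Type} [Fintype γ]

/-- `b` is a possible number of columns of the second factor in the block of column `c`, if the
first factor has the rows `A` and the second one has the rows `B`. -/
structure ValidSplit (S : Matrix ρ γ ℝ) (Z A B : Set ρ) (b : ℕ) (c : γ) : Prop where
  pos : 0 < b
  dvd : b ∣ blockCount S Z c
  left : ∀ d, Agree S Z d c → b ∣ sideCount S Z A d
  -- Each class on `B` must be a multiple of the quotient of the block size by `b`; both sides are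
  -- multiplied by `b` to avoid the quotient.
  right : ∀ d, Agree S Z d c → blockCount S Z c ∣ sideCount S Z B d * b

variable {S : Matrix ρ γ ℝ} {Z A B T : Set ρ} {b : ℕ} {c d : γ}

theorem ValidSplit.congr (h : ValidSplit S Z A B b c) (hcd : Agree S Z c d) :
    ValidSplit S Z A B b d where
  pos := h.pos
  dvd := blockCount_congr hcd ▸ h.dvd
  left e he := h.left e (he.trans hcd.symm)
  right e he := blockCount_congr hcd ▸ h.right e (he.trans hcd.symm)

theorem validSplit_congr (hcd : Agree S Z c d) :
    ValidSplit S Z A B b c ↔ ValidSplit S Z A B b d :=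
  ⟨fun h => h.congr hcd, fun h => h.congr hcd.symm⟩

theorem ValidSplit.le_blockCount (h : ValidSplit S Z A B b c) : b ≤ blockCount S Z c :=
  Nat.le_of_dvd (blockCount_pos S Z c) h.dvd

/-- A number that divides the sizes of all classes of a block divides the size of the block. -/
theorem dvd_blockCount (h : ∀ d, Agree S Z d c → b ∣ sideCount S Z A d) :
    b ∣ blockCount S Z c := by
  classical
  let g : γ → ρ → ℝ := fun e i => if i ∈ A then S i e else 0
  have hg : ∀ e f, g e = g f ↔ Agree S A e f := by
    intro e f
    refine ⟨fun h i hi => by simpa [g, hi] using congrFun h i, fun h => funext fun i => ?_⟩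
    by_cases hi : i ∈ A
    · simp [g, hi, h i hi]
    · simp [g, hi]
  have h1 : blockCount S Z c = _ :=
    Finset.card_eq_sum_card_image g ({e | Agree S Z e c} : Finset γ)
  rw [h1]
  refine Finset.dvd_sum fun v hv => ?_
  obtain ⟨f, hf, rfl⟩ := Finset.mem_image.mp hv
  simp only [Finset.mem_filter, Finset.mem_univ, true_and] at hf
  have h2 : Finset.card {e ∈ ({e | Agree S Z e c} : Finset γ) | g e = g f} =
      sideCount S Z A f := by
    rw [Finset.filter_filter]
    exact card_filter_univ_congr fun e => and_congr hf.symm.congr_right (hg e f)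
  rw [h2]
  exact h f hf

/-- Take the greatest common divisor of the sizes of the `A`-classes. Independence says that the
block size divides each of these sizes times the size of a `B`-class, hence also their greatest
common divisor times that size. -/
theorem CondIndep.exists_validSplit (h : CondIndep S Z A B) (c : γ) :
    ∃ b, ValidSplit S Z A B b c := by
  classical
  let K : Finset γ := {e | Agree S Z e c}
  have hK : ∀ e, e ∈ K ↔ Agree S Z e c := fun e => by simp [K]
  have hleft : ∀ d, Agree S Z d c → K.gcd (sideCount S Z A) ∣ sideCount S Z A d :=
    fun d hd => Finset.gcd_dvd ((hK d).mpr hd)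
  have hdvd := dvd_blockCount hleft
  refine ⟨K.gcd (sideCount S Z A), Nat.pos_of_dvd_of_pos hdvd (blockCount_pos S Z c), hdvd, hleft,
    fun d hd => ?_⟩
  rw [mul_comm]
  have := Finset.gcd_mul_right (s := K) (f := sideCount S Z A) (a := sideCount S Z B d)
  rw [normalize_eq] at this
  rw [← this]
  refine Finset.dvd_gcd fun e he => ?_
  have he := (hK e).mp he
  rw [← h e d (he.trans hd.symm), blockCount_congr he]
  exact Dvd.intro _ rfl

theorem sideCount_lt_blockCount (h : Agree S Z c d) (h' : ¬ Agree S T c d) :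
    sideCount S Z T c < blockCount S Z c := by
  classical
  refine Finset.card_lt_card (Finset.ssubset_iff_subset_ne.mpr ⟨fun e he => ?_, fun he => ?_⟩)
  · simp only [Finset.mem_filter, Finset.mem_univ, true_and] at he ⊢
    exact he.1
  · have : d ∈ ({e | Agree S Z e c} : Finset γ) := by simpa using h.symm
    rw [← he] at this
    simp only [Finset.mem_filter, Finset.mem_univ, true_and] at this
    exact h' this.2.symm

/-- For `b = 1`, the whole block size would divide the size of a `B`-class, which is smaller when
`B` is not constant on the block. -/
theorem ValidSplit.two_le (h : ValidSplit S Z A B b c) (hcd : Agree S Z c d)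
    (hB : ¬ Agree S B c d) : 2 ≤ b := by
  have h1 := sideCount_lt_blockCount hcd hB
  have h2 := h.right c (.refl S Z c)
  have h3 := h.pos
  by_contra hb
  have : b = 1 := by omega
  rw [this, mul_one] at h2
  exact absurd (Nat.le_of_dvd (sideCount_pos S Z B c) h2) (by omega)

/-- The number `b` divides the size of an `A`-class, which is a proper part of the block. -/
theorem ValidSplit.lt_blockCount (h : ValidSplit S Z A B b c) (hcd : Agree S Z c d)
    (hA : ¬ Agree S A c d) : b < blockCount S Z c :=
  (Nat.le_of_dvd (sideCount_pos S Z A c) (h.left c (.refl S Z c))).trans_lt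
    (sideCount_lt_blockCount hcd hA)

theorem sideCount_eq_blockCount (hT : ∀ e, Agree S Z e c → Agree S T e c) :
    sideCount S Z T c = blockCount S Z c :=
  card_filter_univ_congr fun e => and_iff_left_of_imp (hT e)

end Split

/-! ### Splittings of a matrix -/

section RowSplit

variable {m r : ℕ} {γ : Type} [Fintype γ]

/-- The rows of `S` other than the special rows `z` are split into two nonempty sets `A` and `B`
that are independent given the special rows, and `b c` is the number of columns of the second
factor in the block of `c`. -/
structure RowSplit (S : Matrix (Fin m) γ ℝ) (z : Fin r → Fin m) (A B : Set (Fin m))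
    (b : γ → ℕ) : Prop where
  special : SpecialRows S z
  cover : ∀ i, i ∈ A ∨ i ∈ B ∨ i ∈ Set.range z
  disjoint : Disjoint A B
  left_special : Disjoint A (Set.range z)
  right_special : Disjoint B (Set.range z)
  left_nonempty : A.Nonempty
  right_nonempty : B.Nonempty
  indep : CondIndep S (Set.range z) A B
  valid : ∀ c, ValidSplit S (Set.range z) A B (b c) c
  congr : ∀ c d, Agree S (Set.range z) c d → b c = b d

/-- Both factors have fewer columns than `S`. -/
def StrictSplit (S : Matrix (Fin m) γ ℝ) (z : Fin r → Fin m) (b : γ → ℕ) : Prop :=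
  -- In a block of `N` columns the first factor has `N / b` and the second one `b` columns. Hence
  -- the first factor saves columns where `b ≥ 2`, and the second one where `b < N`.
  (∃ c, 2 ≤ b c) ∧ ∃ c, b c < blockCount S (Set.range z) c

variable {S : Matrix (Fin m) γ ℝ} {z : Fin r → Fin m} {A B : Set (Fin m)} {b : γ → ℕ}

theorem SpecialRows.nonempty {ρ γ : Type} {S : Matrix ρ γ ℝ} {z : Fin r → ρ}
    (h : SpecialRows S z) : Nonempty γ := by
  have : (simplexVertex none : Fin r → ℝ) ∈ Set.range (simplexVertex (r := r)) := ⟨none, rfl⟩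
  rw [← h] at this
  exact ⟨this.choose⟩

/-- Exchanging the roles of the two factors. -/
theorem RowSplit.swap (h : RowSplit S z A B b) :
    RowSplit S z B A fun c => blockCount S (Set.range z) c / b c where
  special := h.special
  cover i := by have := h.cover i; tauto
  disjoint := h.disjoint.symm
  left_special := h.right_special
  right_special := h.left_special
  left_nonempty := h.right_nonempty
  right_nonempty := h.left_nonempty
  indep := h.indep.symm
  congr c d hcd := by rw [blockCount_congr hcd, h.congr c d hcd]
  valid c := by
    have hv := h.valid c
    obtain ⟨q, hq⟩ := hv.dvd
    have hdiv : blockCount S (Set.range z) c / b c = q := by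
      rw [hq, Nat.mul_div_cancel_left _ hv.pos]
    have hpos := blockCount_pos S (Set.range z) c
    rw [hdiv]
    refine ⟨Nat.pos_of_ne_zero ?_, ⟨b c, by rw [hq, mul_comm]⟩, fun d hd => ?_, fun d hd => ?_⟩
    · rintro rfl
      omega
    · have := hv.right d hd
      rw [hq, mul_comm] at this
      exact Nat.dvd_of_mul_dvd_mul_right hv.pos this
    · rw [hq]
      exact Nat.mul_dvd_mul_right (hv.left d hd) q

theorem StrictSplit.swap (hs : StrictSplit S z b) (h : RowSplit S z A B b) :
    StrictSplit S z fun c => blockCount S (Set.range z) c / b c := by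
  obtain ⟨⟨c, hc⟩, d, hd⟩ := hs
  refine ⟨⟨d, ?_⟩, c, Nat.div_lt_self (blockCount_pos _ _ _) hc⟩
  obtain ⟨q, hq⟩ := (h.valid d).dvd
  show 2 ≤ blockCount S (Set.range z) d / b d
  have hp := (h.valid d).pos
  rw [hq] at hd ⊢
  rw [Nat.mul_div_cancel_left _ hp]
  by_contra hlt
  have : q ≤ 1 := by omega
  have := Nat.mul_le_mul_left (b d) this
  omega

/-! ### Shrinking the first part to a class of the finest partition -/

variable {lab : ℕ → ℕ}

/-- The classes are the atoms of independence: `finest`, applied to `X` and its complement, does not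
let a class cross the boundary of `X`. -/
theorem FinestLabels.subset_of_mem (h : FinestLabels S (Set.range z) lab m) {X : Set (Fin m)}
    (hX : CondIndep S (Set.range z) X Xᶜ) {w : Fin m} (hw : w ∈ X) :
    labelClass m lab m (lab w) ⊆ X := by
  intro j hj
  exact h.finest X Xᶜ (by ext; simp) disjoint_compl_right hX w j w.2 j.2 hj.2.symm hw

/-- A special row is constant on each block and thus independent of everything, so its class
consists of this row alone. -/
theorem FinestLabels.disjoint_special (h : FinestLabels S (Set.range z) lab m) {w : Fin m}
    (hw : w ∉ Set.range z) : Disjoint (labelClass m lab m (lab w)) (Set.range z) := by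
  refine Set.disjoint_left.mpr ?_
  rintro _ hi ⟨l, rfl⟩
  have := h.subset_of_mem (X := {z l})
    (CondIndep.of_const fun c d hcd => hcd.mono (by simp)).symm rfl
    (show w ∈ labelClass m lab m (lab (z l)) from ⟨w.2, hi.2.symm⟩)
  exact hw ⟨l, this.symm⟩

/-- The special rows are constant on blocks and can be added to `B` at no cost. -/
theorem RowSplit.indep_compl (h : RowSplit S z A B b) : CondIndep S (Set.range z) A Aᶜ := by
  refine (h.indep.union_of_const (C := Set.range z) fun c d h => h).mono subset_rfl ?_
  intro i hi
  exact (h.cover i).resolve_left hi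

/-- A class of the finest partition inside one part gives rise to a splitting. -/
theorem RowSplit.refine (h : RowSplit S z A B b) (hl : FinestLabels S (Set.range z) lab m)
    {w : Fin m} (hw : w ∈ A) (b' : γ → ℕ)
    (hb : ∀ c, ValidSplit S (Set.range z) (labelClass m lab m (lab w))
      (labelRest m lab m (lab w) \ Set.range z) (b' c) c)
    (hb' : ∀ c d, Agree S (Set.range z) c d → b' c = b' d) :
    RowSplit S z (labelClass m lab m (lab w)) (labelRest m lab m (lab w) \ Set.range z) b' where
  special := h.special
  cover i := by
    by_cases hi : lab i = lab w
    · exact .inl ⟨i.2, hi⟩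
    · by_cases hz : i ∈ Set.range z
      · exact .inr (.inr hz)
      · exact .inr (.inl ⟨⟨i.2, hi⟩, hz⟩)
  disjoint := Set.disjoint_left.mpr fun i hi hi' => hi'.1.2 hi.2
  left_special := hl.disjoint_special (Set.disjoint_left.mp h.left_special hw)
  right_special := Set.disjoint_sdiff_left
  left_nonempty := ⟨w, w.2, rfl⟩
  right_nonempty := by
    -- The class of `w` stays inside `A`, so the rows of `B` remain on the other side.
    obtain ⟨j, hj⟩ := h.right_nonempty
    refine ⟨j, ⟨j.2, fun hjw => ?_⟩, Set.disjoint_left.mp h.right_special hj⟩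
    exact Set.disjoint_left.mp h.disjoint (hl.subset_of_mem h.indep_compl hw ⟨j.2, hjw⟩) hj
  indep := (hl.indep (lab w)).mono subset_rfl Set.sdiff_subset
  valid := hb
  congr := hb'

/-- The smallest possible number of columns of the second factor in the block of `c`. -/
noncomputable def minSplit (S : Matrix (Fin m) γ ℝ) (Z A B : Set (Fin m)) (c : γ) : ℕ :=
  sInf {b | ValidSplit S Z A B b c}

theorem minSplit_congr {Z : Set (Fin m)} {c d : γ} (h : Agree S Z c d) :
    minSplit S Z A B c = minSplit S Z A B d := by
  simp only [minSplit, validSplit_congr h]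

theorem CondIndep.minSplit_valid {Z : Set (Fin m)} (h : CondIndep S Z A B) (c : γ) :
    ValidSplit S Z A B (minSplit S Z A B c) c :=
  Nat.sInf_mem (h.exists_validSplit c)

/-- Any row of `A` will do. The numbers of columns are chosen anew, which independence permits. -/
theorem RowSplit.exists_label (h : RowSplit S z A B b)
    (hl : FinestLabels S (Set.range z) lab m) :
    ∃ w ∉ Set.range z, ∃ b', RowSplit S z (labelClass m lab m (lab w))
      (labelRest m lab m (lab w) \ Set.range z) b' := by
  obtain ⟨w, hw⟩ := h.left_nonempty
  refine ⟨w, Set.disjoint_left.mp h.left_special hw, minSplit S (Set.range z)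
    (labelClass m lab m (lab w)) (labelRest m lab m (lab w) \ Set.range z), ?_⟩
  exact h.refine hl hw _
    (fun c => ((hl.indep (lab w)).mono subset_rfl Set.sdiff_subset).minSplit_valid c)
    fun c d hcd => minSplit_congr hcd

/-- The rows of `A` do not distinguish columns within a block. Moving some of them to the other side
changes no class there, and every class on the left is a whole block, so the given `b` stays valid.
Recomputing `b` could lose strictness. -/
theorem RowSplit.exists_label_of_const (h : RowSplit S z A B b)
    (hl : FinestLabels S (Set.range z) lab m)
    (hA : ∀ c d, Agree S (Set.range z) c d → Agree S A c d) :
    ∃ w ∉ Set.range z, RowSplit S z (labelClass m lab m (lab w))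
      (labelRest m lab m (lab w) \ Set.range z) b := by
  obtain ⟨w, hw⟩ := h.left_nonempty
  refine ⟨w, Set.disjoint_left.mp h.left_special hw, h.refine hl hw b (fun c => ?_) h.congr⟩
  have hv := h.valid c
  have hsub := hl.subset_of_mem h.indep_compl hw
  refine ⟨hv.pos, hv.dvd, fun d hd => ?_, fun d hd => ?_⟩
  · rw [sideCount_eq_blockCount fun e he => (hA e d he).mono hsub, blockCount_congr hd]
    exact hv.dvd
  · convert hv.right d hd using 2
    refine card_filter_univ_congr fun e => and_congr_right fun he => ⟨fun h' => ?_, fun h' => ?_⟩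
    · refine h'.mono fun j hj => ⟨⟨j.2, fun hjw => ?_⟩, Set.disjoint_left.mp h.right_special hj⟩
      exact Set.disjoint_left.mp h.disjoint (hsub ⟨j.2, hjw⟩) hj
    · intro j hj
      rcases h.cover j with hjA | hjB | hjZ
      · exact hA e d he j hjA
      · exact h' j hjB
      · exact (hj.2 hjZ).elim

/-- If one side is constant on all blocks, a class inside that side keeps the given numbers, after
exchanging the factors if this side is `B`. Otherwise take the class of a row of `A` that varies
inside some block. It forces `b < N` there; the new right side contains `B` and forces `b ≥ 2` in a
block where `B` varies. -/
theorem RowSplit.exists_label_strict (h : RowSplit S z A B b)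
    (hl : FinestLabels S (Set.range z) lab m) (hs : StrictSplit S z b) :
    ∃ w ∉ Set.range z, ∃ b', RowSplit S z (labelClass m lab m (lab w))
      (labelRest m lab m (lab w) \ Set.range z) b' ∧ StrictSplit S z b' := by
  by_cases hA : ∀ c d, Agree S (Set.range z) c d → Agree S A c d
  · obtain ⟨w, hw, h'⟩ := h.exists_label_of_const hl hA
    exact ⟨w, hw, b, h', hs⟩
  by_cases hB : ∀ c d, Agree S (Set.range z) c d → Agree S B c d
  · obtain ⟨w, hw, h'⟩ := h.swap.exists_label_of_const hl hB
    exact ⟨w, hw, _, h', hs.swap h⟩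
  push Not at hA hB
  obtain ⟨c, d, hcd, hA⟩ := hA
  obtain ⟨c', d', hcd', hB⟩ := hB
  simp only [Agree, not_forall] at hA
  obtain ⟨w, hw, hne⟩ := hA
  have hsub := hl.subset_of_mem h.indep_compl hw
  have h' := h.refine hl hw _
    (fun c => ((hl.indep (lab w)).mono subset_rfl Set.sdiff_subset).minSplit_valid c)
    fun c d hcd => minSplit_congr hcd
  refine ⟨w, Set.disjoint_left.mp h.left_special hw, _, h', ⟨c', ?_⟩, c, ?_⟩
  · refine (h'.valid c').two_le hcd' fun hag => hB (hag.mono fun j hj => ?_)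
    refine ⟨⟨j.2, fun hjw => ?_⟩, Set.disjoint_left.mp h.right_special hj⟩
    exact Set.disjoint_left.mp h.disjoint (hsub ⟨j.2, hjw⟩) hj
  · exact (h'.valid c).lt_blockCount hcd fun hag => hne (hag w ⟨w.2, rfl⟩)

/-! ### Guessing the number of columns in a single block -/

open Classical in
/-- The number `b₁` of columns in the block of `c₁`, and the smallest possible number in the other
blocks. -/
noncomputable def guessSplit (S : Matrix (Fin m) γ ℝ) (Z A B : Set (Fin m)) (c₁ : γ) (b₁ : ℕ)
    (c : γ) : ℕ :=
  if Agree S Z c c₁ then b₁ else minSplit S Z A B c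

theorem guessSplit_congr {Z : Set (Fin m)} {c d : γ} (h : Agree S Z c d) (c₁ : γ) (b₁ : ℕ) :
    guessSplit S Z A B c₁ b₁ c = guessSplit S Z A B c₁ b₁ d := by
  have : Agree S Z c c₁ ↔ Agree S Z d c₁ := by rw [agree_comm, h.congr_right, agree_comm]
  unfold guessSplit
  by_cases hd : Agree S Z d c₁
  · rw [if_pos hd, if_pos (this.mpr hd)]
  · rw [if_neg hd, if_neg (this.not.mpr hd), minSplit_congr h]

theorem RowSplit.guess (h : RowSplit S z A B b) (c₁ : γ) :
    RowSplit S z A B (guessSplit S (Set.range z) A B c₁ (b c₁)) :=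
  { h with
    valid := fun c => by
      unfold guessSplit
      split_ifs with hc
      · rw [← h.congr c c₁ hc]
        exact h.valid c
      · exact h.indep.minSplit_valid c
    congr := fun c d hcd => guessSplit_congr hcd _ _ }

theorem RowSplit.guessSplit_le (h : RowSplit S z A B b) (c₁ c : γ) :
    guessSplit S (Set.range z) A B c₁ (b c₁) c ≤ b c := by
  unfold guessSplit
  split_ifs with hc
  · rw [h.congr c c₁ hc]
  · exact Nat.sInf_le (h.valid c)

theorem RowSplit.exists_guess (h : RowSplit S z A B b) :
    ∃ c₁ b₁, 0 < b₁ ∧ b₁ ≤ Fintype.card γ ∧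
      RowSplit S z A B (guessSplit S (Set.range z) A B c₁ b₁) := by
  obtain ⟨c₁⟩ := h.special.nonempty
  exact ⟨c₁, b c₁, (h.valid c₁).pos, (h.valid c₁).le_blockCount.trans (Finset.card_le_univ _),
    h.guess c₁⟩

/-- The guessed block is one with `b ≥ 2`. Minimal numbers elsewhere never exceed the old ones, so a
block with `b < N` keeps this property. -/
theorem RowSplit.exists_guess_strict (h : RowSplit S z A B b) (hs : StrictSplit S z b) :
    ∃ c₁ b₁, 0 < b₁ ∧ b₁ ≤ Fintype.card γ ∧
      RowSplit S z A B (guessSplit S (Set.range z) A B c₁ b₁) ∧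
      StrictSplit S z (guessSplit S (Set.range z) A B c₁ b₁) := by
  obtain ⟨⟨c₁, hc₁⟩, d, hd⟩ := hs
  refine ⟨c₁, b c₁, (h.valid c₁).pos, (h.valid c₁).le_blockCount.trans (Finset.card_le_univ _),
    h.guess c₁, ⟨c₁, ?_⟩, d, (h.guessSplit_le c₁ d).trans_lt hd⟩
  simpa [guessSplit, Agree.refl] using hc₁

end RowSplit

end KProd

namespace KProd

/-! ### Factorizations give splittings -/

section OfFactorization

theorem simplexVertex_injective (r : ℕ) :
    Function.Injective (simplexVertex : Option (Fin r) → Fin r → ℝ) := by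
  rintro (_ | i) (_ | j) h
  · rfl
  · simpa [simplexVertex] using congrFun h j
  · simpa [simplexVertex] using congrFun h i
  · have := congrFun h i
    by_cases hij : i = j
    · rw [hij]
    · simp [simplexVertex, hij] at this

theorem SpecialRows.injective {r : ℕ} {ρ γ : Type} {S : Matrix ρ γ ℝ} {x : Fin r → ρ}
    (h : SpecialRows S x) : Function.Injective x := by
  intro l l' hl
  have : simplexVertex (some l) ∈ Set.range (simplexVertex (r := r)) := ⟨_, rfl⟩
  rw [← h] at this
  obtain ⟨c, hc⟩ := this
  have h1 : S (x l) c = simplexVertex (some l) l := congrFun hc l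
  have h2 : S (x l') c = simplexVertex (some l) l' := congrFun hc l'
  rw [← hl, h1] at h2
  by_contra hne
  simp [simplexVertex, Ne.symm hne] at h2

theorem SpecialRows.exists_vertex {r : ℕ} {ρ γ : Type} {S : Matrix ρ γ ℝ} {x : Fin r → ρ}
    (h : SpecialRows S x) (c : γ) : ∃ j, ∀ l, S (x l) c = simplexVertex j l := by
  have : (fun l => S (x l) c) ∈ Set.range (simplexVertex (r := r)) := h ▸ ⟨c, rfl⟩
  obtain ⟨j, hj⟩ := this
  exact ⟨j, fun l => (congrFun hj l).symm⟩

theorem SpecialRows.nonempty_blockCol {r : ℕ} {ρ γ : Type} {S : Matrix ρ γ ℝ} {x : Fin r → ρ}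
    (h : SpecialRows S x) (j : Option (Fin r)) : Nonempty (BlockCol S x j) := by
  have : simplexVertex j ∈ Set.range (fun (c : γ) (l : Fin r) => S (x l) c) := h ▸ ⟨j, rfl⟩
  obtain ⟨c, hc⟩ := this
  exact ⟨⟨c, fun l => congrFun hc l⟩⟩

variable {m r : ℕ} {ρ₁ ρ₂ γ γ₁ γ₂ : Type} [Fintype γ] [Fintype γ₁] [Fintype γ₂]

open Classical in
/-- The number of elements with a given property. -/
noncomputable def countSat {α : Type} [Fintype α] (P : α → Prop) : ℕ := Finset.card {a | P a}

theorem countSat_true (α : Type) [Fintype α] : countSat (fun _ : α => True) = Fintype.card α := by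
  simp [countSat]

open Classical in
/-- The columns of a `k`-product in block `j` are pairs. -/
theorem countSat_block {S₁ : Matrix ρ₁ γ₁ ℝ} {x : Fin r → ρ₁} {S₂ : Matrix ρ₂ γ₂ ℝ}
    {y : Fin r → ρ₂} (f : γ ≃ Σ j : Option (Fin r), BlockCol S₁ x j × BlockCol S₂ y j)
    (j : Option (Fin r)) (P : γ₁ → Prop) (Q : γ₂ → Prop) :
    countSat (fun c => (f c).1 = j ∧ P (f c).2.1.1 ∧ Q (f c).2.2.1) =
      countSat (fun u : BlockCol S₁ x j => P u) * countSat (fun v : BlockCol S₂ y j => Q v) := by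
  unfold countSat
  rw [← Finset.card_product]
  symm
  refine Finset.card_bij (fun p _ => f.symm ⟨j, p⟩) ?_ ?_ ?_
  · rintro ⟨u, v⟩ hp
    simp only [Finset.mem_filter, Finset.mem_univ, true_and]
    rw [Equiv.apply_symm_apply]
    simpa using hp
  · rintro p _ q _ h
    simpa using h
  · intro c hc
    simp only [Finset.mem_filter, Finset.mem_univ, true_and] at hc
    rcases hq : f c with ⟨j', p⟩
    rw [hq] at hc
    obtain ⟨rfl, h1, h2⟩ := hc
    exact ⟨p, by simp [h1, h2], by rw [← hq, Equiv.symm_apply_apply]⟩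

theorem card_otherRow_add {ρ : Type} [Fintype ρ] {x : Fin r → ρ} (hx : Function.Injective x)
    [Fintype (OtherRow x)] : Fintype.card (OtherRow x) + r = Fintype.card ρ := by
  have := Fintype.card_congr (Equiv.ofBijective (Sum.elim (Subtype.val : OtherRow x → ρ) x)
    ⟨Subtype.val_injective.sumElim hx fun a l h => a.2 ⟨l, h.symm⟩, fun i => ?_⟩)
  · simpa using this
  · by_cases hi : i ∈ Set.range x
    · obtain ⟨l, rfl⟩ := hi
      exact ⟨.inr l, rfl⟩
    · exact ⟨.inl ⟨i, hi⟩, rfl⟩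

/-- The columns of `S` in a block correspond to pairs, so each number of columns described by
conditions on the two sides is a product of one number per factor. Independence and the
divisibilities can be read off from these products. -/
theorem IsFactorization.exists_rowSplit {k m n : ℕ} {S : Matrix (Fin m) (Fin n) ℝ}
    {F : Factors k} (h : IsFactorization S F) :
    ∃ (z : Fin (k - 1) → Fin m) (A B : Set (Fin m)) (b : Fin n → ℕ), RowSplit S z A B b ∧
      (F.n₁ < n → F.n₂ < n → StrictSplit S z b) := by
  classical
  obtain ⟨m₁, n₁, m₂, n₂, S₁, S₂, x, y⟩ := F
  obtain ⟨hx, hy, hm₁, hm₂, e, f, hS⟩ := h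
  simp only at hx hy hm₁ hm₂ e f hS ⊢
  let z : Fin (k - 1) → Fin m := fun l => e.symm (.inr l)
  have hSz : ∀ l c, S (z l) c = simplexVertex (f c).1 l := by
    intro l c
    rw [hS]
    simp [z, kProduct]
  have hZ : ∀ c d, Agree S (Set.range z) c d ↔ (f c).1 = (f d).1 := by
    intro c d
    constructor
    · intro h
      refine simplexVertex_injective _ (funext fun l => ?_)
      rw [← hSz, ← hSz]
      exact h _ ⟨l, rfl⟩
    · rintro h _ ⟨l, rfl⟩
      rw [hSz, hSz, h]
  let A : Set (Fin m) := {i | ∃ a, e i = .inl (.inl a)}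
  let B : Set (Fin m) := {i | ∃ a, e i = .inl (.inr a)}
  have hSA : ∀ i a, e i = .inl (.inl a) → ∀ c, S i c = S₁ a (f c).2.1 := by
    intro i a hi c
    rw [hS, Matrix.submatrix_apply, hi]
    rfl
  have hSB : ∀ i a, e i = .inl (.inr a) → ∀ c, S i c = S₂ a (f c).2.2 := by
    intro i a hi c
    rw [hS, Matrix.submatrix_apply, hi]
    rfl
  let U : Fin n₁ → Fin n₁ → Prop := fun u v => ∀ a : OtherRow x, S₁ a u = S₁ a v
  let V : Fin n₂ → Fin n₂ → Prop := fun u v => ∀ a : OtherRow y, S₂ a u = S₂ a v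
  have hA : ∀ c d, Agree S A c d ↔ U (f c).2.1.1 (f d).2.1.1 := by
    intro c d
    constructor
    · intro h a
      have := h (e.symm (.inl (.inl a))) ⟨a, by simp⟩
      rwa [hSA _ a (by simp), hSA _ a (by simp)] at this
    · rintro h i ⟨a, ha⟩
      rw [hSA i a ha, hSA i a ha]
      exact h a
  have hB : ∀ c d, Agree S B c d ↔ V (f c).2.2.1 (f d).2.2.1 := by
    intro c d
    constructor
    · intro h a
      have := h (e.symm (.inl (.inr a))) ⟨a, by simp⟩
      rwa [hSB _ a (by simp), hSB _ a (by simp)] at this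
    · rintro h i ⟨a, ha⟩
      rw [hSB i a ha, hSB i a ha]
      exact h a
  let cnt₁ : Fin n → ℕ := fun c =>
    countSat fun u : BlockCol S₁ x (f c).1 => U u (f c).2.1.1
  let cnt₂ : Fin n → ℕ := fun c =>
    countSat fun v : BlockCol S₂ y (f c).1 => V v (f c).2.2.1
  let a : Fin n → ℕ := fun c => Fintype.card (BlockCol S₁ x (f c).1)
  let b : Fin n → ℕ := fun c => Fintype.card (BlockCol S₂ y (f c).1)
  have hn : ∀ c, blockCount S (Set.range z) c = a c * b c := by
    intro c
    have := countSat_block f (f c).1 (fun _ => True) (fun _ => True)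
    simp only [and_true, countSat_true] at this
    refine Eq.trans ?_ this
    exact card_filter_univ_congr fun e => hZ e c
  have hcA : ∀ c, sideCount S (Set.range z) A c = cnt₁ c * b c := by
    intro c
    have := countSat_block f (f c).1 (fun u => U u (f c).2.1.1) (fun _ => True)
    simp only [and_true, countSat_true] at this
    refine Eq.trans ?_ this
    exact card_filter_univ_congr fun e => by rw [hZ, hA]
  have hcB : ∀ c, sideCount S (Set.range z) B c = a c * cnt₂ c := by
    intro c
    have := countSat_block f (f c).1 (fun _ => True) (fun v => V v (f c).2.2.1)
    simp only [true_and, countSat_true] at this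
    refine Eq.trans ?_ this
    exact card_filter_univ_congr fun e => by rw [hZ, hB]
  have hb : ∀ c d, Agree S (Set.range z) c d → b c = b d := by
    intro c d h
    simp only [b, (hZ c d).mp h]
  have hjoint : ∀ c d, Agree S (Set.range z) c d →
      jointCount S (Set.range z) A B c d = cnt₁ c * cnt₂ d := by
    intro c d h
    have := countSat_block f (f c).1 (fun u => U u (f c).2.1.1) (fun v => V v (f d).2.2.1)
    have h2 : countSat (fun v : BlockCol S₂ y (f c).1 => V v (f d).2.2.1) = cnt₂ d := by
      have : ∀ j, j = (f d).1 →
          countSat (fun v : BlockCol S₂ y j => V v (f d).2.2.1) = cnt₂ d := by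
        rintro _ rfl
        rfl
      exact this _ ((hZ c d).mp h)
    rw [h2] at this
    refine Eq.trans ?_ this
    exact card_filter_univ_congr fun e => by rw [hZ, hA, hB]
  have ha : ∀ c d, Agree S (Set.range z) c d → a c = a d := by
    intro c d h
    simp only [a, (hZ c d).mp h]
  have hbpos : ∀ c, 0 < b c := fun c => Fintype.card_pos_iff.mpr (hy.nonempty_blockCol _)
  have hcardm : m = (Fintype.card (OtherRow x) + Fintype.card (OtherRow y)) + (k - 1) := by
    have := Fintype.card_congr e
    simpa using this
  have hother₁ : Fintype.card (OtherRow x) + (k - 1) = m₁ := by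
    rw [card_otherRow_add hx.injective, Fintype.card_fin]
  have hother₂ : Fintype.card (OtherRow y) + (k - 1) = m₂ := by
    rw [card_otherRow_add hy.injective, Fintype.card_fin]
  have hsplit : RowSplit S z A B b :=
    { special := by
        refine Set.Subset.antisymm ?_ ?_
        · rintro _ ⟨c, rfl⟩
          exact ⟨(f c).1, funext fun l => (hSz l c).symm⟩
        · rintro _ ⟨j, rfl⟩
          obtain ⟨u⟩ := hx.nonempty_blockCol j
          obtain ⟨v⟩ := hy.nonempty_blockCol j
          refine ⟨f.symm ⟨j, u, v⟩, funext fun l => ?_⟩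
          simp [hSz]
      cover := by
        intro i
        rcases hi : e i with (a | a) | l
        · exact .inl ⟨a, hi⟩
        · exact .inr (.inl ⟨a, hi⟩)
        · exact .inr (.inr ⟨l, by simp [z, ← hi]⟩)
      disjoint := by
        refine Set.disjoint_left.mpr ?_
        rintro i ⟨a, ha⟩ ⟨a', ha'⟩
        simp [ha] at ha'
      left_special := by
        refine Set.disjoint_left.mpr ?_
        rintro i ⟨a, ha⟩ ⟨l, rfl⟩
        simp [z] at ha
      right_special := by
        refine Set.disjoint_left.mpr ?_
        rintro i ⟨a, ha⟩ ⟨l, rfl⟩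
        simp [z] at ha
      left_nonempty := by
        -- The rows of `S` are the special ones and the other rows of both factors; since the second
        -- factor has fewer rows than `S`, the first one has a row that is not special.
        obtain ⟨a⟩ := Fintype.card_pos_iff.mp (show 0 < Fintype.card (OtherRow x) by omega)
        exact ⟨e.symm (.inl (.inl a)), a, by simp⟩
      right_nonempty := by
        obtain ⟨a⟩ := Fintype.card_pos_iff.mp (show 0 < Fintype.card (OtherRow y) by omega)
        exact ⟨e.symm (.inl (.inr a)), a, by simp⟩
      indep := by
        intro c d h
        rw [hn, hcA, hcB, hjoint c d h, ha c d h]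
        rw [hb c d h]
        ring
      valid := fun c => by
        refine ⟨hbpos c, ⟨a c, by rw [hn, mul_comm]⟩, fun d hd => ⟨cnt₁ d, ?_⟩,
          fun d hd => ⟨cnt₂ d, ?_⟩⟩
        · rw [hcA, hb d c hd, mul_comm]
        · rw [hn, hcB, ha d c hd]
          ring
      congr := hb }
  refine ⟨z, A, B, b, hsplit, fun h₁ h₂ => ⟨?_, ?_⟩⟩
  -- If the second factor has one column in each block, a column of `S` is determined by its first
  -- component, whose special entries give the block. Then `n ≤ n₁`.
  · by_contra hcon
    push Not at hcon
    refine absurd (Fintype.card_le_of_injective (fun c => ((f c).2.1.1 : Fin n₁)) ?_)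
      (by simpa using h₁)
    intro c d hcd
    apply f.injective
    rcases hc : f c with ⟨j, u, v⟩
    rcases hd : f d with ⟨j', u', v'⟩
    change (f c).2.1.1 = (f d).2.1.1 at hcd
    rw [hc, hd] at hcd
    obtain ⟨u, hu⟩ := u
    obtain ⟨u', hu'⟩ := u'
    obtain rfl : u = u' := hcd
    obtain rfl : j = j' := simplexVertex_injective _ (funext fun l => (hu l).symm.trans (hu' l))
    have : Fintype.card (BlockCol S₂ y j) ≤ 1 := by
      have := hcon c
      simp only [b, hc] at this
      omega
    have := Fintype.card_le_one_iff.mp this v v'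
    rw [this]
  -- Likewise, `b` equal to the block size everywhere leaves one column per block in the first
  -- factor, and then `n ≤ n₂`.
  · by_contra hcon
    push Not at hcon
    refine absurd (Fintype.card_le_of_injective (fun c => ((f c).2.2.1 : Fin n₂)) ?_)
      (by simpa using h₂)
    intro c d hcd
    apply f.injective
    rcases hc : f c with ⟨j, u, v⟩
    rcases hd : f d with ⟨j', u', v'⟩
    change (f c).2.2.1 = (f d).2.2.1 at hcd
    rw [hc, hd] at hcd
    obtain ⟨v, hv⟩ := v
    obtain ⟨v', hv'⟩ := v'
    obtain rfl : v = v' := hcd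
    obtain rfl : j = j' := simplexVertex_injective _ (funext fun l => (hv l).symm.trans (hv' l))
    have : Fintype.card (BlockCol S₁ x j) ≤ 1 := by
      have h1 := hcon c
      rw [hn] at h1
      have h2 := Nat.le_of_mul_le_mul_right (h1.trans_eq (one_mul (b c)).symm) (hbpos c)
      simpa only [a, hc] using h2
    have := Fintype.card_le_one_iff.mp this u u'
    rw [this]

end OfFactorization

end KProd

namespace KProd

/-! ### Splittings give factorizations -/

section ToFactorization

/-- Of the elements of a finite set, exactly `t` have fewer than `t` predecessors. -/
theorem card_filter_rank_lt {α : Type} [LinearOrder α] (K : Finset α) {t : ℕ} (ht : t ≤ K.card) :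
    Finset.card {d ∈ K | Finset.card {e ∈ K | e < d} < t} = t := by
  let φ : α → ℕ := fun d => Finset.card {e ∈ K | e < d}
  have hmono : ∀ d ∈ K, ∀ d' ∈ K, d < d' → φ d < φ d' := by
    intro d hd d' _ h
    refine Finset.card_lt_card (Finset.ssubset_iff_subset_ne.mpr ⟨fun e he => ?_, fun he => ?_⟩)
    · simp only [Finset.mem_filter] at he ⊢
      exact ⟨he.1, he.2.trans h⟩
    · have : d ∈ ({e ∈ K | e < d'} : Finset α) := by simp [hd, h]
      rw [← he] at this
      simp at this
  have hinj : Set.InjOn φ K := by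
    intro d hd d' hd' h
    rcases lt_trichotomy d d' with h' | h' | h'
    · exact absurd h (hmono d hd d' hd' h').ne
    · exact h'
    · exact absurd h (hmono d' hd' d hd h').ne'
  have himage : K.image φ = Finset.range K.card := by
    refine Finset.eq_of_subset_of_card_le (fun v hv => ?_) ?_
    · obtain ⟨d, hd, rfl⟩ := Finset.mem_image.mp hv
      rw [Finset.mem_range]
      refine Finset.card_lt_card (Finset.ssubset_iff_subset_ne.mpr
        ⟨Finset.filter_subset _ _, fun he => ?_⟩)
      rw [← he] at hd
      simp at hd
    · rw [Finset.card_range, Finset.card_image_of_injOn hinj]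
  have h1 : ({d ∈ K | φ d < t} : Finset α).image φ = Finset.range t := by
    ext v
    have hv : v ∈ K.image φ ↔ v < K.card := by rw [himage, Finset.mem_range]
    simp only [Finset.mem_image, Finset.mem_filter, Finset.mem_range] at hv ⊢
    constructor
    · rintro ⟨d, hd, rfl⟩
      exact hd.2
    · intro h
      obtain ⟨d, hd, rfl⟩ := hv.mpr (by omega)
      exact ⟨d, ⟨hd, h⟩, rfl⟩
  rw [← Finset.card_image_of_injOn (hinj.mono (s₁ := ({d ∈ K | φ d < t} : Finset α))
    fun d hd => (Finset.mem_filter.mp hd).1), h1, Finset.card_range]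

/-! ### Selecting the columns of the two factors -/

variable {ρ : Type} {m n r : ℕ}

open Classical in
/-- The number of columns before `c` that agree with `c` on `Z` and `T`. -/
noncomputable def classRank (S : Matrix ρ (Fin n) ℝ) (Z T : Set ρ) (c : Fin n) : ℕ :=
  Finset.card {e | e < c ∧ Agree S Z e c ∧ Agree S T e c}

/-- The columns of `S` that are used for the first factor. -/
def LeftCol (S : Matrix ρ (Fin n) ℝ) (Z A : Set ρ) (b : Fin n → ℕ) (c : Fin n) : Prop :=
  -- Of each class on `A`, the first columns are kept, in number the size of the class divided by
  -- `b`.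
  classRank S Z A c * b c < sideCount S Z A c

/-- The columns of `S` that are used for the second factor. -/
def RightCol (S : Matrix ρ (Fin n) ℝ) (Z B : Set ρ) (b : Fin n → ℕ) (c : Fin n) : Prop :=
  -- Of each class on `B`, the first columns are kept, in number the size of the class times `b`
  -- divided by the block size.
  classRank S Z B c * blockCount S Z c < sideCount S Z B c * b c

open Classical in
theorem card_class_rank_lt (S : Matrix ρ (Fin n) ℝ) (Z T : Set ρ) (c : Fin n) {t : ℕ}
    (ht : t ≤ sideCount S Z T c) :
    Finset.card {d | classRank S Z T d < t ∧ Agree S Z d c ∧ Agree S T d c} = t := by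
  let K : Finset (Fin n) := {e | Agree S Z e c ∧ Agree S T e c}
  have h := card_filter_rank_lt K ht
  convert h using 2
  ext d
  simp only [K, Finset.mem_filter, Finset.mem_univ, true_and]
  rw [and_comm]
  refine and_congr_right fun hd => ?_
  convert Iff.rfl using 2
  unfold classRank
  congr 1
  ext e
  simp only [Finset.mem_filter, Finset.mem_univ, true_and, hd.1.congr_right, hd.2.congr_right]
  tauto

variable {S : Matrix (Fin m) (Fin n) ℝ} {z : Fin r → Fin m} {A B : Set (Fin m)} {b : Fin n → ℕ}

open Classical in
theorem RowSplit.card_leftCol (h : RowSplit S z A B b) (c : Fin n) :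
    Finset.card {d | LeftCol S (Set.range z) A b d ∧ Agree S (Set.range z) d c ∧ Agree S A d c} *
      b c = sideCount S (Set.range z) A c := by
  obtain ⟨q, hq⟩ := (h.valid c).left c (.refl _ _ _)
  have hb := (h.valid c).pos
  have hle : q ≤ sideCount S (Set.range z) A c := by
    rw [hq]
    exact Nat.le_mul_of_pos_left q hb
  rw [hq, mul_comm (b c)]
  congr 1
  rw [← card_class_rank_lt S (Set.range z) A c hle]
  refine card_filter_univ_congr fun d => and_congr_left fun hd => ?_
  rw [LeftCol, h.congr d c hd.1, sideCount_congr hd.1 hd.2, hq, mul_comm (b c),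
    Nat.mul_lt_mul_right hb]

open Classical in
theorem RowSplit.card_rightCol (h : RowSplit S z A B b) (c : Fin n) :
    Finset.card {d | RightCol S (Set.range z) B b d ∧ Agree S (Set.range z) d c ∧
      Agree S B d c} * blockCount S (Set.range z) c = sideCount S (Set.range z) B c * b c := by
  obtain ⟨q, hq⟩ := (h.valid c).right c (.refl _ _ _)
  have hpos := blockCount_pos S (Set.range z) c
  have hle : q ≤ sideCount S (Set.range z) B c := by
    have := Nat.mul_le_mul_left (sideCount S (Set.range z) B c) (h.valid c).le_blockCount
    rw [hq, mul_comm] at this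
    exact Nat.le_of_mul_le_mul_right this hpos
  rw [hq, mul_comm (blockCount S (Set.range z) c)]
  congr 1
  rw [← card_class_rank_lt S (Set.range z) B c hle]
  refine card_filter_univ_congr fun d => and_congr_left fun hd => ?_
  rw [RightCol, h.congr d c hd.1, blockCount_congr hd.1, sideCount_congr hd.1 hd.2, hq,
    mul_comm (blockCount S (Set.range z) c), Nat.mul_lt_mul_right hpos]

theorem RowSplit.exists_leftCol (h : RowSplit S z A B b) (c : Fin n) :
    ∃ d, LeftCol S (Set.range z) A b d ∧ Agree S (Set.range z) d c := by
  classical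
  have h1 := h.card_leftCol c
  have h2 := sideCount_pos S (Set.range z) A c
  obtain ⟨d, hd⟩ := Finset.card_pos.mp (Nat.pos_of_mul_pos_right (h1 ▸ h2))
  simp only [Finset.mem_filter, Finset.mem_univ, true_and] at hd
  exact ⟨d, hd.1, hd.2.1⟩

theorem RowSplit.exists_rightCol (h : RowSplit S z A B b) (c : Fin n) :
    ∃ d, RightCol S (Set.range z) B b d ∧ Agree S (Set.range z) d c := by
  classical
  have h1 := h.card_rightCol c
  have h2 := Nat.mul_pos (sideCount_pos S (Set.range z) B c) (h.valid c).pos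
  obtain ⟨d, hd⟩ := Finset.card_pos.mp (Nat.pos_of_mul_pos_right (h1 ▸ h2))
  simp only [Finset.mem_filter, Finset.mem_univ, true_and] at hd
  exact ⟨d, hd.1, hd.2.1⟩

theorem RowSplit.exists_not_leftCol (h : RowSplit S z A B b) {c : Fin n} (hc : 2 ≤ b c) :
    ∃ d, ¬ LeftCol S (Set.range z) A b d := by
  classical
  by_contra hcon
  push Not at hcon
  have h1 := h.card_leftCol c
  simp only [hcon, true_and] at h1
  have h2 := sideCount_pos S (Set.range z) A c
  change sideCount S (Set.range z) A c * b c = sideCount S (Set.range z) A c at h1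
  have := Nat.mul_le_mul_left (sideCount S (Set.range z) A c) hc
  omega

theorem RowSplit.exists_not_rightCol (h : RowSplit S z A B b) {c : Fin n}
    (hc : b c < blockCount S (Set.range z) c) : ∃ d, ¬ RightCol S (Set.range z) B b d := by
  classical
  by_contra hcon
  push Not at hcon
  have h1 := h.card_rightCol c
  simp only [hcon, true_and] at h1
  have h2 := sideCount_pos S (Set.range z) B c
  change sideCount S (Set.range z) B c * _ = _ at h1
  exact hc.ne' (Nat.eq_of_mul_eq_mul_left h2 h1)

/-- Two matrices with the same rows differ by a permutation of columns as soon as every vector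
occurs equally often in both; `F` and `G` will be the maps from column indices to column vectors. -/
theorem exists_equiv_of_card_fiber {α β V : Type} [Fintype α] [Fintype β] [DecidableEq V]
    (F : α → V) (G : β → V)
    (h : ∀ v, Finset.card {a | F a = v} = Finset.card {b | G b = v}) :
    ∃ f : α ≃ β, ∀ a, G (f a) = F a := by
  have e : ∀ v, Nonempty ({a // F a = v} ≃ {b // G b = v}) := by
    intro v
    refine Fintype.card_eq.mp ?_
    rw [Fintype.card_subtype, Fintype.card_subtype, h]
  exact ⟨Equiv.ofFiberEquiv fun v => (e v).some, fun a => Equiv.ofFiberEquiv_map _ a⟩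

/-- The submatrix for the rows in the range of `ε` and the columns in the range of `κ` inherits
the special rows if every block is met. -/
theorem SpecialRows.submatrix {ρ' γ γ' : Type} {S : Matrix ρ γ ℝ} {z : Fin r → ρ}
    (h : SpecialRows S z) {ε : ρ' → ρ} {κ : γ' → γ} {x : Fin r → ρ'} (hx : ∀ l, ε (x l) = z l)
    (hκ : ∀ c, ∃ d, Agree S (Set.range z) (κ d) c) : SpecialRows (S.submatrix ε κ) x := by
  refine Set.Subset.antisymm ?_ ?_
  · rintro _ ⟨c, rfl⟩
    rw [← h]
    exact ⟨κ c, by simp [hx]⟩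
  · rw [← h]
    rintro _ ⟨c, rfl⟩
    obtain ⟨d, hd⟩ := hκ c
    refine ⟨d, funext fun l => ?_⟩
    simp only [Matrix.submatrix_apply, hx]
    exact hd _ ⟨l, rfl⟩

/-- The rows correspond by construction, and columns are compared by multiplicity. Let `N` be the
block size, let `α` and `β` be the sizes of the classes of a column, and let `P₁` and `P₂` be the
numbers of columns kept from them. Then `P₁ b = α` and `P₂ N = β b`, and independence says that the
column occurs `α β / N = P₁ P₂` times in `S`, which is its multiplicity in the product. -/
theorem RowSplit.isomorphic {ρ₁ ρ₂ γ₁ γ₂ : Type} [Fintype γ₁] [Fintype γ₂]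
    (h : RowSplit S z A B b)
    {ε₁ : ρ₁ → Fin m} {κ₁ : γ₁ → Fin n} {ε₂ : ρ₂ → Fin m} {κ₂ : γ₂ → Fin n}
    (hε₁ : Function.Injective ε₁) (hκ₁ : Function.Injective κ₁)
    (hε₂ : Function.Injective ε₂) (hκ₂ : Function.Injective κ₂)
    (rε₁ : ∀ i, i ∈ Set.range ε₁ ↔ i ∈ A ∨ i ∈ Set.range z)
    (rε₂ : ∀ i, i ∈ Set.range ε₂ ↔ i ∈ B ∨ i ∈ Set.range z)
    (rκ₁ : ∀ c, c ∈ Set.range κ₁ ↔ LeftCol S (Set.range z) A b c)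
    (rκ₂ : ∀ c, c ∈ Set.range κ₂ ↔ RightCol S (Set.range z) B b c)
    {x : Fin r → ρ₁} {y : Fin r → ρ₂} (hx : ∀ l, ε₁ (x l) = z l) (hy : ∀ l, ε₂ (y l) = z l) :
    Isomorphic S (kProduct (S.submatrix ε₁ κ₁) x (S.submatrix ε₂ κ₂) y) := by
  classical
  have hzi := h.special.injective
  have other₁ : ∀ a : OtherRow x, ε₁ a ∈ A := by
    intro a
    refine ((rε₁ _).mp ⟨a, rfl⟩).resolve_right ?_
    rintro ⟨l, hl⟩
    exact a.2 ⟨l, hε₁ ((hx l).trans hl)⟩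
  have other₂ : ∀ a : OtherRow y, ε₂ a ∈ B := by
    intro a
    refine ((rε₂ _).mp ⟨a, rfl⟩).resolve_right ?_
    rintro ⟨l, hl⟩
    exact a.2 ⟨l, hε₂ ((hy l).trans hl)⟩
  have surj₁ : ∀ i ∈ A, ∃ a : OtherRow x, ε₁ a = i := by
    intro i hi
    obtain ⟨a, rfl⟩ := (rε₁ i).mpr (.inl hi)
    refine ⟨⟨a, ?_⟩, rfl⟩
    rintro ⟨l, rfl⟩
    exact Set.disjoint_left.mp h.left_special hi ⟨l, (hx l).symm⟩
  have surj₂ : ∀ i ∈ B, ∃ a : OtherRow y, ε₂ a = i := by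
    intro i hi
    obtain ⟨a, rfl⟩ := (rε₂ i).mpr (.inl hi)
    refine ⟨⟨a, ?_⟩, rfl⟩
    rintro ⟨l, rfl⟩
    exact Set.disjoint_left.mp h.right_special hi ⟨l, (hy l).symm⟩
  let g : (OtherRow x ⊕ OtherRow y) ⊕ Fin r → Fin m :=
    Sum.elim (Sum.elim (fun a => ε₁ a) (fun a => ε₂ a)) z
  have hg : Function.Bijective g := by
    constructor
    · refine Function.Injective.sumElim (Function.Injective.sumElim
        (hε₁.comp Subtype.val_injective) (hε₂.comp Subtype.val_injective) ?_) hzi ?_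
      · intro a a' haa
        exact Set.disjoint_left.mp h.disjoint (other₁ a) (haa ▸ other₂ a')
      · rintro (a | a) l hal
        · exact Set.disjoint_left.mp h.left_special (other₁ a) ⟨l, hal.symm⟩
        · exact Set.disjoint_left.mp h.right_special (other₂ a) ⟨l, hal.symm⟩
    · intro i
      rcases h.cover i with hi | hi | ⟨l, rfl⟩
      · obtain ⟨a, rfl⟩ := surj₁ i hi
        exact ⟨.inl (.inl a), rfl⟩
      · obtain ⟨a, rfl⟩ := surj₂ i hi
        exact ⟨.inl (.inr a), rfl⟩
      · exact ⟨.inr l, rfl⟩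
  let M := kProduct (S.submatrix ε₁ κ₁) x (S.submatrix ε₂ κ₂) y
  let F : Fin n → ((OtherRow x ⊕ OtherRow y) ⊕ Fin r → ℝ) := fun c t => S (g t) c
  let G : (Σ j : Option (Fin r), BlockCol (S.submatrix ε₁ κ₁) x j ×
      BlockCol (S.submatrix ε₂ κ₂) y j) → ((OtherRow x ⊕ OtherRow y) ⊕ Fin r → ℝ) :=
    fun q t => M t q
  have hz₁ : ∀ (j) (u : BlockCol (S.submatrix ε₁ κ₁) x j) (l),
      S (z l) (κ₁ u.1) = simplexVertex j l := fun j u l => by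
    rw [← hx]; exact u.2 l
  have hz₂ : ∀ (j) (u : BlockCol (S.submatrix ε₂ κ₂) y j) (l),
      S (z l) (κ₂ u.1) = simplexVertex j l := fun j u l => by
    rw [← hy]; exact u.2 l
  have hF : ∀ c d, F c = F d ↔
      Agree S (Set.range z) c d ∧ Agree S A c d ∧ Agree S B c d := by
    intro c d
    constructor
    · intro hcd
      refine ⟨?_, ?_, ?_⟩
      · rintro _ ⟨l, rfl⟩
        exact congrFun hcd (.inr l)
      · intro i hi
        obtain ⟨a, rfl⟩ := surj₁ i hi
        exact congrFun hcd (.inl (.inl a))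
      · intro i hi
        obtain ⟨a, rfl⟩ := surj₂ i hi
        exact congrFun hcd (.inl (.inr a))
    · rintro ⟨h1, h2, h3⟩
      funext t
      rcases h.cover (g t) with hi | hi | hi
      · exact h2 _ hi
      · exact h3 _ hi
      · exact h1 _ hi
  have hG : ∀ q c, G q = F c ↔
      (Agree S (Set.range z) (κ₁ q.2.1.1) c ∧ Agree S A (κ₁ q.2.1.1) c) ∧
      (Agree S (Set.range z) (κ₂ q.2.2.1) c ∧ Agree S B (κ₂ q.2.2.1) c) := by
    rintro ⟨j, u, v⟩ c
    constructor
    · intro hq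
      have hzc : ∀ l, simplexVertex j l = S (z l) c := fun l => congrFun hq (.inr l)
      refine ⟨⟨?_, ?_⟩, ?_, ?_⟩
      · rintro _ ⟨l, rfl⟩
        rw [← hzc]; exact hz₁ j u l
      · intro i hi
        obtain ⟨a, rfl⟩ := surj₁ i hi
        exact congrFun hq (.inl (.inl a))
      · rintro _ ⟨l, rfl⟩
        rw [← hzc]; exact hz₂ j v l
      · intro i hi
        obtain ⟨a, rfl⟩ := surj₂ i hi
        exact congrFun hq (.inl (.inr a))
    · rintro ⟨⟨h1, h2⟩, h3, h4⟩
      funext t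
      rcases t with (a | a) | l
      · exact h2 _ (other₁ a)
      · exact h4 _ (other₂ a)
      · exact (hz₁ j u l).symm.trans (h1 _ ⟨l, rfl⟩)
  have hcount : ∀ c, Finset.card {d | F d = F c} = Finset.card {q | G q = F c} := by
    intro c
    let P₁ : Finset (Fin n) := {d | LeftCol S (Set.range z) A b d ∧
      Agree S (Set.range z) d c ∧ Agree S A d c}
    let P₂ : Finset (Fin n) := {d | RightCol S (Set.range z) B b d ∧
      Agree S (Set.range z) d c ∧ Agree S B d c}
    have h1 : Finset.card {d | F d = F c} = jointCount S (Set.range z) A B c c :=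
      card_filter_univ_congr fun d => hF d c
    have h2 : Finset.card {q | G q = F c} = P₁.card * P₂.card := by
      rw [← Finset.card_product]
      refine Finset.card_bij (fun q _ => (κ₁ q.2.1.1, κ₂ q.2.2.1)) ?_ ?_ ?_
      · intro q hq
        simp only [Finset.mem_filter, Finset.mem_univ, true_and, hG] at hq
        simp only [P₁, P₂, Finset.mem_product, Finset.mem_filter, Finset.mem_univ, true_and]
        exact ⟨⟨(rκ₁ _).mp ⟨_, rfl⟩, hq.1⟩, (rκ₂ _).mp ⟨_, rfl⟩, hq.2⟩
      · rintro ⟨j, u, v⟩ _ ⟨j', u', v'⟩ _ hqq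
        obtain ⟨h1, h2⟩ := Prod.mk.inj hqq
        obtain ⟨u, hu⟩ := u
        obtain ⟨u', hu'⟩ := u'
        obtain ⟨v, hv⟩ := v
        obtain ⟨v', hv'⟩ := v'
        obtain rfl : u = u' := hκ₁ h1
        obtain rfl : v = v' := hκ₂ h2
        obtain rfl : j = j' :=
          simplexVertex_injective _ (funext fun l => (hu l).symm.trans (hu' l))
        rfl
      · rintro ⟨d₁, d₂⟩ hd
        simp only [P₁, P₂, Finset.mem_product, Finset.mem_filter, Finset.mem_univ,
          true_and] at hd
        obtain ⟨⟨hL, hd₁⟩, hR, hd₂⟩ := hd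
        obtain ⟨u, rfl⟩ := (rκ₁ _).mpr hL
        obtain ⟨v, rfl⟩ := (rκ₂ _).mpr hR
        -- The block index of the pair is recovered from the special rows of `c`.
        obtain ⟨j, hj⟩ := h.special.exists_vertex c
        refine ⟨⟨j, ⟨u, fun l => ?_⟩, ⟨v, fun l => ?_⟩⟩, ?_, rfl⟩
        · rw [← hj, Matrix.submatrix_apply, hx]
          exact hd₁.1 _ ⟨l, rfl⟩
        · rw [← hj, Matrix.submatrix_apply, hy]
          exact hd₂.1 _ ⟨l, rfl⟩
        · simp only [Finset.mem_filter, Finset.mem_univ, true_and, hG]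
          exact ⟨hd₁, hd₂⟩
    rw [h1, h2]
    have e1 : P₁.card * b c = _ := h.card_leftCol c
    have e2 : P₂.card * blockCount S (Set.range z) c = _ := h.card_rightCol c
    have e3 := h.indep c c (.refl _ _ _)
    have hp := Nat.mul_pos (blockCount_pos S (Set.range z) c) (h.valid c).pos
    refine Nat.eq_of_mul_eq_mul_left hp ?_
    calc blockCount S (Set.range z) c * b c * jointCount S (Set.range z) A B c c
        = sideCount S (Set.range z) A c * (sideCount S (Set.range z) B c * b c) := by
          rw [mul_right_comm, e3]; ring
      _ = blockCount S (Set.range z) c * b c * (P₁.card * P₂.card) := by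
          rw [← e1, ← e2]; ring
  obtain ⟨f, hf⟩ := exists_equiv_of_card_fiber F G (by
    intro v
    by_cases hv : ∃ c, F c = v
    · obtain ⟨c, rfl⟩ := hv
      exact hcount c
    · rw [Finset.card_eq_zero.mpr, Finset.card_eq_zero.mpr]
      · refine Finset.filter_eq_empty_iff.mpr ?_
        rintro ⟨j, u, v'⟩ _ hq
        -- Vectors that do not occur in `S` must not occur in the product either: by independence
        -- every pair of kept columns from one block is realized by a column of `S`.
        obtain ⟨c, hc1, hc2, hc3⟩ := h.indep.exists_agree (c := κ₁ u.1) (d := κ₂ v'.1) (by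
          rintro _ ⟨l, rfl⟩
          rw [hz₁ j u l, hz₂ j v' l])
        refine hv ⟨c, hq ▸ ((hG ⟨j, u, v'⟩ c).mpr ⟨⟨hc1.symm, hc2.symm⟩, ?_, hc3.symm⟩).symm⟩
        refine Agree.trans ?_ hc1.symm
        rintro _ ⟨l, rfl⟩
        rw [hz₁ j u l, hz₂ j v' l]
      · exact Finset.filter_eq_empty_iff.mpr fun c _ hc => hv ⟨c, hc⟩)
  refine ⟨(Equiv.ofBijective g hg).symm, f, ?_⟩
  ext i c
  obtain ⟨t, rfl⟩ := hg.2 i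
  rw [Matrix.submatrix_apply, Equiv.ofBijective_symm_apply_apply]
  exact (congrFun (hf c) t).symm

end ToFactorization

end KProd

namespace KProd

/-! ### Bounded expressions about the input matrix -/

section Expressions

variable {m n : ℕ}

/-- The input arrays describe the matrix `S`. -/
structure State.HoldsInput (s : State) (S : Matrix (Fin m) (Fin n) ℝ) : Prop where
  rows : s.nat 0 0 = m
  cols : s.nat 0 1 = n
  entry : ∀ (i : Fin m) (j : Fin n), s.real 0 (i * n + j) = S i j

theorem State.HoldsInput.congr {s s' : State} {S : Matrix (Fin m) (Fin n) ℝ}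
    (h : s.HoldsInput S) {W R : Set ℕ} (hs : s.SameOutside W R s') (hW : 0 ∉ W) (hR : 0 ∉ R) :
    s'.HoldsInput S where
  rows := (hs.1 0 hW 0).trans h.rows
  cols := (hs.1 0 hW 1).trans h.cols
  entry i j := (hs.2 0 hR _).trans (h.entry i j)

theorem State.HoldsInput.size_eq {s : State} {S : Matrix (Fin m) (Fin n) ℝ}
    (h : s.HoldsInput S) : s.size = m + n + 1 := by
  rw [State.size, h.rows, h.cols]

namespace BExpr

/-- The expression has a nonzero value. -/
def Holds (e : BExpr) (s : State) : Prop := e.eval s ≠ 0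

/-- Cell `0` of array `a`. -/
abbrev var (a : ℕ) : BExpr := .read a (.const 0)

/-- Negation. -/
def neg (e : BExpr) : BExpr := .eq e (.const 0)

/-- Conjunction. -/
def conj (e f : BExpr) : BExpr := .ite e f (.const 0)

/-- Disjunction. -/
def disj (e f : BExpr) : BExpr := .ite e (.const 1) f

/-- Implication. -/
def imp (e f : BExpr) : BExpr := .ite e f (.const 1)

/-- Bounded universal quantification. -/
def all (v : ℕ) (b : Fin 2) (e : BExpr) : BExpr := neg (.sum v b (neg e))

/-- Bounded existential quantification. -/
def any (v : ℕ) (b : Fin 2) (e : BExpr) : BExpr := .sum v b e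

/-- The number of values of the variable for which the expression holds. -/
def count (v : ℕ) (b : Fin 2) (e : BExpr) : BExpr := .sum v b (.ite e (.const 1) (.const 0))

/-- Conjunction of a list. -/
def allOf (l : List BExpr) : BExpr := l.foldr conj (.const 1)

/-- Disjunction of a list. -/
def anyOf (l : List BExpr) : BExpr := l.foldr disj (.const 0)

variable {s : State} {e f : BExpr} {v : ℕ} {b : Fin 2}

@[simp] theorem eval_const (c : ℕ) : (const c).eval s = c := rfl

@[simp] theorem eval_read (a : ℕ) (i : BExpr) : (read a i).eval s = s.nat a (i.eval s) := rfl

@[simp] theorem eval_add : (add e f).eval s = e.eval s + f.eval s := rfl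

@[simp] theorem holds_read (a : ℕ) (i : BExpr) :
    (read a i).Holds s ↔ s.nat a (i.eval s) ≠ 0 := Iff.rfl

@[simp] theorem holds_lt : (lt e f).Holds s ↔ e.eval s < f.eval s := by
  simp [Holds, eval]

@[simp] theorem holds_eq : (eq e f).Holds s ↔ e.eval s = f.eval s := by
  simp [Holds, eval]

@[simp] theorem holds_realEq :
    (realEq e f).Holds s ↔ s.real 0 (e.eval s) = s.real 0 (f.eval s) := by
  simp [Holds, eval]

@[simp] theorem holds_realZero : (realZero e).Holds s ↔ s.real 0 (e.eval s) = 0 := by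
  simp [Holds, eval]

@[simp] theorem holds_realOne : (realOne e).Holds s ↔ s.real 0 (e.eval s) = 1 := by
  simp [Holds, eval]

@[simp] theorem holds_neg : (neg e).Holds s ↔ ¬ e.Holds s := by
  rw [neg, holds_eq]
  simp [Holds]

@[simp] theorem holds_conj : (conj e f).Holds s ↔ e.Holds s ∧ f.Holds s := by
  simp [conj, Holds, eval]

@[simp] theorem holds_disj : (disj e f).Holds s ↔ e.Holds s ∨ f.Holds s := by
  by_cases h : e.eval s = 0 <;> simp [disj, Holds, eval, h]

@[simp] theorem holds_imp : (imp e f).Holds s ↔ (e.Holds s → f.Holds s) := by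
  by_cases h : e.eval s = 0 <;> simp [imp, Holds, eval, h]

theorem holds_any_iff : (any v b e).Holds s ↔ ∃ i < s.nat 0 b, e.Holds (s.setNat v 0 i) := by
  simp [any, Holds, eval]

theorem holds_all_iff : (all v b e).Holds s ↔ ∀ i < s.nat 0 b, e.Holds (s.setNat v 0 i) := by
  rw [all, holds_neg, ← any, holds_any_iff]
  simp

theorem holds_all {K : ℕ} (hK : s.nat 0 b = K) :
    (all v b e).Holds s ↔ ∀ i : Fin K, e.Holds (s.setNat v 0 i) := by
  rw [holds_all_iff, hK, Fin.forall_iff]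

theorem holds_any {K : ℕ} (hK : s.nat 0 b = K) :
    (any v b e).Holds s ↔ ∃ i : Fin K, e.Holds (s.setNat v 0 i) := by
  rw [holds_any_iff, hK, Fin.exists_iff]
  simp

open Classical in
theorem eval_count {K : ℕ} (hK : s.nat 0 b = K) :
    (count v b e).eval s = Finset.card {i : Fin K | e.Holds (s.setNat v 0 i)} := by
  rw [count, eval, hK, Finset.sum_range, Finset.card_filter]
  refine Finset.sum_congr rfl fun i _ => ?_
  by_cases h : e.eval (s.setNat v 0 i) = 0 <;> simp [eval, Holds, h]

theorem holds_allOf (l : List BExpr) : (allOf l).Holds s ↔ ∀ e ∈ l, e.Holds s := by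
  induction l with
  | nil => simp [allOf, Holds]
  | cons e l ih =>
    rw [List.forall_mem_cons, ← ih]
    exact holds_conj

theorem holds_anyOf (l : List BExpr) : (anyOf l).Holds s ↔ ∃ e ∈ l, e.Holds s := by
  induction l with
  | nil => simp [anyOf, Holds]
  | cons e l ih =>
    rw [List.exists_mem_cons_iff, ← ih]
    exact holds_disj

theorem below_allOf {L : ℕ} {l : List BExpr} (h : ∀ e ∈ l, e.Below L) : (allOf l).Below L := by
  induction l with
  | nil => trivial
  | cons e l ih =>
    rw [List.forall_mem_cons] at h
    exact ⟨h.1, ih h.2, trivial⟩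

theorem below_anyOf {L : ℕ} {l : List BExpr} (h : ∀ e ∈ l, e.Below L) : (anyOf l).Below L := by
  induction l with
  | nil => trivial
  | cons e l ih =>
    rw [List.forall_mem_cons] at h
    exact ⟨h.1, trivial, ih h.2⟩

/-! ### Substitution below bound variables -/

/-- The value is `x`, whatever the variables `20, …, L - 1` are. -/
def Stable (L : ℕ) (e : BExpr) (s : State) (x : ℕ) : Prop :=
  -- Quantifiers bind variables numbered from `20` on. Stability of an argument rules out that it is
  -- captured by a quantifier inside the expression to which it is passed.
  ∀ s', s.SameOutside (Set.Ico 20 L) ∅ s' → e.eval s' = x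

theorem Stable.eval_eq {L x : ℕ} (h : Stable L e s x) : e.eval s = x := h s (.refl _ _ _)

theorem Stable.mono {L L' x : ℕ} (h : Stable L e s x) (hL : L' ≤ L) : Stable L' e s x :=
  fun s' hs => h s' (hs.mono (Set.Ico_subset_Ico_right hL) subset_rfl)

theorem Stable.congr {L x : ℕ} {s' : State} (h : Stable L e s x)
    (hs : s.SameOutside (Set.Ico 20 L) ∅ s') : Stable L e s' x :=
  fun s'' hs' => h s'' (hs.trans hs')

theorem Stable.set {L x : ℕ} (h : Stable L e s x) (hv : v ∈ Set.Ico 20 L) (i : ℕ) :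
    Stable L e (s.setNat v 0 i) x :=
  h.congr (.setNat s hv 0 i)

theorem Stable.var {L a : ℕ} (ha : a ∉ Set.Ico 20 L) : Stable L (var a) s (s.nat a 0) :=
  fun _ hs => hs.1 a ha 0

theorem Stable.read {L a x : ℕ} (ha : a ∉ Set.Ico 20 L) (he : Stable L e s x) :
    Stable L (read a e) s (s.nat a x) := fun s' hs => by
  rw [eval_read, he s' hs, hs.1 a ha]

theorem Stable.add {L x y : ℕ} (he : Stable L e s x) (hf : Stable L f s y) :
    Stable L (add e f) s (x + y) := fun s' hs => by
  rw [eval_add, he s' hs, hf s' hs]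

theorem Stable.const (L c : ℕ) : Stable L (const c) s c := fun _ _ => rfl

/-- The bound variable of a quantifier is stable with respect to variables of smaller number. -/
theorem Stable.bound {L : ℕ} (hv : L ≤ v) (i : ℕ) :
    Stable L (BExpr.var v) (s.setNat v 0 i) i := by
  have := Stable.var (s := s.setNat v 0 i) (L := L) (a := v) (by simp; omega)
  simpa using this

/-- The position of the entry in row `i` and column `c` in the input array. -/
def entryAt (i c : BExpr) : BExpr := .add (.mul i (.read 0 (.const 1))) c

/-- A row index does not exceed the input size, so the cut-off of products has no effect. -/
theorem eval_entryAt {S : Matrix (Fin m) (Fin n) ℝ} (h : s.HoldsInput S) {i c : BExpr}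
    (hi : i.eval s ≤ m) : (entryAt i c).eval s = i.eval s * n + c.eval s := by
  have : min (i.eval s) (m + n + 1) = i.eval s := min_eq_left (by omega)
  simp [entryAt, eval, h.size_eq, h.cols, this]

/-- The columns `c` and `d` agree on the rows marked in array `a`. -/
def agree (a : ℕ) (c d : BExpr) : BExpr :=
  all 20 0 (imp (.read a (var 20)) (.realEq (entryAt (var 20) c) (entryAt (var 20) d)))

/-- The rows marked in array `a` are those from `X`. -/
def Marks (s : State) (a : ℕ) (X : Set (Fin m)) : Prop := ∀ i : Fin m, s.nat a i ≠ 0 ↔ i ∈ X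

theorem Marks.congr {a : ℕ} {X : Set (Fin m)} (h : Marks s a X) {s' : State} {W R : Set ℕ}
    (hs : s.SameOutside W R s') (ha : a ∉ W) : Marks s' a X := fun i => by
  rw [hs.1 a ha]; exact h i

theorem holds_agree {S : Matrix (Fin m) (Fin n) ℝ} (h : s.HoldsInput S) {a : ℕ}
    {X : Set (Fin m)} (hX : Marks s a X) (ha : a < 20) {c d : BExpr} {c' d' : Fin n}
    (hc : Stable 21 c s c') (hd : Stable 21 d s d') :
    (agree a c d).Holds s ↔ Agree S X c' d' := by
  rw [agree, holds_all (b := 0) h.rows]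
  refine forall_congr' fun i => ?_
  have hs : s.SameOutside (Set.Ico 20 21) ∅ (s.setNat 20 0 i) := .setNat s (by simp) 0 i
  have h' := h.congr hs (by simp) (by simp)
  have hX' := hX.congr hs (a := a) (by simp; omega) i
  have e1 : (var 20).eval (s.setNat 20 0 i) = i := by simp
  rw [holds_imp, holds_realEq, eval_entryAt h' (by rw [e1]; omega),
    eval_entryAt h' (by rw [e1]; omega), hc _ hs, hd _ hs, holds_read, e1, hX', h'.entry, h'.entry]

end BExpr

/-- The memory holds the input `S`, and the arrays `5`, `6` and `7` mark the sets of rows `Z`, `A`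
and `B`. -/
structure State.HoldsSets (s : State) (S : Matrix (Fin m) (Fin n) ℝ) (Z A B : Set (Fin m)) :
    Prop where
  input : s.HoldsInput S
  special : BExpr.Marks s 5 Z
  left : BExpr.Marks s 6 A
  right : BExpr.Marks s 7 B

theorem State.HoldsSets.congr {s s' : State} {S : Matrix (Fin m) (Fin n) ℝ}
    {Z A B : Set (Fin m)} (h : s.HoldsSets S Z A B) {W R : Set ℕ} (hs : s.SameOutside W R s')
    (hW : ∀ a ∈ W, 8 ≤ a) (hR : 0 ∉ R) : s'.HoldsSets S Z A B where
  input := h.input.congr hs (fun h => by have := hW _ h; omega) hR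
  special := h.special.congr hs (fun h => by have := hW _ h; omega)
  left := h.left.congr hs (fun h => by have := hW _ h; omega)
  right := h.right.congr hs (fun h => by have := hW _ h; omega)

theorem State.HoldsSets.set {s : State} {S : Matrix (Fin m) (Fin n) ℝ}
    {Z A B : Set (Fin m)} (h : s.HoldsSets S Z A B) {v : ℕ} (hv : 8 ≤ v) (i : ℕ) :
    (s.setNat v 0 i).HoldsSets S Z A B :=
  h.congr (W := {v}) (R := ∅) (.setNat s (by simp) 0 i) (by simpa) (by simp)

namespace BExpr

variable {s : State} {S : Matrix (Fin m) (Fin n) ℝ} {Z A B : Set (Fin m)}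

/-- The size of the block of column `c`. -/
def blockSize (c : BExpr) : BExpr := count 21 1 (agree 5 (var 21) c)

/-- The size of the class of column `c` with respect to the rows marked in array `a`. -/
def sideSize (a : ℕ) (c : BExpr) : BExpr :=
  count 21 1 (conj (agree 5 (var 21) c) (agree a (var 21) c))

/-- The number of columns that agree with `c` and `d` on the two sides. -/
def jointSize (c d : BExpr) : BExpr :=
  count 21 1 (conj (agree 5 (var 21) c) (conj (agree 6 (var 21) c) (agree 7 (var 21) d)))

theorem eval_blockSize (h : s.HoldsSets S Z A B) {c : BExpr} {c' : Fin n}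
    (hc : Stable 22 c s c') : (blockSize c).eval s = blockCount S Z c' := by
  rw [blockSize, eval_count (b := 1) h.input.cols]
  refine card_filter_univ_congr fun i => ?_
  have h' := h.set (v := 21) (by simp) i
  exact holds_agree h'.input h'.special (by simp) (.bound le_rfl i)
    ((hc.set (by simp) i).mono (by simp))

theorem eval_sideSize_left (h : s.HoldsSets S Z A B) {c : BExpr} {c' : Fin n}
    (hc : Stable 22 c s c') : (sideSize 6 c).eval s = sideCount S Z A c' := by
  rw [sideSize, eval_count (b := 1) h.input.cols]
  refine card_filter_univ_congr fun i => ?_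
  have h' := h.set (v := 21) (by simp) i
  have hc' : Stable 21 c (s.setNat 21 0 i) c' := (hc.set (by simp) i).mono (by simp)
  rw [holds_conj, holds_agree h'.input h'.special (by simp) (.bound le_rfl i) hc',
    holds_agree h'.input h'.left (by simp) (.bound le_rfl i) hc']

theorem eval_sideSize_right (h : s.HoldsSets S Z A B) {c : BExpr} {c' : Fin n}
    (hc : Stable 22 c s c') : (sideSize 7 c).eval s = sideCount S Z B c' := by
  rw [sideSize, eval_count (b := 1) h.input.cols]
  refine card_filter_univ_congr fun i => ?_
  have h' := h.set (v := 21) (by simp) i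
  have hc' : Stable 21 c (s.setNat 21 0 i) c' := (hc.set (by simp) i).mono (by simp)
  rw [holds_conj, holds_agree h'.input h'.special (by simp) (.bound le_rfl i) hc',
    holds_agree h'.input h'.right (by simp) (.bound le_rfl i) hc']

theorem eval_jointSize (h : s.HoldsSets S Z A B) {c d : BExpr} {c' d' : Fin n}
    (hc : Stable 22 c s c') (hd : Stable 22 d s d') :
    (jointSize c d).eval s = jointCount S Z A B c' d' := by
  rw [jointSize, eval_count (b := 1) h.input.cols]
  refine card_filter_univ_congr fun i => ?_
  have h' := h.set (v := 21) (by simp) i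
  have hc' : Stable 21 c (s.setNat 21 0 i) c' := (hc.set (by simp) i).mono (by simp)
  have hd' : Stable 21 d (s.setNat 21 0 i) d' := (hd.set (by simp) i).mono (by simp)
  rw [holds_conj, holds_conj, holds_agree h'.input h'.special (by simp) (.bound le_rfl i) hc',
    holds_agree h'.input h'.left (by simp) (.bound le_rfl i) hc',
    holds_agree h'.input h'.right (by simp) (.bound le_rfl i) hd']

/-- The first factors of the products that occur count columns or are quotients bounded by `n`, so
nothing is cut off. -/
theorem eval_mul (h : s.HoldsInput S) {e f : BExpr} {x y : ℕ} (he : e.eval s = x)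
    (hf : f.eval s = y) (hx : x ≤ n) : (mul e f).eval s = x * y := by
  rw [eval, he, hf, h.size_eq, min_eq_left (by omega)]

theorem blockCount_le (S : Matrix (Fin m) (Fin n) ℝ) (Z : Set (Fin m)) (c : Fin n) :
    blockCount S Z c ≤ n :=
  (Finset.card_le_univ _).trans_eq (Fintype.card_fin n)

theorem sideCount_le_card (S : Matrix (Fin m) (Fin n) ℝ) (Z A : Set (Fin m)) (c : Fin n) :
    sideCount S Z A c ≤ n :=
  (Finset.card_le_univ _).trans_eq (Fintype.card_fin n)

/-- The marked sets of rows are independent. -/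
def indep : BExpr :=
  all 22 1 (all 23 1 (imp (agree 5 (var 22) (var 23))
    (.eq (.mul (blockSize (var 22)) (jointSize (var 22) (var 23)))
      (.mul (sideSize 6 (var 22)) (sideSize 7 (var 23))))))

theorem holds_indep (h : s.HoldsSets S Z A B) : indep.Holds s ↔ CondIndep S Z A B := by
  rw [indep, holds_all (b := 1) h.input.cols]
  refine forall_congr' fun c => ?_
  have h₁ := h.set (v := 22) (by simp) c
  rw [holds_all (b := 1) h₁.input.cols]
  refine forall_congr' fun d => ?_
  have h₂ := h₁.set (v := 23) (by simp) d
  have hd : Stable 22 (var 23) ((s.setNat 22 0 c).setNat 23 0 d) d := .bound (by simp) d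
  have hc : Stable 22 (var 22) ((s.setNat 22 0 c).setNat 23 0 d) c := by
    have := Stable.var (s := (s.setNat 22 0 c).setNat 23 0 d) (L := 22) (a := 22) (by simp)
    simpa using this
  rw [holds_imp, holds_agree h₂.input h₂.special (by simp) (hc.mono (by simp))
    (hd.mono (by simp)), holds_eq,
    eval_mul h₂.input (eval_blockSize h₂ hc) (eval_jointSize h₂ hc hd) (blockCount_le _ _ _),
    eval_mul h₂.input (eval_sideSize_left h₂ hc) (eval_sideSize_right h₂ hd)
      (sideCount_le_card _ _ _ _)]

/-- Divisibility, for quotients between `1` and the number of columns. -/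
def dvd (e f : BExpr) : BExpr := any 22 1 (.eq (.mul (.add (var 22) (.const 1)) e) f)

theorem holds_dvd (h : s.HoldsInput S) {e f : BExpr} {x y : ℕ} (he : Stable 23 e s x)
    (hf : Stable 23 f s y) (hy : 0 < y) (hxy : y ≤ n * x) : (dvd e f).Holds s ↔ x ∣ y := by
  rw [dvd, holds_any (b := 1) h.cols]
  have key : ∀ i : Fin n, (eq (mul (add (var 22) (const 1)) e) f).Holds (s.setNat 22 0 i) ↔
      (i + 1) * x = y := by
    intro i
    have h' : (s.setNat 22 0 i).HoldsInput S :=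
      h.congr (W := {22}) (R := ∅) (.setNat s (by simp) 0 i) (by simp) (by simp)
    rw [holds_eq, eval_mul (x := i + 1) h' (by simp) (he.set (by simp) i).eval_eq (by omega),
      (hf.set (by simp) i).eval_eq]
  simp only [key]
  constructor
  · rintro ⟨i, rfl⟩
    exact Dvd.intro_left _ rfl
  · rintro ⟨q, rfl⟩
    have hx : 0 < x := Nat.pos_of_mul_pos_right hy
    have hq : 0 < q := Nat.pos_of_mul_pos_left hy
    rw [mul_comm] at hxy
    have := Nat.le_of_mul_le_mul_right hxy hx
    refine ⟨⟨q - 1, by omega⟩, ?_⟩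
    rw [Nat.sub_add_cancel hq, mul_comm]

/-- `b` is a valid number of columns of the second factor in the block of `c`. -/
def valid (b c : BExpr) : BExpr :=
  conj (.lt (.const 0) b) (conj (dvd b (blockSize c)) (all 23 1 (imp (agree 5 (var 23) c)
    (conj (dvd b (sideSize 6 (var 23)))
      (dvd (blockSize c) (.mul (sideSize 7 (var 23)) b))))))

theorem holds_valid (h : s.HoldsSets S Z A B) {b c : BExpr} {x : ℕ} {c' : Fin n}
    (hb : Stable 24 b s x) (hc : Stable 24 c s c') :
    (valid b c).Holds s ↔ ValidSplit S Z A B x c' := by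
  rw [valid, holds_conj, holds_lt, holds_conj, hb.eval_eq, eval_const]
  have hsets : ∀ {s s' : State} {L : ℕ}, s.HoldsSets S Z A B →
      s.SameOutside (Set.Ico 20 L) ∅ s' → s'.HoldsSets S Z A B := fun h hs =>
    h.congr hs (fun a ha => by simp at ha; omega) (by simp)
  have hblock : ∀ {s : State} {c : BExpr} {c' : Fin n}, s.HoldsSets S Z A B →
      Stable 23 c s c' → Stable 23 (blockSize c) s (blockCount S Z c') := fun h hc s' hs =>
    eval_blockSize (hsets h hs) ((hc.congr hs).mono (by simp))
  have hleft : ∀ {s : State} {c : BExpr} {c' : Fin n}, s.HoldsSets S Z A B →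
      Stable 23 c s c' → Stable 23 (sideSize 6 c) s (sideCount S Z A c') := fun h hc s' hs =>
    eval_sideSize_left (hsets h hs) ((hc.congr hs).mono (by simp))
  rw [holds_all (b := 1) h.input.cols]
  -- Zero is excluded first, since the search for a quotient up to `n` decides divisibility only for
  -- a positive dividend of at most `n` times the divisor.
  by_cases hx : 0 < x
  swap
  · exact ⟨fun h => absurd h.1 hx, fun h => absurd h.pos hx⟩
  have hpos := blockCount_pos S Z c'
  have hn := blockCount_le S Z c'
  rw [holds_dvd h.input (hb.mono (by simp)) (hblock h (hc.mono (by simp))) hpos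
    (hn.trans (Nat.le_mul_of_pos_right n hx))]
  -- The first divisibility gives that `x` is at most the block size, which keeps the quotient in
  -- the last test below the search bound `n`.
  have key : x ∣ blockCount S Z c' → ∀ d : Fin n, (imp (agree 5 (var 23) c)
      (conj (dvd b (sideSize 6 (var 23)))
      (dvd (blockSize c) (.mul (sideSize 7 (var 23)) b)))).Holds (s.setNat 23 0 d) ↔
      (Agree S Z d c' → x ∣ sideCount S Z A d ∧ blockCount S Z c' ∣ sideCount S Z B d * x) := by
    intro hdvd d
    have h' := h.set (v := 23) (by simp) d
    have hd : Stable 23 (var 23) (s.setNat 23 0 d) d := .bound le_rfl d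
    have hb' : Stable 23 b (s.setNat 23 0 d) x := (hb.set (by simp) d).mono (by simp)
    have hc' : Stable 23 c (s.setNat 23 0 d) c' := (hc.set (by simp) d).mono (by simp)
    have hmul : Stable 23 (.mul (sideSize 7 (var 23)) b) (s.setNat 23 0 d)
        (sideCount S Z B d * x) := fun s' hs =>
      eval_mul (hsets h' hs).input
        (eval_sideSize_right (hsets h' hs) ((hd.congr hs).mono (by simp)))
        (hb' s' hs) (sideCount_le_card _ _ _ _)
    rw [holds_imp, holds_conj, holds_agree h'.input h'.special (by simp) (hd.mono (by simp))
      (hc'.mono (by simp)), holds_dvd h'.input hb' (hleft h' hd) (sideCount_pos _ _ _ _)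
      ((sideCount_le_card _ _ _ _).trans (Nat.le_mul_of_pos_right n hx)),
      holds_dvd h'.input (hblock h' hc') hmul (Nat.mul_pos (sideCount_pos _ _ _ _) hx)
      (Nat.mul_le_mul (sideCount_le_card _ _ _ _) (Nat.le_of_dvd hpos hdvd))]
  constructor
  · rintro ⟨_, hdvd, hall⟩
    exact ⟨hx, hdvd, fun d hd => ((key hdvd d).mp (hall d) hd).1,
      fun d hd => ((key hdvd d).mp (hall d) hd).2⟩
  · intro hv
    exact ⟨hx, hv.dvd, fun d => (key hv.dvd d).mpr fun hd => ⟨hv.left d hd, hv.right d hd⟩⟩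

/-- The smallest valid number of columns of the second factor in the block of `c`. -/
def smallest (c : BExpr) : BExpr :=
  -- The sum counts the `i` for which none of `1, …, i + 1` is valid. These are the `i` with `i + 1`
  -- below the minimum, so the count is the minimum minus one.
  .add (count 25 1 (all 24 1 (imp (.lt (var 24) (.add (var 25) (.const 1)))
    (neg (valid (.add (var 24) (.const 1)) c))))) (.const 1)

theorem eval_smallest (h : s.HoldsSets S Z A B) (hi : CondIndep S Z A B) {c : BExpr} {c' : Fin n}
    (hc : Stable 26 c s c') : (smallest c).eval s = minSplit S Z A B c' := by
  classical
  have hmin := hi.minSplit_valid c'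
  have hn := hmin.le_blockCount.trans (blockCount_le S Z c')
  have hpos := hmin.pos
  set x := minSplit S Z A B c' with hx
  rw [smallest, eval_add, eval_count (b := 1) h.input.cols, eval_const]
  suffices H : Finset.card {i : Fin n | (i : ℕ) + 1 < x} + 1 = x by
    convert H using 2
    refine card_filter_univ_congr fun i => ?_
    have h₁ := h.set (v := 25) (by simp) i
    rw [holds_all (b := 1) h₁.input.cols]
    have key : ∀ j : Fin n, (imp (.lt (var 24) (.add (var 25) (.const 1)))
        (neg (valid (.add (var 24) (.const 1)) c))).Holds
          ((s.setNat 25 0 i).setNat 24 0 j) ↔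
        ((j : ℕ) < i + 1 → ¬ ValidSplit S Z A B (j + 1) c') := by
      intro j
      have h₂ := h₁.set (v := 24) (by simp) j
      rw [holds_imp, holds_neg, holds_valid (c' := c') (x := j + 1) h₂
        (Stable.add (.bound le_rfl j) (.const _ _))
        (((hc.set (by simp) _).set (by simp) _).mono (by simp)), holds_lt]
      simp
    simp only [key]
    constructor
    · intro hall
      by_contra hlt
      have := hall ⟨x - 1, by omega⟩ (by simp; omega)
      rw [Nat.sub_add_cancel hpos] at this
      exact this hmin
    · intro hlt j hj hv
      have : x ≤ j + 1 := Nat.sInf_le hv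
      omega
  have : Finset.card {i : Fin n | (i : ℕ) + 1 < x} = x - 1 := by
    have h1 : ({i : Fin n | (i : ℕ) + 1 < x} : Finset (Fin n)) =
        ({i : Fin n | (i : ℕ) < x - 1} : Finset (Fin n)) := by
      ext i
      simp only [Finset.mem_filter, Finset.mem_univ, true_and]
      omega
    rw [h1, Fin.card_filter_val_lt]
    omega
  omega

/-- The guessed number of columns in the block of the guessed column (variables `13` and `12`),
and the smallest valid number in other blocks. -/
def guess (c : BExpr) : BExpr :=
  -- Variable `13` runs from `0`, so the guessed number, which is positive, is its content plus one.
  .ite (agree 5 c (var 12)) (.add (var 13) (.const 1)) (smallest c)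

theorem eval_guess (h : s.HoldsSets S Z A B) (hi : CondIndep S Z A B) {c : BExpr} {c' : Fin n}
    (hc : Stable 26 c s c') {c₁ : Fin n} (hc₁ : s.nat 12 0 = c₁) :
    (guess c).eval s = guessSplit S Z A B c₁ (s.nat 13 0 + 1) c' := by
  have hv : Stable 21 (var 12) s c₁ := hc₁ ▸ .var (by simp)
  have ha := holds_agree h.input h.special (by simp) (hc.mono (by simp)) hv
  rw [guess, eval, guessSplit]
  by_cases hag : Agree S Z c' c₁
  · rw [if_neg (ha.mpr hag), if_pos hag]
    rfl
  · rw [if_pos (not_not.mp fun h => hag (ha.mp h)), if_neg hag, eval_smallest h hi hc]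

/-- The number of columns before `c` in the class of `c` with respect to the rows marked in
array `a`. -/
def rank (a : ℕ) (c : BExpr) : BExpr :=
  count 21 1 (conj (.lt (var 21) c) (conj (agree 5 (var 21) c) (agree a (var 21) c)))

theorem eval_rank (h : s.HoldsInput S) {a : ℕ} (ha : a < 20) (hZ : Marks s 5 Z)
    (hA : Marks s a A) {c : BExpr} {c' : Fin n}
    (hc : Stable 22 c s c') : (rank a c).eval s = classRank S Z A c' := by
  rw [rank, eval_count (b := 1) h.cols]
  refine card_filter_univ_congr fun i => ?_
  have hs : s.SameOutside {21} ∅ (s.setNat 21 0 i) := .setNat s (by simp) 0 i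
  have h' := h.congr hs (by simp) (by simp)
  have hc' : Stable 21 c (s.setNat 21 0 i) c' := (hc.set (by simp) i).mono (by simp)
  rw [holds_conj, holds_conj, holds_agree h' (hZ.congr hs (by simp)) (by simp)
    (.bound le_rfl i) hc', holds_agree h' (hA.congr hs (by simp; omega)) ha (.bound le_rfl i) hc',
    holds_lt, hc'.eval_eq]
  simp

theorem classRank_le (S : Matrix (Fin m) (Fin n) ℝ) (Z A : Set (Fin m)) (c : Fin n) :
    classRank S Z A c ≤ n :=
  (Finset.card_le_univ _).trans_eq (Fintype.card_fin n)

/-- Column `c` is used for the first factor. -/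
def leftCol (c : BExpr) : BExpr := .lt (.mul (rank 6 c) (.read 8 c)) (sideSize 6 c)

/-- Column `c` is used for the second factor. -/
def rightCol (c : BExpr) : BExpr :=
  .lt (.mul (rank 7 c) (blockSize c)) (.mul (sideSize 7 c) (.read 8 c))

theorem holds_leftCol (h : s.HoldsSets S Z A B) {c : BExpr} {c' : Fin n} (hc : Stable 22 c s c')
    {b : Fin n → ℕ} (hb : s.nat 8 c' = b c') : (leftCol c).Holds s ↔ LeftCol S Z A b c' := by
  rw [leftCol, holds_lt, LeftCol, eval_sideSize_left h hc,
    eval_mul h.input (eval_rank h.input (by simp) h.special h.left hc)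
      (y := b c') (by rw [eval_read, hc.eval_eq, hb]) (classRank_le _ _ _ _)]

theorem holds_rightCol (h : s.HoldsSets S Z A B) {c : BExpr} {c' : Fin n} (hc : Stable 22 c s c')
    {b : Fin n → ℕ} (hb : s.nat 8 c' = b c') : (rightCol c).Holds s ↔ RightCol S Z B b c' := by
  rw [rightCol, holds_lt, RightCol,
    eval_mul h.input (eval_sideSize_right h hc) (y := b c') (by rw [eval_read, hc.eval_eq, hb])
      (sideCount_le_card _ _ _ _),
    eval_mul h.input (eval_rank h.input (by simp) h.special h.right hc) (eval_blockSize h hc)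
      (classRank_le _ _ _ _)]

end BExpr

end Expressions

end KProd

namespace KProd

/-! ### Filling an array and computing the labels -/

section Labels

variable {m n : ℕ}

namespace Cmd

open BExpr

/-- Stores the value of `e` in each cell of array `a`, where variable `16` is the index. -/
def fill (a : ℕ) (b : Fin 2) (e : BExpr) : Cmd := .loop 16 b (.setNat a (var 16) e)

/-- The hypothesis `hP` may use that cell `i` still has its old content when `e` is evaluated. The
relabelling needs this, as it reads the array that it overwrites. -/
theorem exec_fill {a : ℕ} {b : Fin 2} {e : BExpr} {s : State} (ha : a ≠ 16)
    (P : ℕ → ℕ → Prop)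
    (hP : ∀ i < s.nat 0 b, ∀ s', s.SameOutside {a, 16} ∅ s' → s'.nat 16 0 = i →
      s'.nat a i = s.nat a i → P i (e.eval s')) :
    s.SameOutside {a, 16} ∅ ((fill a b e).exec s) ∧
      ∀ i < s.nat 0 b, P i (((fill a b e).exec s).nat a i) := by
  have key := iterateUpTo_induction (f := fun i u => (Cmd.setNat a (var 16) e).exec (u.setNat 16 0 i))
    (s := s) (K := s.nat 0 b)
    (fun k u => s.SameOutside {a, 16} ∅ u ∧ (∀ i < k, P i (u.nat a i)) ∧
      ∀ i, k ≤ i → u.nat a i = s.nat a i)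
    ⟨.refl _ _ _, by simp, by simp⟩ (by
      rintro k hk u ⟨h1, h2, h3⟩
      have hs : s.SameOutside {a, 16} ∅ (u.setNat 16 0 k) := h1.trans (.setNat u (by simp) 0 k)
      have he := hP k hk _ hs (by simp) (by simp [ha, h3 k le_rfl])
      simp only [Cmd.exec]
      refine ⟨hs.trans (.setNat _ (by simp) _ _), fun i hi => ?_, fun i hi => ?_⟩
      · rcases lt_or_eq_of_le (Nat.lt_succ_iff.mp hi) with hi | rfl
        · simpa [ha, hi.ne] using h2 i hi
        · simpa using he
      · have : i ≠ k := by omega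
        simp [ha, this, h3 i (by omega)])
  exact ⟨key.1, key.2.1⟩

/-- Marks the rows or columns for which `e` holds in array `a`. -/
theorem marks_fill {a : ℕ} {b : Fin 2} {e : BExpr} {s : State} (ha : a ≠ 16) {K : ℕ}
    (hK : s.nat 0 b = K) (X : Set (Fin K))
    (hX : ∀ i : Fin K, ∀ s', s.SameOutside {a, 16} ∅ s' → s'.nat 16 0 = i →
      (e.Holds s' ↔ i ∈ X)) :
    s.SameOutside {a, 16} ∅ ((fill a b e).exec s) ∧ Marks ((fill a b e).exec s) a X := by
  subst hK
  obtain ⟨h1, h2⟩ := exec_fill (s := s) (b := b) (e := e) ha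
    (fun i x => ∀ hi : i < s.nat 0 b, x ≠ 0 ↔ (⟨i, hi⟩ : Fin _) ∈ X)
    (fun i _ s' hs hi' _ hi => hX ⟨i, hi⟩ s' hs hi')
  exact ⟨h1, fun i => h2 i i.2 i.2⟩

/-- Marks the class with label `l` (variable `15`) and the other rows up to row `p` (variable
`14`), and gives the class the label `p` unless it is independent of the other rows. -/
def mergeClass : Cmd :=
  .seq (fill 6 0 (conj (.lt (var 16) (.add (var 14) (.const 1))) (.eq (.read 4 (var 16)) (var 15))))
  (.seq (fill 7 0 (conj (.lt (var 16) (.add (var 14) (.const 1)))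
    (neg (.eq (.read 4 (var 16)) (var 15)))))
  (.ite indep .skip (fill 4 0 (.ite (conj (.lt (var 16) (var 14)) (.eq (.read 4 (var 16)) (var 15)))
    (var 14) (.read 4 (var 16))))))

open Classical in
theorem exec_mergeClass {S : Matrix (Fin m) (Fin n) ℝ} {Z : Set (Fin m)} {s : State}
    (h : s.HoldsInput S) (hZ : Marks s 5 Z) :
    s.SameOutside {4, 6, 7, 16} ∅ (mergeClass.exec s) ∧
    ∀ i < m, (mergeClass.exec s).nat 4 i =
      if i < s.nat 14 0 ∧ s.nat 4 i = s.nat 15 0 ∧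
        ¬ CondIndep S Z {j | j < s.nat 14 0 + 1 ∧ s.nat 4 j = s.nat 15 0}
          {j | j < s.nat 14 0 + 1 ∧ s.nat 4 j ≠ s.nat 15 0} then s.nat 14 0
      else s.nat 4 i := by
  obtain ⟨h1, hA⟩ := marks_fill (s := s) (a := 6) (b := 0)
    (e := conj (.lt (var 16) (.add (var 14) (.const 1))) (.eq (.read 4 (var 16)) (var 15)))
    (by simp) h.rows {j | j < s.nat 14 0 + 1 ∧ s.nat 4 j = s.nat 15 0}
    (fun i s' hs hi => by simp [hi, hs.1 14, hs.1 15, hs.1 4])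
  set s₁ := (fill 6 0 (conj (.lt (var 16) (.add (var 14) (.const 1)))
    (.eq (.read 4 (var 16)) (var 15)))).exec s with hs₁
  have hin₁ := h.congr h1 (by simp) (by simp)
  obtain ⟨h2, hB⟩ := marks_fill (s := s₁) (a := 7) (b := 0)
    (e := conj (.lt (var 16) (.add (var 14) (.const 1))) (neg (.eq (.read 4 (var 16)) (var 15))))
    (by simp) hin₁.rows {j | j < s.nat 14 0 + 1 ∧ s.nat 4 j ≠ s.nat 15 0}
    (fun i s' hs hi => by simp [hi, hs.1 14, hs.1 15, hs.1 4, h1.1 14, h1.1 15, h1.1 4])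
  set s₂ := (fill 7 0 (conj (.lt (var 16) (.add (var 14) (.const 1)))
    (neg (.eq (.read 4 (var 16)) (var 15))))).exec s₁ with hs₂
  have hs : s.SameOutside {4, 6, 7, 16} ∅ s₂ :=
    (h1.mono (by intro; simp; tauto) (by simp)).trans (h2.mono (by intro; simp; tauto) (by simp))
  have h4 : ∀ i, s₂.nat 4 i = s.nat 4 i := fun i => by rw [h2.1 4 (by simp), h1.1 4 (by simp)]
  have hsets : s₂.HoldsSets S Z {j | j < s.nat 14 0 + 1 ∧ s.nat 4 j = s.nat 15 0}
      {j | j < s.nat 14 0 + 1 ∧ s.nat 4 j ≠ s.nat 15 0} :=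
    ⟨hin₁.congr h2 (by simp) (by simp), (hZ.congr h1 (by simp)).congr h2 (by simp),
      hA.congr h2 (by simp), hB⟩
  have hexec : mergeClass.exec s = if indep.eval s₂ = 0 then (fill 4 0 (.ite (conj (.lt (var 16)
      (var 14)) (.eq (.read 4 (var 16)) (var 15))) (var 14) (.read 4 (var 16)))).exec s₂
      else s₂ := rfl
  have hi := holds_indep hsets
  rw [hexec]
  by_cases hind : indep.eval s₂ = 0
  · have hind' := hi.not.mp (not_not.mpr hind)
    rw [if_pos hind]
    obtain ⟨h3, h3'⟩ := exec_fill (s := s₂) (a := 4) (b := 0)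
      (e := .ite (conj (.lt (var 16) (var 14)) (.eq (.read 4 (var 16)) (var 15)))
        (var 14) (.read 4 (var 16))) (by simp)
      (fun i x => x = if i < s.nat 14 0 ∧ s.nat 4 i = s.nat 15 0 then s.nat 14 0 else s.nat 4 i)
      (by
        intro i _ s' hs' hi' h4'
        have e1 : (conj (.lt (var 16) (var 14)) (.eq (.read 4 (var 16)) (var 15))).Holds s' ↔
            i < s.nat 14 0 ∧ s.nat 4 i = s.nat 15 0 := by
          simp [hi', h4', h4, hs'.1 14, hs'.1 15, hs.1 14, hs.1 15]
        have e2 : s'.nat 14 0 = s.nat 14 0 := by rw [hs'.1 14 (by simp), hs.1 14 (by simp)]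
        rw [eval]
        by_cases hc : i < s.nat 14 0 ∧ s.nat 4 i = s.nat 15 0
        · rw [if_neg (e1.mpr hc), if_pos hc]
          exact e2
        · rw [if_pos (not_not.mp fun h => hc (e1.mp h)), if_neg hc]
          simp [hi', h4', h4])
    refine ⟨hs.trans (h3.mono (by intro; simp; tauto) (by simp)), fun i him => ?_⟩
    rw [h3' i (by rw [Fin.val_zero, hsets.input.rows]; exact him)]
    simp only [hind', not_false_eq_true, and_true]
  · have hind' := hi.mp hind
    rw [if_neg hind]
    refine ⟨hs, fun i _ => ?_⟩
    simp only [hind', not_true_eq_false, and_false, if_false, h4]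

/-- Takes row `p` (variable `14`) into account. -/
def addRow : Cmd :=
  .seq (.setNat 4 (var 14) (var 14)) (.loop 15 0 (.ite (.lt (var 15) (var 14)) mergeClass .skip))

end Cmd

open BExpr Cmd

theorem labelClass_congr {lab lab' : ℕ → ℕ} {p : ℕ} (h : ∀ i < p, lab i = lab' i) (l : ℕ) :
    labelClass m lab p l = labelClass m lab' p l := by
  ext i
  simp only [labelClass, Set.mem_ofPred_eq]
  exact and_congr_right fun hi => by rw [h i hi]

theorem labelRest_congr {lab lab' : ℕ → ℕ} {p : ℕ} (h : ∀ i < p, lab i = lab' i) (l : ℕ) :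
    labelRest m lab p l = labelRest m lab' p l := by
  ext i
  simp only [labelRest, Set.mem_ofPred_eq]
  exact and_congr_right fun hi => by rw [h i hi]

theorem FinestLabels.congr {γ : Type} [Fintype γ] {S : Matrix (Fin m) γ ℝ} {Z : Set (Fin m)}
    {lab lab' : ℕ → ℕ} {p : ℕ} (h : FinestLabels S Z lab p) (hl : ∀ i < p, lab i = lab' i) :
    FinestLabels S Z lab' p where
  lt i hi := hl i hi ▸ h.lt i hi
  indep l := by
    rw [← labelClass_congr hl, ← labelRest_congr hl]
    exact h.indep l
  finest X Y hXY hd hi i j hip hjp hij := by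
    rw [← hl i hip, ← hl j hjp] at hij
    exact h.finest X Y hXY hd hi i j hip hjp hij

/-- The labels are updated in place while `l` runs through the old labels, whereas `nextLabels`
tests all classes against the old labels. There is no conflict: when `l` is processed, only rows
with the label `l` can change, and they get the label `p`, which differs from every label still to
be tested. So the class of a later label and its complement are as they were. -/
theorem Cmd.exec_addRow {S : Matrix (Fin m) (Fin n) ℝ} {Z : Set (Fin m)} {s : State}
    (h : s.HoldsInput S) (hZ : Marks s 5 Z) {p : ℕ} (hp : s.nat 14 0 = p) (hpm : p < m)
    (hl : FinestLabels S Z (s.nat 4) p) :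
    s.SameOutside {4, 6, 7, 15, 16} ∅ (addRow.exec s) ∧
      FinestLabels S Z ((addRow.exec s).nat 4) (p + 1) := by
  classical
  let good : ℕ → Prop := fun l => CondIndep S Z (labelClass m (s.nat 4) p l)
    (labelRest m (s.nat 4) p l ∪ {j | j = p})
  let s₀ := s.setNat 4 p p
  have h0 : s.SameOutside {4, 6, 7, 15, 16} ∅ s₀ := .setNat s (by simp) _ _
  have key := iterateUpTo_induction
    (f := fun i u => (Cmd.ite (.lt (var 15) (var 14)) mergeClass .skip).exec (u.setNat 15 0 i))
    (s := s₀) (K := m)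
    (fun k u => s.SameOutside {4, 6, 7, 15, 16} ∅ u ∧ u.nat 4 p = p ∧
      ∀ i < p, u.nat 4 i = if s.nat 4 i < k ∧ ¬ good (s.nat 4 i) then p else s.nat 4 i)
    ⟨h0, by simp [s₀], fun i hi => by simp [s₀, hi.ne]⟩ (by
      rintro k hk u ⟨h1, h2, h3⟩
      have hs : s.SameOutside {4, 6, 7, 15, 16} ∅ (u.setNat 15 0 k) :=
        h1.trans (.setNat u (by simp) 0 k)
      have h14 : (u.setNat 15 0 k).nat 14 0 = p := by rw [hs.1 14 (by simp), hp]
      have h15 : (u.setNat 15 0 k).nat 15 0 = k := by simp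
      have h4 : ∀ i, (u.setNat 15 0 k).nat 4 i = u.nat 4 i := by simp
      by_cases hkp : k < p
      · have htest : ¬ (BExpr.lt (var 15) (var 14)).eval (u.setNat 15 0 k) = 0 := by
          have : (BExpr.lt (var 15) (var 14)).Holds (u.setNat 15 0 k) := by
            rw [holds_lt, eval_read, eval_read, eval_const, h14, h15]
            exact hkp
          exact this
        have e0 : (Cmd.ite (.lt (var 15) (var 14)) mergeClass .skip).exec (u.setNat 15 0 k) =
            mergeClass.exec (u.setNat 15 0 k) := by
          rw [Cmd.exec, if_neg htest]
        obtain ⟨h5, h6⟩ := exec_mergeClass (h.congr hs (by simp) (by simp))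
          (hZ.congr hs (by simp))
        rw [h14, h15] at h6
        simp only [h4] at h6
        have hcl : ({j | (j : ℕ) < p + 1 ∧ u.nat 4 j = k} : Set (Fin m)) =
            labelClass m (s.nat 4) p k := by
          ext j
          simp only [labelClass, Set.mem_ofPred_eq]
          constructor
          · rintro ⟨hj, hjk⟩
            rcases lt_or_eq_of_le (Nat.lt_succ_iff.mp hj) with hj | hj
            · rw [h3 j hj] at hjk
              split_ifs at hjk
              · omega
              · exact ⟨hj, hjk⟩
            · rw [hj, h2] at hjk
              omega
          · rintro ⟨hj, hjk⟩
            refine ⟨by omega, ?_⟩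
            rw [h3 j hj, if_neg (by omega), hjk]
        -- Row `p` has its own label already, so it counts among the other rows, as do rows that
        -- have been merged with it.
        have hre : ({j | (j : ℕ) < p + 1 ∧ u.nat 4 j ≠ k} : Set (Fin m)) =
            labelRest m (s.nat 4) p k ∪ {j | (j : ℕ) = p} := by
          ext j
          simp only [labelRest, Set.mem_union, Set.mem_ofPred_eq]
          constructor
          · rintro ⟨hj, hjk⟩
            rcases lt_or_eq_of_le (Nat.lt_succ_iff.mp hj) with hj | hj
            · refine .inl ⟨hj, fun hjk' => hjk ?_⟩
              rw [h3 j hj, if_neg (by omega), hjk']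
            · exact .inr hj
          · rintro (⟨hj, hjk⟩ | hj)
            · refine ⟨by omega, fun hjk' => ?_⟩
              rw [h3 j hj] at hjk'
              split_ifs at hjk'
              · omega
              · exact hjk hjk'
            · refine ⟨by omega, ?_⟩
              rw [hj, h2]
              omega
        rw [hcl, hre] at h6
        simp only [e0]
        refine ⟨hs.trans (h5.mono (by intro; simp; tauto) (by simp)), ?_, fun i hi => ?_⟩
        · rw [h6 p hpm, if_neg (by omega), h2]
        · rw [h6 i (by omega), h3 i hi]
          have hli := hl.lt i hi
          change (if i < p ∧ _ ∧ ¬ good k then p else _) = _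
          by_cases hik : s.nat 4 i = k
          · subst hik
            by_cases hg : good (s.nat 4 i)
            · simp [hg]
            · simp [hg, hi]
          · have e1 : s.nat 4 i < k + 1 ↔ s.nat 4 i < k := by omega
            simp only [e1]
            by_cases hg : s.nat 4 i < k ∧ ¬ good (s.nat 4 i)
            · rw [if_pos hg, if_neg (by omega)]
            · rw [if_neg hg, if_neg (by tauto)]
      · have htest : (BExpr.lt (var 15) (var 14)).eval (u.setNat 15 0 k) = 0 := by
          by_contra hne
          have : (BExpr.lt (var 15) (var 14)).Holds (u.setNat 15 0 k) := hne
          rw [holds_lt, eval_read, eval_read, eval_const, h14, h15] at this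
          exact hkp this
        have e0 : (Cmd.ite (.lt (var 15) (var 14)) mergeClass .skip).exec (u.setNat 15 0 k) =
            u.setNat 15 0 k := by
          rw [Cmd.exec, if_pos htest]
          rfl
        simp only [e0]
        refine ⟨hs, by rw [h4, h2], fun i hi => ?_⟩
        rw [h4, h3 i hi]
        have hli := hl.lt i hi
        have e1 : s.nat 4 i < k + 1 := by omega
        have e2 : s.nat 4 i < k := by omega
        simp only [e1, e2])
  have hexec : addRow.exec s = iterateUpTo (fun i u => (Cmd.ite (.lt (var 15) (var 14)) mergeClass
      .skip).exec (u.setNat 15 0 i)) m s₀ := by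
    simp only [addRow, Cmd.exec, eval_read, eval_const, hp, s₀, Fin.val_zero]
    congr 1
    simp [h.rows]
  rw [hexec]
  obtain ⟨k1, k2, k3⟩ := key
  refine ⟨k1, (hl.next hpm).congr fun i hi => ?_⟩
  rcases lt_or_eq_of_le (Nat.lt_succ_iff.mp hi) with hi | rfl
  · rw [k3 i hi, nextLabels, if_neg (by omega)]
    have := hl.lt i hi
    have e1 : s.nat 4 i < m := by omega
    simp only [e1, hi, true_and, good]
  · rw [k2, nextLabels, if_pos rfl]

/-- Computes the labels of the finest partition of all rows. -/
def Cmd.computeLabels : Cmd := .loop 14 0 addRow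

theorem Cmd.exec_computeLabels {S : Matrix (Fin m) (Fin n) ℝ} {Z : Set (Fin m)} {s : State}
    (h : s.HoldsInput S) (hZ : Marks s 5 Z) :
    s.SameOutside {4, 6, 7, 14, 15, 16} ∅ (computeLabels.exec s) ∧
      FinestLabels S Z ((computeLabels.exec s).nat 4) m := by
  have key := iterateUpTo_induction (f := fun i u => addRow.exec (u.setNat 14 0 i))
    (s := s) (K := m)
    (fun k u => s.SameOutside {4, 6, 7, 14, 15, 16} ∅ u ∧ FinestLabels S Z (u.nat 4) k)
    ⟨.refl _ _ _, .zero S Z _⟩ (by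
      rintro k hk u ⟨h1, h2⟩
      have hs : s.SameOutside {4, 6, 7, 14, 15, 16} ∅ (u.setNat 14 0 k) :=
        h1.trans (.setNat u (by simp) 0 k)
      obtain ⟨h3, h4⟩ := exec_addRow (h.congr hs (by simp) (by simp)) (hZ.congr hs (by simp))
        (p := k) (by simp) hk (h2.congr fun i _ => by simp)
      exact ⟨hs.trans (h3.mono (by intro; simp; tauto) (by simp)), h4⟩)
  simpa only [computeLabels, Cmd.exec, Fin.val_zero, h.rows] using key

end Labels

end KProd

namespace KProd

/-! ### Writing the factors -/

section Output

variable {m n : ℕ}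

open Classical in
/-- The number of elements of `X`. -/
noncomputable def markCount {K : ℕ} (X : Set (Fin K)) : ℕ := Finset.card {j | j ∈ X}

open Classical in
/-- The number of elements of `X` before `i`. -/
noncomputable def markRank {K : ℕ} (X : Set (Fin K)) (i : Fin K) : ℕ :=
  Finset.card {j | j < i ∧ j ∈ X}

theorem markRank_le {K : ℕ} (X : Set (Fin K)) (i : Fin K) : markRank X i ≤ K :=
  (Finset.card_le_univ _).trans_eq (Fintype.card_fin K)

theorem markCount_lt_iff {K : ℕ} (X : Set (Fin K)) : markCount X < K ↔ ∃ i, i ∉ X := by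
  classical
  constructor
  · intro h
    by_contra hcon
    push Not at hcon
    simp [markCount, hcon] at h
  · rintro ⟨i, hi⟩
    refine (Finset.card_lt_univ_of_notMem (x := i) ?_).trans_eq (Fintype.card_fin K)
    simpa using hi

/-- `ε` lists the elements of `X` in increasing order. -/
structure Enumerates {K N : ℕ} (X : Set (Fin K)) (ε : Fin N → Fin K) : Prop where
  injective : Function.Injective ε
  range : ∀ i, i ∈ Set.range ε ↔ i ∈ X
  rank : ∀ a, markRank X (ε a) = a

theorem exists_enumerates {K : ℕ} (X : Set (Fin K)) :
    ∃ ε : Fin (markCount X) → Fin K, Enumerates X ε := by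
  classical
  let s : Finset (Fin K) := {j | j ∈ X}
  let ε := s.orderEmbOfFin (k := markCount X) rfl
  have hr : ∀ i, i ∈ Set.range ε ↔ i ∈ X := fun i => by
    have : Set.range ε = s := s.range_orderEmbOfFin rfl
    rw [this]
    simp [s]
  refine ⟨ε, ε.injective, hr, fun a => ?_⟩
  have : ({j | j < ε a ∧ j ∈ X} : Finset (Fin K)) = (Finset.Iio a).map ε.toEmbedding := by
    ext j
    simp only [Finset.mem_filter, Finset.mem_univ, true_and, Finset.mem_map, Finset.mem_Iio]
    constructor
    · rintro ⟨hj, hjX⟩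
      obtain ⟨c, rfl⟩ := (hr j).mpr hjX
      exact ⟨c, ε.lt_iff_lt.mp hj, rfl⟩
    · rintro ⟨c, hc, rfl⟩
      exact ⟨ε.lt_iff_lt.mpr hc, (hr _).mp ⟨c, rfl⟩⟩
  rw [markRank, this, Finset.card_map, Fin.card_Iio]

namespace BExpr

variable {s : State}

/-- The number of rows or columns marked in array `a`. -/
def countMarked (a : ℕ) (b : Fin 2) : BExpr := count 21 b (.read a (var 21))

/-- The number of rows or columns before `e` marked in array `a`. -/
def rankMarked (a : ℕ) (b : Fin 2) (e : BExpr) : BExpr :=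
  count 21 b (conj (.lt (var 21) e) (.read a (var 21)))

theorem eval_countMarked {a K : ℕ} {b : Fin 2} (hK : s.nat 0 b = K) {X : Set (Fin K)}
    (hX : Marks s a X) (ha : a ≠ 21) : (countMarked a b).eval s = markCount X := by
  rw [countMarked, eval_count hK]
  refine card_filter_univ_congr fun i => ?_
  simpa [ha] using hX i

theorem eval_rankMarked {a K : ℕ} {b : Fin 2} (hK : s.nat 0 b = K) {X : Set (Fin K)}
    (hX : Marks s a X) (ha : a ≠ 21) {v : ℕ} (hv : v ≠ 21) {i : Fin K} (hi : s.nat v 0 = i) :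
    (rankMarked a b (var v)).eval s = markRank X i := by
  rw [rankMarked, eval_count hK]
  refine card_filter_univ_congr fun j => ?_
  rw [holds_conj]
  refine and_congr ?_ ?_
  · simp [hv, hi]
  · simpa [ha] using hX j

end BExpr

namespace Cmd

open BExpr

/-- Writes the positions of the rows in the variables `50, …, 50 + r - 1` among the rows marked in
array `ra` to array `t`. -/
def writeSpecial (ra t : ℕ) : ℕ → Cmd
  | 0 => .skip
  | r + 1 => .seq (writeSpecial ra t r) (.setNat t (.const r) (rankMarked ra 0 (var (50 + r))))

theorem exec_writeSpecial {ra t r : ℕ} {s : State} (hm : s.nat 0 0 = m) {X : Set (Fin m)}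
    (hX : Marks s ra X) (hra : ra ≠ 21) (ht : t < 20) (ht0 : t ≠ 0) (hat : ra ≠ t) {z : Fin r → Fin m}
    (hz : ∀ l : Fin r, s.nat (50 + l) 0 = z l) :
    s.SameOutside {t} ∅ ((writeSpecial ra t r).exec s) ∧
      ∀ l : Fin r, ((writeSpecial ra t r).exec s).nat t l = markRank X (z l) := by
  induction r with
  | zero => exact ⟨.refl _ _ _, fun l => l.elim0⟩
  | succ r ih =>
    obtain ⟨h1, h2⟩ := ih (z := fun l => z l.castSucc) (fun l => hz l.castSucc)
    have e : (rankMarked ra 0 (var (50 + r))).eval ((writeSpecial ra t r).exec s) =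
        markRank X (z (Fin.last r)) := by
      refine eval_rankMarked (b := 0) (by rw [h1.1 0 (by simpa using ht0.symm)]; exact hm)
        (hX.congr h1 (by simpa using hat)) hra (by omega) ?_
      rw [h1.1 _ (by simp; omega)]
      exact hz (Fin.last r)
    have hexec : (writeSpecial ra t (r + 1)).exec s =
        ((writeSpecial ra t r).exec s).setNat t r (markRank X (z (Fin.last r))) := by
      rw [← e]
      rfl
    rw [hexec]
    refine ⟨h1.trans (.setNat _ (by simp) _ _), fun l => ?_⟩
    induction l using Fin.lastCases with
    | last => simp
    | cast l =>
      have : (l : ℕ) ≠ r := by omega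
      simp [this, h2 l]

/-- Writes the submatrix for the rows marked in array `ra` and the columns marked in array `ca` to
the real array `t`. -/
def writeMatrix (ra ca t : ℕ) : Cmd :=
  .loop 16 0 (.loop 17 1 (.ite (conj (.read ra (var 16)) (.read ca (var 17)))
    (.copyReal t (.add (.mul (rankMarked ra 0 (var 16)) (countMarked ca 1))
      (rankMarked ca 1 (var 17))) (entryAt (var 16) (var 17))) .skip))

/-- The loop invariant `Done D` says that the entries at the positions in `D` have been written; `D`
grows by one position per pass of the inner loop. The ranks in the two marked sets are the indices
in the submatrix. -/
theorem exec_writeMatrix {S : Matrix (Fin m) (Fin n) ℝ} {s : State} (h : s.HoldsInput S)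
    {ra ca t : ℕ} (hra : ra ∉ ({16, 17, 21} : Set ℕ)) (hca : ca ∉ ({16, 17, 21} : Set ℕ))
    (ht : t ≠ 0) {X : Set (Fin m)} {Y : Set (Fin n)} (hX : Marks s ra X) (hY : Marks s ca Y)
    {M : ℕ} {ε : Fin M → Fin m} {κ : Fin (markCount Y) → Fin n}
    (hε : Enumerates X ε) (hκ : Enumerates Y κ) :
    s.SameOutside {16, 17} {t} ((writeMatrix ra ca t).exec s) ∧
      ((writeMatrix ra ca t).exec s).HoldsMatrix t (S.submatrix ε κ) := by
  simp only [Set.mem_insert_iff, Set.mem_singleton_iff, not_or] at hra hca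
  let body : Cmd := .ite (conj (.read ra (var 16)) (.read ca (var 17)))
    (.copyReal t (.add (.mul (rankMarked ra 0 (var 16)) (countMarked ca 1))
      (rankMarked ca 1 (var 17))) (entryAt (var 16) (var 17))) .skip
  let Done : (Fin m → Fin n → Prop) → State → Prop := fun D u =>
    s.SameOutside {16, 17} {t} u ∧ ∀ (a : Fin M) (c : Fin (markCount Y)), D (ε a) (κ c) →
      u.real t (a * markCount Y + c) = S (ε a) (κ c)
  have step : ∀ D D' u, ∀ i : Fin m, ∀ j : Fin n, Done D u → u.nat 16 0 = i →
      (∀ i' j', D' i' j' → D i' j' ∨ i' = i ∧ j' = j) → Done D' (body.exec (u.setNat 17 0 j)) := by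
    rintro D D' u i j ⟨hu, hD⟩ hi hD'
    have hs : s.SameOutside {16, 17} {t} (u.setNat 17 0 j) := hu.trans (.setNat _ (by simp) _ _)
    set u' := u.setNat 17 0 j
    have hi' : u'.nat 16 0 = i := by simp [u', hi]
    have hj' : u'.nat 17 0 = j := by simp [u']
    have hin := h.congr hs (by simp) (by simpa using ht.symm)
    have hX' := hX.congr hs (by simp [hra])
    have hY' := hY.congr hs (by simp [hca])
    have htest : (conj (.read ra (var 16)) (.read ca (var 17))).Holds u' ↔ i ∈ X ∧ j ∈ Y := by
      rw [holds_conj, ← hX' i, ← hY' j]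
      simp [hi', hj']
    by_cases hij : i ∈ X ∧ j ∈ Y
    · obtain ⟨a, rfl⟩ := (hε.range i).mpr hij.1
      obtain ⟨c, rfl⟩ := (hκ.range j).mpr hij.2
      have e1 : (add (mul (rankMarked ra 0 (var 16)) (countMarked ca 1))
          (rankMarked ca 1 (var 17))).eval u' = a * markCount Y + c := by
        rw [eval_add, eval, eval_rankMarked (b := 0) hin.rows hX' hra.2.2 (by simp) hi',
          eval_rankMarked (b := 1) hin.cols hY' hca.2.2 (by simp) hj',
          eval_countMarked (b := 1) hin.cols hY' hca.2.2, hκ.rank, hin.size_eq,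
          min_eq_left ((markRank_le _ _).trans (by omega)), hε.rank]
      have e2 : u'.real 0 ((entryAt (var 16) (var 17)).eval u') = S (ε a) (κ c) := by
        rw [eval_entryAt hin (by simp [hi'])]
        simp [hi', hj', hin.entry]
      have hexec : body.exec u' = u'.setReal t (a * markCount Y + c) (S (ε a) (κ c)) := by
        rw [← e1, ← e2]
        exact if_neg (htest.mpr hij)
      rw [hexec]
      refine ⟨⟨fun b hb i => hs.1 b hb i, fun b hb i => ?_⟩, fun a' c' hac => ?_⟩
      · have : b ≠ t := by simpa using hb
        simp [this, hs.2 b hb]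
      · by_cases heq : a' = a ∧ c' = c
        · obtain ⟨rfl, rfl⟩ := heq
          simp
        -- Division with remainder recovers row and column from a position in row-major order, so
        -- entries written earlier are not overwritten.
        · have hne : ¬ ((a' : ℕ) * markCount Y + c' = a * markCount Y + c) := by
            intro hcon
            apply heq
            have hpos : 0 < markCount Y := by have := c.2; omega
            have h1 := congrArg (· / markCount Y) hcon
            have h2 := congrArg (· % markCount Y) hcon
            simp only [mul_comm _ (markCount Y),
              Nat.mul_add_div hpos, Nat.div_eq_of_lt c.2, Nat.div_eq_of_lt c'.2,
              Nat.mul_add_mod, Nat.mod_eq_of_lt c.2, Nat.mod_eq_of_lt c'.2] at h1 h2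
            exact ⟨Fin.ext (by omega), Fin.ext h2⟩
          have := (hD' _ _ hac).resolve_right
            (fun h => heq ⟨hε.injective h.1, hκ.injective h.2⟩)
          simpa [hne, u'] using hD a' c' this
    · have hexec : body.exec u' = u' := if_pos (not_not.mp fun h => hij (htest.mp h))
      rw [hexec]
      refine ⟨hs, fun a c hac => ?_⟩
      refine hD a c ((hD' _ _ hac).resolve_right fun h => hij ?_)
      exact ⟨h.1 ▸ (hε.range _).mp ⟨a, rfl⟩, h.2 ▸ (hκ.range _).mp ⟨c, rfl⟩⟩
  have key := iterateUpTo_induction (s := s) (K := m)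
    (f := fun i u => (Cmd.loop 17 1 body).exec (u.setNat 16 0 i))
    (fun p u => Done (fun i _ => i < p) u) ⟨.refl _ _ _, by simp⟩ (by
      rintro p hp u ⟨hu, hD⟩
      have hs : s.SameOutside {16, 17} {t} (u.setNat 16 0 p) := hu.trans (.setNat _ (by simp) _ _)
      have hcols := (h.congr hs (by simp) (by simpa using ht.symm)).cols
      have inner := iterateUpTo_induction (s := u.setNat 16 0 p) (K := n)
        (f := fun j u => body.exec (u.setNat 17 0 j))
        (fun q u => Done (fun i j => i < p ∨ i = p ∧ j < q) u ∧ u.nat 16 0 = p)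
        ⟨⟨hs, by simpa using hD⟩, by simp⟩ (by
          rintro q hq v ⟨hv, hv'⟩
          refine ⟨step (fun i j => i < p ∨ i = p ∧ j < q)
            (fun i j => i < p ∨ i = p ∧ j < q + 1) v ⟨p, hp⟩ ⟨q, hq⟩ hv hv' ?_, ?_⟩
          · intro i' j'
            simp only [Fin.ext_iff]
            omega
          · have hw : body.WritesOnly {17} {t} := by simp [body, WritesOnly]
            rw [(exec_sameOutside body hw _).1 16 (by simp)]
            simpa using hv')
      have hexec : (Cmd.loop 17 1 body).exec (u.setNat 16 0 p) =
          iterateUpTo (fun j u => body.exec (u.setNat 17 0 j)) n (u.setNat 16 0 p) := by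
        rw [← hcols]
        rfl
      simp only [hexec]
      exact ⟨inner.1.1, fun a c hac => inner.1.2 a c (by omega)⟩)
  have hexec : (writeMatrix ra ca t).exec s =
      iterateUpTo (fun i u => (Cmd.loop 17 1 body).exec (u.setNat 16 0 i)) m s := by
    rw [← h.rows]
    rfl
  rw [hexec]
  exact ⟨key.1, fun a c => key.2 a c (by simp)⟩

/-- Writes a factor: the sizes to the cells `o` and `o + 1` of array `1`, the special rows to
array `t + 1`, and the entries to the real array `t`. -/
def writeFactor (r ra ca o t : ℕ) : Cmd :=
  .seq (writeMatrix ra ca t) (.seq (writeSpecial ra (t + 1) r)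
    (.seq (.setNat 1 (.const o) (countMarked ra 0)) (.setNat 1 (.const (o + 1)) (countMarked ca 1))))

theorem exec_writeFactor {S : Matrix (Fin m) (Fin n) ℝ} {s : State} (h : s.HoldsInput S)
    {r ra ca o t : ℕ} (hra : ra ∈ ({18, 19} : Set ℕ)) (hca : ca ∈ ({9, 10} : Set ℕ))
    (ht : t ∈ ({1, 2} : Set ℕ)) {X : Set (Fin m)} {Y : Set (Fin n)} (hX : Marks s ra X)
    (hY : Marks s ca Y) {ε : Fin (markCount X) → Fin m} {κ : Fin (markCount Y) → Fin n}
    (hε : Enumerates X ε) (hκ : Enumerates Y κ) {z : Fin r → Fin m}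
    (hz : ∀ l : Fin r, s.nat (50 + l) 0 = z l) {x : Fin r → Fin (markCount X)}
    (hx : ∀ l, ε (x l) = z l) :
    s.SameOutside {1, 16, 17, t + 1} {t} ((writeFactor r ra ca o t).exec s) ∧
      (∀ i ∉ ({o, o + 1} : Set ℕ), ((writeFactor r ra ca o t).exec s).nat 1 i = s.nat 1 i) ∧
      ((writeFactor r ra ca o t).exec s).nat 1 o = markCount X ∧
      ((writeFactor r ra ca o t).exec s).nat 1 (o + 1) = markCount Y ∧
      ((writeFactor r ra ca o t).exec s).HoldsMatrix t (S.submatrix ε κ) ∧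
      ∀ l : Fin r, ((writeFactor r ra ca o t).exec s).nat (t + 1) l = x l := by
  simp only [Set.mem_insert_iff, Set.mem_singleton_iff] at hra hca ht
  obtain ⟨h1, h1'⟩ := exec_writeMatrix h (ra := ra) (ca := ca) (t := t) (by simp; omega)
    (by simp; omega) (by omega) hX hY hε hκ
  set s₁ := (writeMatrix ra ca t).exec s
  obtain ⟨h2, h2'⟩ := exec_writeSpecial (s := s₁) (m := m) (ra := ra) (t := t + 1) (X := X) (z := z)
    (by rw [h1.1 0 (by simp)]; exact h.rows) (hX.congr h1 (by simp; omega)) (by omega) (by omega)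
    (by omega) (by omega) (fun l => by rw [h1.1 _ (by simp; omega), hz l])
  set s₂ := (writeSpecial ra (t + 1) r).exec s₁
  have hs₂ : s.SameOutside {1, 16, 17, t + 1} {t} s₂ :=
    (h1.mono (by intro; simp; tauto) subset_rfl).trans (h2.mono (by intro; simp; tauto) (by simp))
  have h12 : ∀ i, s₂.nat 1 i = s.nat 1 i := fun i => by
    rw [h2.1 1 (by simp; omega), h1.1 1 (by simp)]
  have hin := h.congr hs₂ (by simp) (by simp; omega)
  have hX' := hX.congr hs₂ (by simp; omega)
  have hY' := hY.congr hs₂ (by simp; omega)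
  have hs₃ : s₂.SameOutside {1} ∅ (s₂.setNat 1 o (markCount X)) := .setNat _ (by simp) _ _
  have hexec : (writeFactor r ra ca o t).exec s =
      (s₂.setNat 1 o (markCount X)).setNat 1 (o + 1) (markCount Y) := by
    have e1 := eval_countMarked (b := 0) hin.rows hX' (by omega)
    have e2 := eval_countMarked (b := 1) (hin.congr hs₃ (by simp) (by simp)).cols
      (hY'.congr hs₃ (by simp; omega)) (by omega)
    simp only [writeFactor, Cmd.exec, eval_const]
    change ((s₂.setNat 1 o ((countMarked ra 0).eval s₂)).setNat 1 (o + 1)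
      ((countMarked ca 1).eval (s₂.setNat 1 o ((countMarked ra 0).eval s₂)))) = _
    rw [e1, e2]
  rw [hexec]
  refine ⟨hs₂.trans ((State.SameOutside.setNat _ (by simp) _ _).trans (.setNat _ (by simp) _ _)),
    fun i hi => ?_, by simp, by simp, fun a c => ?_, fun l => ?_⟩
  · simp only [Set.mem_insert_iff, Set.mem_singleton_iff, not_or] at hi
    simp [hi, h12]
  · exact (h2.2 t (by simp) _).trans (h1' a c)
  · have : t ≠ 0 := by omega
    simp [this, h2', ← hx, hε.rank]

/-- Writes both factors and the answer. -/
def writeFactors (r : ℕ) : Cmd :=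
  .seq (writeFactor r 18 9 1 1) (.seq (writeFactor r 19 10 3 2) (.setNat 1 (.const 0) (.const 1)))

theorem exec_writeFactors {k : ℕ} {S : Matrix (Fin m) (Fin n) ℝ} {s : State} (h : s.HoldsInput S)
    {X₁ X₂ : Set (Fin m)} {Y₁ Y₂ : Set (Fin n)} (hX₁ : Marks s 18 X₁) (hY₁ : Marks s 9 Y₁)
    (hX₂ : Marks s 19 X₂) (hY₂ : Marks s 10 Y₂)
    {ε₁ : Fin (markCount X₁) → Fin m} {κ₁ : Fin (markCount Y₁) → Fin n}
    {ε₂ : Fin (markCount X₂) → Fin m} {κ₂ : Fin (markCount Y₂) → Fin n}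
    (hε₁ : Enumerates X₁ ε₁) (hκ₁ : Enumerates Y₁ κ₁) (hε₂ : Enumerates X₂ ε₂)
    (hκ₂ : Enumerates Y₂ κ₂) {z : Fin (k - 1) → Fin m}
    (hz : ∀ l : Fin (k - 1), s.nat (50 + l) 0 = z l) {x : Fin (k - 1) → Fin (markCount X₁)}
    {y : Fin (k - 1) → Fin (markCount X₂)} (hx : ∀ l, ε₁ (x l) = z l) (hy : ∀ l, ε₂ (y l) = z l) :
    ((writeFactors (k - 1)).exec s).nat 1 0 = 1 ∧
      ((writeFactors (k - 1)).exec s).HoldsFactors (k := k)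
        ⟨_, _, _, _, S.submatrix ε₁ κ₁, S.submatrix ε₂ κ₂, x, y⟩ := by
  obtain ⟨h1, h1', p1, p2, p3, p4⟩ := exec_writeFactor (o := 1) (t := 1) h (by simp) (by simp)
    (by simp) hX₁ hY₁ hε₁ hκ₁ hz hx
  set s₁ := (writeFactor (k - 1) 18 9 1 1).exec s
  obtain ⟨h2, h2', q1, q2, q3, q4⟩ := exec_writeFactor (s := s₁) (o := 3) (t := 2) (z := z)
    (h.congr h1 (by simp) (by simp)) (by simp) (by simp) (by simp) (hX₂.congr h1 (by simp))
    (hY₂.congr h1 (by simp)) hε₂ hκ₂ (fun l => by rw [h1.1 _ (by simp; omega), hz l]) hy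
  set s₂ := (writeFactor (k - 1) 19 10 3 2).exec s₁
  have hexec : (writeFactors (k - 1)).exec s = s₂.setNat 1 0 1 := rfl
  rw [hexec]
  refine ⟨by simp, ?_, ?_, ?_, ?_, ?_, ?_, ?_, ?_⟩
  · simp [h2', p1]
  · simpa [h2'] using p2
  · simp [q1]
  · simpa using q2
  · exact fun a c => (h2.2 1 (by simp) _).trans (p3 a c)
  · exact q3
  · intro l
    simpa [h2.1 2] using p4 l
  · intro l
    simpa using q4 l

end Cmd

end Output

end KProd

namespace KProd

/-! ### Testing a guess -/

section Attempt

variable {m n r : ℕ}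

namespace BExpr

theorem holds_anyOf_map {α : Type} {s : State} (l : List α) (f : α → BExpr) :
    (anyOf (l.map f)).Holds s ↔ ∃ a ∈ l, (f a).Holds s := by
  rw [holds_anyOf]
  simp

theorem holds_allOf_map {α : Type} {s : State} (l : List α) (f : α → BExpr) :
    (allOf (l.map f)).Holds s ↔ ∀ a ∈ l, (f a).Holds s := by
  rw [holds_allOf]
  simp

/-- The column `c` is equal to the vertex `j` in the special rows. -/
def isVertex (j : Option (Fin r)) (c : BExpr) : BExpr :=
  allOf ((List.finRange r).map fun l => if j = some l then .realOne (entryAt (var (50 + l)) c)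
    else .realZero (entryAt (var (50 + l)) c))

theorem simplexVertex_apply (j : Option (Fin r)) (l : Fin r) :
    simplexVertex j l = if j = some l then 1 else 0 := by
  cases j with
  | none => simp [simplexVertex]
  | some i => simp [simplexVertex, Pi.single_apply, eq_comm]

theorem holds_isVertex {s : State} {S : Matrix (Fin m) (Fin n) ℝ} (h : s.HoldsInput S)
    {z : Fin r → Fin m} (hz : ∀ l : Fin r, s.nat (50 + l) 0 = z l) {c : BExpr} {c' : Fin n}
    (hc : c.eval s = c') (j : Option (Fin r)) :
    (isVertex j c).Holds s ↔ (fun l => S (z l) c') = simplexVertex j := by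
  rw [isVertex, holds_allOf_map, funext_iff]
  simp only [List.mem_finRange, true_imp_iff]
  refine forall_congr' fun l => ?_
  have e : s.real 0 ((entryAt (var (50 + l)) c).eval s) = S (z l) c' := by
    rw [eval_entryAt h (by simp [hz]), hc, ← h.entry]
    simp [hz]
  rw [simplexVertex_apply]
  split_ifs
  · rw [holds_realOne, e]
  · rw [holds_realZero, e]

/-- The rows in the variables `50, …, 50 + r - 1` are special. -/
def special (r : ℕ) : BExpr :=
  conj (all 23 1 (anyOf ((none :: (List.finRange r).map some).map fun j => isVertex j (var 23))))
    (allOf ((none :: (List.finRange r).map some).map fun j => any 23 1 (isVertex j (var 23))))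

theorem holds_special {s : State} {S : Matrix (Fin m) (Fin n) ℝ} (h : s.HoldsInput S)
    {z : Fin r → Fin m} (hz : ∀ l : Fin r, s.nat (50 + l) 0 = z l) :
    (special r).Holds s ↔ SpecialRows S z := by
  have hmem : ∀ j : Option (Fin r), j ∈ none :: (List.finRange r).map some := by
    intro j
    cases j <;> simp
  have hv : ∀ (c : Fin n) (j : Option (Fin r)), (isVertex j (var 23)).Holds (s.setNat 23 0 c) ↔
      (fun l => S (z l) c) = simplexVertex j := fun c j =>
    holds_isVertex (h.congr (W := {23}) (R := ∅) (.setNat s (by simp) 0 c) (by simp) (by simp))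
      (fun l => by
        have : 50 + (l : ℕ) ≠ 23 := by omega
        simp [this, hz]) (by simp) j
  rw [special, holds_conj, holds_all (b := 1) h.cols, holds_allOf_map, SpecialRows,
    Set.Subset.antisymm_iff]
  refine and_congr ?_ ?_
  · rw [Set.range_subset_iff]
    refine forall_congr' fun c => ?_
    rw [holds_anyOf_map]
    simp only [hmem, true_and, hv, Set.mem_range]
    exact exists_congr fun j => eq_comm
  · rw [Set.range_subset_iff]
    simp only [hmem, true_imp_iff]
    refine forall_congr' fun j => ?_
    rw [holds_any (b := 1) h.cols]
    simp only [hv, Set.mem_range]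

/-- The marked sets of rows and the numbers in array `8` form a splitting. -/
def split (r : ℕ) : BExpr :=
  conj (special r) (conj (neg (.read 5 (var 11))) (conj (any 23 0 (.read 7 (var 23)))
    (all 24 1 (valid (.read 8 (var 24)) (var 24)))))

/-- Fewer columns are marked in the arrays `9` and `10` than there are. -/
def fewerCols : BExpr :=
  conj (.lt (countMarked 9 1) (.read 0 (.const 1))) (.lt (countMarked 10 1) (.read 0 (.const 1)))

end BExpr

/-- The data derived from a guess: the class of row `w` in the finest partition, the other rows,
the numbers of columns of the second factor, and the rows and columns of both factors. -/
structure State.HoldsGuess (s : State) (S : Matrix (Fin m) (Fin n) ℝ) (z : Fin r → Fin m)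
    (A B : Set (Fin m)) (b : Fin n → ℕ) : Prop where
  sets : s.HoldsSets S (Set.range z) A B
  numbers : ∀ c : Fin n, s.nat 8 c = b c
  leftCols : BExpr.Marks s 9 {c | LeftCol S (Set.range z) A b c}
  rightCols : BExpr.Marks s 10 {c | RightCol S (Set.range z) B b c}
  leftRows : BExpr.Marks s 18 (A ∪ Set.range z)
  rightRows : BExpr.Marks s 19 (B ∪ Set.range z)

/-- Since `A` is a class of the finest partition, independence and disjointness need no test. What
remains is that the rows `z` are special, that `w` is not among them, that `B` is nonempty, and that
the numbers are valid. -/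
theorem BExpr.holds_split {s : State} {S : Matrix (Fin m) (Fin n) ℝ} {z : Fin r → Fin m}
    (hz : ∀ l : Fin r, s.nat (50 + l) 0 = z l) {lab : ℕ → ℕ}
    (hl : FinestLabels S (Set.range z) lab m) {w : Fin m} (hw : s.nat 11 0 = w) {c₁ : Fin n}
    {b₁ : ℕ} {A B : Set (Fin m)} (hA : A = labelClass m lab m (lab w))
    (hB : B = labelRest m lab m (lab w) \ Set.range z)
    (h : s.HoldsGuess S z A B (guessSplit S (Set.range z) A B c₁ b₁)) :
    (split r).Holds s ↔ RowSplit S z A B (guessSplit S (Set.range z) A B c₁ b₁) := by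
  have hin := h.sets.input
  have hvalid : ∀ c : Fin n, (valid (.read 8 (var 24)) (var 24)).Holds (s.setNat 24 0 c) ↔
      ValidSplit S (Set.range z) A B (guessSplit S (Set.range z) A B c₁ b₁ c) c := fun c => by
    have hc : Stable 24 (var 24) (s.setNat 24 0 c) c := .bound le_rfl c
    refine holds_valid (h.sets.set (by simp) _) ?_ hc
    have := hc.read (a := 8) (by simp)
    simpa [h.numbers] using this
  have hne : (any 23 0 (.read 7 (var 23))).Holds s ↔ B.Nonempty := by
    rw [holds_any (b := 0) hin.rows]
    refine exists_congr fun i => ?_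
    simpa using h.sets.right i
  have hwz : (neg (.read 5 (var 11))).Holds s ↔ w ∉ Set.range z := by
    rw [holds_neg, holds_read, eval_read, eval_const, hw, h.sets.special w]
  rw [split, holds_conj, holds_conj, holds_conj, holds_special hin hz, hwz, hne,
    holds_all (b := 1) hin.cols]
  simp only [hvalid]
  constructor
  · rintro ⟨h1, h2, h3, h4⟩
    refine ⟨h1, fun i => ?_, ?_, ?_, ?_, ⟨w, ?_⟩, h3, ?_, h4, fun c d hcd => guessSplit_congr hcd _ _⟩
    · subst hA hB
      by_cases hi : lab i = lab w
      · exact .inl ⟨i.2, hi⟩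
      · by_cases hz : i ∈ Set.range z
        · exact .inr (.inr hz)
        · exact .inr (.inl ⟨⟨i.2, hi⟩, hz⟩)
    · subst hA hB
      exact Set.disjoint_left.mpr fun i hi hi' => hi'.1.2 hi.2
    · rw [hA]
      exact hl.disjoint_special h2
    · rw [hB]
      exact Set.disjoint_sdiff_left
    · rw [hA]
      exact ⟨w.2, rfl⟩
    · rw [hA, hB]
      exact (hl.indep (lab w)).mono subset_rfl Set.sdiff_subset
  · intro hs
    refine ⟨hs.special, Set.disjoint_left.mp hs.left_special ?_, hs.right_nonempty, hs.valid⟩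
    rw [hA]
    exact ⟨w.2, rfl⟩

theorem BExpr.holds_fewerCols {s : State} {S : Matrix (Fin m) (Fin n) ℝ} {z : Fin r → Fin m}
    {A B : Set (Fin m)} {b : Fin n → ℕ} (h : s.HoldsGuess S z A B b) :
    fewerCols.Holds s ↔ markCount {c | LeftCol S (Set.range z) A b c} < n ∧
      markCount {c | RightCol S (Set.range z) B b c} < n := by
  have hin := h.sets.input
  rw [fewerCols, holds_conj, holds_lt, holds_lt,
    eval_countMarked (b := 1) hin.cols h.leftCols (by simp),
    eval_countMarked (b := 1) hin.cols h.rightCols (by simp), eval_read, eval_const, hin.cols]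

namespace Cmd

open BExpr

theorem exec_ite_of_holds {b : BExpr} {s : State} (h : b.Holds s) {c d : Cmd} :
    (Cmd.ite b c d).exec s = c.exec s := if_neg h

theorem exec_ite_of_not_holds {b : BExpr} {s : State} (h : ¬ b.Holds s) {c d : Cmd} :
    (Cmd.ite b c d).exec s = d.exec s := if_pos (not_not.mp h)

/-- Computes the data derived from a guess. -/
def prepare (r : ℕ) : Cmd :=
  .seq (fill 5 0 (anyOf ((List.finRange r).map fun l : Fin r => .eq (var 16) (var (50 + l)))))
  (.seq computeLabels
  (.seq (fill 6 0 (.eq (.read 4 (var 16)) (.read 4 (var 11))))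
  (.seq (fill 7 0 (conj (neg (.eq (.read 4 (var 16)) (.read 4 (var 11)))) (neg (.read 5 (var 16)))))
  (.seq (fill 8 1 (guess (var 16)))
  (.seq (fill 9 1 (leftCol (var 16)))
  (.seq (fill 10 1 (rightCol (var 16)))
  (.seq (fill 18 0 (disj (.read 6 (var 16)) (.read 5 (var 16))))
  (fill 19 0 (disj (.read 7 (var 16)) (.read 5 (var 16)))))))))))

theorem exec_prepare {s : State} {S : Matrix (Fin m) (Fin n) ℝ} (h : s.HoldsInput S)
    {z : Fin r → Fin m} (hz : ∀ l : Fin r, s.nat (50 + l) 0 = z l) {w : Fin m}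
    (hw : s.nat 11 0 = w) {c₁ : Fin n} (hc₁ : s.nat 12 0 = c₁) :
    s.SameOutside {4, 5, 6, 7, 8, 9, 10, 14, 15, 16, 18, 19} ∅ ((prepare r).exec s) ∧
    ∃ lab A B, FinestLabels S (Set.range z) lab m ∧ A = labelClass m lab m (lab w) ∧
      B = labelRest m lab m (lab w) \ Set.range z ∧
      ((prepare r).exec s).HoldsGuess S z A B
        (guessSplit S (Set.range z) A B c₁ (s.nat 13 0 + 1)) := by
  have hstable : ∀ {u : State} {L i : ℕ}, u.nat 16 0 = i → Stable L (var 16) u i :=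
    fun hi => hi ▸ .var (by simp)
  obtain ⟨f5, m5⟩ := marks_fill (s := s) (a := 5) (b := 0)
    (e := anyOf ((List.finRange r).map fun l : Fin r => .eq (var 16) (var (50 + l)))) (by simp) h.rows
    (Set.range z) (fun i u hu hi => by
      rw [holds_anyOf_map]
      simp only [List.mem_finRange, true_and, holds_eq, eval_read, eval_const,
        hi, Set.mem_range]
      refine exists_congr fun l => ?_
      rw [hu.1 _ (by simp; omega), hz, Fin.ext_iff, eq_comm])
  set s₁ := (fill 5 0 (anyOf ((List.finRange r).map fun l : Fin r => .eq (var 16) (var (50 + l))))).exec s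
    with hs₁
  have i₁ := h.congr f5 (by simp) (by simp)
  obtain ⟨f4, hl⟩ := exec_computeLabels i₁ m5
  set s₂ := computeLabels.exec s₁ with hs₂
  have i₂ := i₁.congr f4 (by simp) (by simp)
  have z₂ := m5.congr f4 (by simp)
  have w₂ : s₂.nat 11 0 = w := by rw [f4.1 11 (by simp), f5.1 11 (by simp), hw]
  set lab := s₂.nat 4 with hlab
  obtain ⟨f6, m6⟩ := marks_fill (s := s₂) (a := 6) (b := 0)
    (e := .eq (.read 4 (var 16)) (.read 4 (var 11))) (by simp) i₂.rows
    (labelClass m lab m (lab w)) (fun i u hu hi => by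
      simp [labelClass, hi, hu.1 4, hu.1 11, w₂, lab])
  set s₃ := (fill 6 0 (.eq (.read 4 (var 16)) (.read 4 (var 11)))).exec s₂ with hs₃
  have i₃ := i₂.congr f6 (by simp) (by simp)
  have z₃ := z₂.congr f6 (by simp)
  have w₃ : s₃.nat 11 0 = w := by rw [f6.1 11 (by simp), w₂]
  obtain ⟨f7, m7⟩ := marks_fill (s := s₃) (a := 7) (b := 0)
    (e := conj (neg (.eq (.read 4 (var 16)) (.read 4 (var 11)))) (neg (.read 5 (var 16))))
    (by simp) i₃.rows (labelRest m lab m (lab w) \ Set.range z) (fun i u hu hi => by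
      rw [holds_conj, holds_neg, holds_neg, holds_read, eval_read, eval_const, hi, hu.1 5 (by simp),
        z₃ i]
      simp [labelRest, hi, hu.1 4, hu.1 11, f6.1 4, w₃, lab])
  set s₄ := (fill 7 0 (conj (neg (.eq (.read 4 (var 16)) (.read 4 (var 11))))
    (neg (.read 5 (var 16))))).exec s₃ with hs₄
  refine ⟨exec_sameOutside _ (by simp [prepare, fill, computeLabels, addRow, mergeClass, WritesOnly])
    _, lab, labelClass m lab m (lab w), labelRest m lab m (lab w) \ Set.range z, hl, rfl, rfl, ?_⟩
  set A := labelClass m lab m (lab w)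
  set B := labelRest m lab m (lab w) \ Set.range z
  have hi : CondIndep S (Set.range z) A B := (hl.indep (lab w)).mono subset_rfl Set.sdiff_subset
  have h₄ : s₄.HoldsSets S (Set.range z) A B :=
    ⟨i₃.congr f7 (by simp) (by simp), z₃.congr f7 (by simp), m6.congr f7 (by simp), m7⟩
  have c₄ : s₄.nat 12 0 = c₁ := by
    rw [f7.1 12 (by simp), f6.1 12 (by simp), f4.1 12 (by simp), f5.1 12 (by simp), hc₁]
  have b₄ : s₄.nat 13 0 = s.nat 13 0 := by
    rw [f7.1 13 (by simp), f6.1 13 (by simp), f4.1 13 (by simp), f5.1 13 (by simp)]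
  set b := guessSplit S (Set.range z) A B c₁ (s.nat 13 0 + 1) with hb
  obtain ⟨f8, m8⟩ := exec_fill (s := s₄) (a := 8) (b := 1) (e := guess (var 16)) (by simp)
    (fun i x => ∀ hi : i < n, x = b ⟨i, hi⟩) (fun i _ u hu hiu _ hin => by
      rw [eval_guess (c' := ⟨i, hin⟩) (c₁ := c₁) (h₄.congr hu (by simp) (by simp)) hi (hstable hiu)
        (by rw [hu.1 12 (by simp), c₄]), hu.1 13 (by simp), b₄])
  set s₅ := (fill 8 1 (guess (var 16))).exec s₄ with hs₅
  have h₅ : s₅.HoldsSets S (Set.range z) A B := h₄.congr f8 (by simp) (by simp)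
  have b₅ : ∀ c : Fin n, s₅.nat 8 c = b c := fun c => m8 c (by
    have := h₄.input.cols
    simp only [Fin.val_one, this]
    exact c.2) c.2
  obtain ⟨f9, m9⟩ := marks_fill (s := s₅) (a := 9) (b := 1) (e := leftCol (var 16)) (by simp)
    h₅.input.cols {c | LeftCol S (Set.range z) A b c} (fun c u hu hc =>
      holds_leftCol (h₅.congr hu (by simp) (by simp)) (hstable hc) (by rw [hu.1 8 (by simp), b₅]))
  set s₆ := (fill 9 1 (leftCol (var 16))).exec s₅ with hs₆
  have h₆ : s₆.HoldsSets S (Set.range z) A B := h₅.congr f9 (by simp) (by simp)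
  obtain ⟨f10, m10⟩ := marks_fill (s := s₆) (a := 10) (b := 1) (e := rightCol (var 16)) (by simp)
    h₆.input.cols {c | RightCol S (Set.range z) B b c} (fun c u hu hc =>
      holds_rightCol (h₆.congr hu (by simp) (by simp)) (hstable hc)
        (by rw [hu.1 8 (by simp), f9.1 8 (by simp), b₅]))
  set s₇ := (fill 10 1 (rightCol (var 16))).exec s₆ with hs₇
  have h₇ : s₇.HoldsSets S (Set.range z) A B := h₆.congr f10 (by simp) (by simp)
  obtain ⟨f18, m18⟩ := marks_fill (s := s₇) (a := 18) (b := 0)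
    (e := disj (.read 6 (var 16)) (.read 5 (var 16))) (by simp)
    h₇.input.rows (A ∪ Set.range z) (fun i u hu hi => by
      rw [holds_disj, holds_read, holds_read, eval_read, eval_const, hi, hu.1 5 (by simp),
        hu.1 6 (by simp), h₇.left i, h₇.special i, Set.mem_union])
  set s₈ := (fill 18 0 (disj (.read 6 (var 16)) (.read 5 (var 16)))).exec s₇ with hs₈
  have h₈ : s₈.HoldsSets S (Set.range z) A B := h₇.congr f18 (by simp) (by simp)
  obtain ⟨f19, m19⟩ := marks_fill (s := s₈) (a := 19) (b := 0)
    (e := disj (.read 7 (var 16)) (.read 5 (var 16))) (by simp)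
    h₈.input.rows (B ∪ Set.range z) (fun i u hu hi => by
      rw [holds_disj, holds_read, holds_read, eval_read, eval_const, hi, hu.1 5 (by simp),
        hu.1 7 (by simp), h₈.right i, h₈.special i, Set.mem_union])
  change ((fill 19 0 (disj (.read 7 (var 16)) (.read 5 (var 16)))).exec s₈).HoldsGuess S z A B b
  refine ⟨h₈.congr f19 (by simp) (by simp), fun c => ?_, ?_, ?_, m18.congr f19 (by simp), m19⟩
  · rw [f19.1 8 (by simp), f18.1 8 (by simp), f10.1 8 (by simp), f9.1 8 (by simp), b₅]
  · exact ((m9.congr f10 (by simp)).congr f18 (by simp)).congr f19 (by simp)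
  · exact (m10.congr f18 (by simp)).congr f19 (by simp)

/-- Tests a guess and writes the factors if it is right. -/
def attempt (strict : Bool) (r : ℕ) : Cmd :=
  .seq (prepare r)
    (.ite (conj (split r) (if strict then fewerCols else .const 1)) (writeFactors r) .skip)

end Cmd

/-- The property of the factors that is looked for. -/
def IsSolution (strict : Bool) {k : ℕ} (S : Matrix (Fin m) (Fin n) ℝ) (F : Factors k) : Prop :=
  IsFactorization S F ∧ (strict = true → F.n₁ < n ∧ F.n₂ < n)

/-- The guess leads to factors. -/
def IsRightGuess (strict : Bool) (S : Matrix (Fin m) (Fin n) ℝ) (z : Fin r → Fin m) (w : Fin m)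
    (c₁ : Fin n) (b₁ : ℕ) : Prop :=
  -- All labellings are admitted because only the partition matters and not the numbers used as
  -- labels.
  ∀ lab A B, FinestLabels S (Set.range z) lab m → A = labelClass m lab m (lab w) →
    B = labelRest m lab m (lab w) \ Set.range z →
    RowSplit S z A B (guessSplit S (Set.range z) A B c₁ b₁) ∧
    (strict = true → StrictSplit S z (guessSplit S (Set.range z) A B c₁ b₁))

open BExpr Cmd

theorem RowSplit.isFactorization {k : ℕ} {S : Matrix (Fin m) (Fin n) ℝ} {z : Fin (k - 1) → Fin m}
    {A B : Set (Fin m)} {b : Fin n → ℕ} (h : RowSplit S z A B b)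
    {ε₁ : Fin (markCount (A ∪ Set.range z)) → Fin m}
    {κ₁ : Fin (markCount {c | LeftCol S (Set.range z) A b c}) → Fin n}
    {ε₂ : Fin (markCount (B ∪ Set.range z)) → Fin m}
    {κ₂ : Fin (markCount {c | RightCol S (Set.range z) B b c}) → Fin n}
    (hε₁ : Enumerates (A ∪ Set.range z) ε₁)
    (hκ₁ : Enumerates {c | LeftCol S (Set.range z) A b c} κ₁)
    (hε₂ : Enumerates (B ∪ Set.range z) ε₂)
    (hκ₂ : Enumerates {c | RightCol S (Set.range z) B b c} κ₂)
    {x : Fin (k - 1) → Fin (markCount (A ∪ Set.range z))}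
    {y : Fin (k - 1) → Fin (markCount (B ∪ Set.range z))}
    (hx : ∀ l, ε₁ (x l) = z l) (hy : ∀ l, ε₂ (y l) = z l) :
    IsFactorization (k := k) S ⟨_, _, _, _, S.submatrix ε₁ κ₁, S.submatrix ε₂ κ₂, x, y⟩ := by
  refine ⟨h.special.submatrix hx fun c => ?_, h.special.submatrix hy fun c => ?_, ?_, ?_,
    h.isomorphic hε₁.injective hκ₁.injective hε₂.injective hκ₂.injective hε₁.range hε₂.range
      hκ₁.range hκ₂.range hx hy⟩
  · obtain ⟨d, hd, hdc⟩ := h.exists_leftCol c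
    obtain ⟨e, rfl⟩ := (hκ₁.range d).mpr hd
    exact ⟨e, hdc⟩
  · obtain ⟨d, hd, hdc⟩ := h.exists_rightCol c
    obtain ⟨e, rfl⟩ := (hκ₂.range d).mpr hd
    exact ⟨e, hdc⟩
  · obtain ⟨i, hi⟩ := h.right_nonempty
    refine (markCount_lt_iff _).mpr ⟨i, ?_⟩
    rintro (hA | hz)
    · exact Set.disjoint_left.mp h.disjoint hA hi
    · exact Set.disjoint_left.mp h.right_special hi hz
  · obtain ⟨i, hi⟩ := h.left_nonempty
    refine (markCount_lt_iff _).mpr ⟨i, ?_⟩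
    rintro (hB | hz)
    · exact Set.disjoint_left.mp h.disjoint hi hB
    · exact Set.disjoint_left.mp h.left_special hi hz

/-- Soundness and completeness of one attempt: either correct factors are written, or the answer is
untouched and the guess was not right. -/
theorem Cmd.exec_attempt {strict : Bool} {k : ℕ} {s : State} {S : Matrix (Fin m) (Fin n) ℝ}
    (h : s.HoldsInput S) {z : Fin (k - 1) → Fin m}
    (hz : ∀ l : Fin (k - 1), s.nat (50 + l) 0 = z l) {w : Fin m} (hw : s.nat 11 0 = w)
    {c₁ : Fin n} (hc₁ : s.nat 12 0 = c₁) :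
    ((attempt strict (k - 1)).exec s).nat 1 0 = 1 ∧
      (∃ F : Factors k, ((attempt strict (k - 1)).exec s).HoldsFactors F ∧ IsSolution strict S F) ∨
    ((attempt strict (k - 1)).exec s).nat 1 0 = s.nat 1 0 ∧
      ¬ IsRightGuess strict S z w c₁ (s.nat 13 0 + 1) := by
  obtain ⟨hs, lab, A, B, hl, hA, hB, hg⟩ := exec_prepare h hz hw hc₁
  set u := (prepare (k - 1)).exec s
  set b := guessSplit S (Set.range z) A B c₁ (s.nat 13 0 + 1)
  have hz' : ∀ l : Fin (k - 1), u.nat (50 + l) 0 = z l := fun l => by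
    rw [hs.1 _ (by simp; omega), hz]
  have hw' : u.nat 11 0 = w := by rw [hs.1 _ (by simp), hw]
  have htest : (conj (split (k - 1)) (if strict then fewerCols else .const 1)).Holds u ↔
      RowSplit S z A B b ∧ (strict = true → markCount {c | LeftCol S (Set.range z) A b c} < n ∧
      markCount {c | RightCol S (Set.range z) B b c} < n) := by
    have e : (split (k - 1)).Holds u ↔ RowSplit S z A B b := holds_split hz' hl hw' hA hB hg
    rw [holds_conj, e, ← holds_fewerCols hg]
    cases strict <;> simp [Holds]
  by_cases hc : (conj (split (k - 1)) (if strict then fewerCols else .const 1)).Holds u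
  · have hexec : (attempt strict (k - 1)).exec s = (writeFactors (k - 1)).exec u :=
      exec_ite_of_holds hc
    obtain ⟨hr, hstrict⟩ := htest.mp hc
    obtain ⟨ε₁, hε₁⟩ := exists_enumerates (A ∪ Set.range z)
    obtain ⟨κ₁, hκ₁⟩ := exists_enumerates {c | LeftCol S (Set.range z) A b c}
    obtain ⟨ε₂, hε₂⟩ := exists_enumerates (B ∪ Set.range z)
    obtain ⟨κ₂, hκ₂⟩ := exists_enumerates {c | RightCol S (Set.range z) B b c}
    choose x hx using fun l => (hε₁.range (z l)).mpr (.inr ⟨l, rfl⟩)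
    choose y hy using fun l => (hε₂.range (z l)).mpr (.inr ⟨l, rfl⟩)
    obtain ⟨h1, h2⟩ := exec_writeFactors (k := k) hg.sets.input hg.leftRows hg.leftCols hg.rightRows
      hg.rightCols hε₁ hκ₁ hε₂ hκ₂ hz' hx hy
    rw [hexec]
    exact .inl ⟨h1, _, h2, hr.isFactorization hε₁ hκ₁ hε₂ hκ₂ hx hy, hstrict⟩
  · have hexec : (attempt strict (k - 1)).exec s = u := exec_ite_of_not_holds hc
    rw [hexec]
    refine .inr ⟨hs.1 1 (by simp) 0, fun hright => hc (htest.mpr ?_)⟩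
    obtain ⟨hr, hs⟩ := hright lab A B hl hA hB
    refine ⟨hr, fun ht => ?_⟩
    -- Only this implication from `StrictSplit` to the column counts is needed; after a successful
    -- test the counts themselves give the bounds on the sizes.
    obtain ⟨⟨c, hc⟩, d, hd⟩ := hs ht
    exact ⟨(markCount_lt_iff _).mpr (hr.exists_not_leftCol hc),
      (markCount_lt_iff _).mpr (hr.exists_not_rightCol hd)⟩

/-- Factors give rise to a right guess. -/
theorem IsSolution.exists_rightGuess {strict : Bool} {k : ℕ} {S : Matrix (Fin m) (Fin n) ℝ}
    {F : Factors k} (h : IsSolution strict S F) :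
    ∃ (z : Fin (k - 1) → Fin m) (w : Fin m) (c₁ : Fin n) (b₁ : ℕ), b₁ < n ∧
      IsRightGuess strict S z w c₁ (b₁ + 1) := by
  obtain ⟨z, A, B, b, hr, hs⟩ := h.1.exists_rowSplit
  have hlab : ∀ p ≤ m, ∃ lab, FinestLabels S (Set.range z) lab p := by
    intro p
    induction p with
    | zero => exact fun _ => ⟨_, .zero S _ id⟩
    | succ p ih =>
      intro hp
      obtain ⟨lab, hlab⟩ := ih (by omega)
      exact ⟨_, hlab.next (by omega)⟩
  obtain ⟨lab, hl⟩ := hlab m le_rfl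
  -- Two finest partitions have the same classes, since each class of one is an independent set for
  -- the other.
  have huniq : ∀ (lab' : ℕ → ℕ) (w : Fin m), FinestLabels S (Set.range z) lab' m →
      labelClass m lab' m (lab' w) = labelClass m lab m (lab w) ∧
      labelRest m lab' m (lab' w) = labelRest m lab m (lab w) := by
    intro lab' w hl'
    have compl : ∀ (lab : ℕ → ℕ) l, labelRest m lab m l = (labelClass m lab m l)ᶜ := by
      intro lab l
      ext i
      simp [labelRest, labelClass]
    have hcl : labelClass m lab' m (lab' w) = labelClass m lab m (lab w) := by
      refine Set.Subset.antisymm (hl'.subset_of_mem ?_ ⟨w.2, rfl⟩) (hl.subset_of_mem ?_ ⟨w.2, rfl⟩)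
      · rw [← compl]
        exact hl.indep _
      · rw [← compl]
        exact hl'.indep _
    exact ⟨hcl, by rw [compl, compl, hcl]⟩
  have finish : ∀ (w : Fin m) (c₁ : Fin n) (b₁ : ℕ), 0 < b₁ → b₁ ≤ Fintype.card (Fin n) →
      RowSplit S z (labelClass m lab m (lab w)) (labelRest m lab m (lab w) \ Set.range z)
        (guessSplit S (Set.range z) (labelClass m lab m (lab w))
          (labelRest m lab m (lab w) \ Set.range z) c₁ b₁) →
      (strict = true → StrictSplit S z (guessSplit S (Set.range z) (labelClass m lab m (lab w))
          (labelRest m lab m (lab w) \ Set.range z) c₁ b₁)) →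
      ∃ (z : Fin (k - 1) → Fin m) (w : Fin m) (c₁ : Fin n) (b₁ : ℕ), b₁ < n ∧
        IsRightGuess strict S z w c₁ (b₁ + 1) := by
    intro w c₁ b₁ hb hb' h1 h2
    rw [Fintype.card_fin] at hb'
    -- The loop variable holds the guessed number minus one.
    refine ⟨z, w, c₁, b₁ - 1, by omega, ?_⟩
    rintro lab' A' B' hl' rfl rfl
    rw [(huniq lab' w hl').1, (huniq lab' w hl').2, Nat.sub_add_cancel hb]
    exact ⟨h1, h2⟩
  cases hst : strict with
  | false =>
    obtain ⟨w, _, b', hb'⟩ := hr.exists_label hl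
    obtain ⟨c₁, b₁, h1, h2, h3⟩ := hb'.exists_guess
    subst hst
    exact finish w c₁ b₁ h1 h2 h3 (by simp)
  | true =>
    obtain ⟨w, _, b', hb', hs'⟩ := hr.exists_label_strict hl (hs (h.2 hst).1 (h.2 hst).2)
    obtain ⟨c₁, b₁, h1, h2, h3, h4⟩ := hb'.exists_guess_strict hs'
    subst hst
    exact finish w c₁ b₁ h1 h2 h3 fun _ => h4

end Attempt

end KProd

namespace KProd

/-! ### Searching for a right guess -/

section Search

variable {m n : ℕ}

/-- The memory holds the input, and either the answer is still `0`, or it is `1` and the factors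
have been written. -/
def State.IsConsistent (strict : Bool) (k : ℕ) (S : Matrix (Fin m) (Fin n) ℝ) (s : State) : Prop :=
  s.HoldsInput S ∧ (s.nat 1 0 = 0 ∨
    s.nat 1 0 = 1 ∧ ∃ F : Factors k, s.HoldsFactors F ∧ IsSolution strict S F)

theorem State.IsConsistent.setNat {strict : Bool} {k : ℕ} {S : Matrix (Fin m) (Fin n) ℝ}
    {s : State} (h : s.IsConsistent strict k S) {v : ℕ} (hv : 4 ≤ v) (i : ℕ) :
    (s.setNat v 0 i).IsConsistent strict k S := by
  have hs : s.SameOutside {v} ∅ (s.setNat v 0 i) := .setNat s (by simp) 0 i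
  have hne : ∀ a < 4, ∀ j, (s.setNat v 0 i).nat a j = s.nat a j := fun a ha j =>
    hs.1 a (by simp; omega) j
  refine ⟨h.1.congr hs (by simp; omega) (by simp), ?_⟩
  have h' := h.2
  have hr : (s.setNat v 0 i).real = s.real := rfl
  simp only [State.HoldsFactors, State.HoldsMatrix] at h' ⊢
  simpa only [hne 1 (by simp), hne 2 (by simp), hne 3 (by simp), hr] using h'

/-- The command preserves consistency and the answer `1`, and gives this answer if some values of
the variables from `W`, together with the given values of the other variables, satisfy `P`. -/
structure Finds (strict : Bool) (k : ℕ) (S : Matrix (Fin m) (Fin n) ℝ) (P : (ℕ → ℕ) → Prop)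
    (W : Set ℕ) (c : Cmd) : Prop where
  writes : c.WritesOnly W {1, 2}
  consistent : ∀ s : State, s.IsConsistent strict k S → (c.exec s).IsConsistent strict k S
  keeps : ∀ s : State, s.IsConsistent strict k S → s.nat 1 0 = 1 → (c.exec s).nat 1 0 = 1
  finds : ∀ (s : State) (ρ : ℕ → ℕ), s.IsConsistent strict k S → (∀ v ∉ W, ρ v = s.nat v 0) →
    P ρ → (c.exec s).nat 1 0 = 1

theorem Cmd.WritesOnly.mono {W W' R : Set ℕ} {c : Cmd} (h : c.WritesOnly W R) (hW : W ⊆ W') :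
    c.WritesOnly W' R := by
  induction c with
  | skip => trivial
  | setNat a i e => exact hW h
  | copyReal a i e => exact h
  | seq c d ihc ihd | ite b c d ihc ihd => exact ⟨ihc h.1, ihd h.2⟩
  | loop v b c ih => exact ⟨hW h.1, ih h.2⟩

/-- When the loop reaches the value `ρ v`, the body finds factors, and the later passes keep the
answer. The body needs only the variables outside `W`, which earlier passes have not disturbed apart
from `v`, and `v` is set again each time. -/
theorem Finds.loop {strict : Bool} {k : ℕ} {S : Matrix (Fin m) (Fin n) ℝ} {P : (ℕ → ℕ) → Prop}
    {W : Set ℕ} {c : Cmd} (h : Finds strict k S P W c) {v : ℕ} (hv : 4 ≤ v) (b : Fin 2)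
    (hP : ∀ s : State, s.HoldsInput S → ∀ ρ, P ρ → ρ v < s.nat 0 b) :
    Finds strict k S P (insert v W) (.loop v b c) := by
  have step : ∀ (s u : State) i, u.IsConsistent strict k S ∧ (s.nat 1 0 = 1 → u.nat 1 0 = 1) →
      (c.exec (u.setNat v 0 i)).IsConsistent strict k S ∧
        (s.nat 1 0 = 1 → (c.exec (u.setNat v 0 i)).nat 1 0 = 1) := fun s u i hu =>
    ⟨h.consistent _ (hu.1.setNat hv i), fun hs => h.keeps _ (hu.1.setNat hv i) (by
      rw [State.setNat_nat_of_ne _ _ _ (by omega)]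
      exact hu.2 hs)⟩
  have inv : ∀ (s : State), s.IsConsistent strict k S →
      ((Cmd.loop v b c).exec s).IsConsistent strict k S ∧
        (s.nat 1 0 = 1 → ((Cmd.loop v b c).exec s).nat 1 0 = 1) := fun s hs =>
    iterateUpTo_induction (fun _ u => u.IsConsistent strict k S ∧ (s.nat 1 0 = 1 → u.nat 1 0 = 1))
      ⟨hs, id⟩ fun i _ u hu => step s u i hu
  have hw : (Cmd.loop v b c).WritesOnly (insert v W) {1, 2} :=
    ⟨by simp, h.writes.mono (Set.subset_insert _ _)⟩
  refine ⟨hw, fun s hs => (inv s hs).1, fun s hs => (inv s hs).2, fun s ρ hs hρ hPρ => ?_⟩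
  have key := iterateUpTo_induction (s := s) (K := s.nat 0 b)
    (f := fun i u => c.exec (u.setNat v 0 i))
    (fun p u => u.IsConsistent strict k S ∧ s.SameOutside (insert v W) {1, 2} u ∧
      (ρ v < p → u.nat 1 0 = 1)) ⟨hs, .refl _ _ _, by simp⟩ (by
      rintro p hp u ⟨h1, h2, h3⟩
      refine ⟨h.consistent _ (h1.setNat hv p), h2.trans ((State.SameOutside.setNat u (by simp) 0 p).trans
        ((Cmd.exec_sameOutside c h.writes _).mono (Set.subset_insert _ _) subset_rfl)), fun hlt => ?_⟩
      rcases lt_or_eq_of_le (Nat.lt_succ_iff.mp hlt) with hlt | rfl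
      · refine h.keeps _ (h1.setNat hv p) ?_
        rw [State.setNat_nat_of_ne _ _ _ (by omega)]
        exact h3 hlt
      · refine h.finds _ ρ (h1.setNat hv _) (fun a ha => ?_) hPρ
        by_cases hav : a = v
        · simp [hav]
        · rw [State.setNat_nat_of_ne _ _ _ hav, h2.1 a (by simp [hav, ha]),
            hρ a (by simp [hav, ha])])
  exact key.2.2 (hP s hs.1 ρ hPρ)

namespace Cmd

open BExpr

/-- Tests a guess if it makes sense and the answer is still `0`. -/
def guardedAttempt (strict : Bool) (r : ℕ) : Cmd :=
  -- Once the answer is `1`, factors that have been written are not overwritten by a later guess.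
  -- The range tests make the specification hold for arbitrary contents of the variables.
  .ite (conj (neg (.read 1 (.const 0))) (conj (.lt (var 11) (.read 0 (.const 0)))
    (conj (.lt (var 12) (.read 0 (.const 1)))
      (allOf ((List.finRange r).map fun l : Fin r => .lt (var (50 + l)) (.read 0 (.const 0)))))))
    (attempt strict r) .skip

/-- Tries all rows as values of the variables `50, …, 50 + r - 1`. -/
def forSpecial (c : Cmd) : ℕ → Cmd
  | 0 => c
  | r + 1 => .loop (50 + r) 0 (forSpecial c r)

/-- Tries all guesses. -/
def search (strict : Bool) (r : ℕ) : Cmd :=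
  forSpecial (.loop 11 0 (.loop 12 1 (.loop 13 1 (guardedAttempt strict r)))) r

theorem writesOnly_writeSpecial {W R : Set ℕ} (ra : ℕ) {t : ℕ} (ht : t ∈ W) (r : ℕ) :
    (writeSpecial ra t r).WritesOnly W R := by
  induction r with
  | zero => trivial
  | succ r ih => exact ⟨ih, ht⟩

theorem writesOnly_guardedAttempt (strict : Bool) (r : ℕ) :
    (guardedAttempt strict r).WritesOnly {a | 1 ≤ a ∧ a < 20 ∧ a ≠ 11 ∧ a ≠ 12 ∧ a ≠ 13} {1, 2} := by
  have h2 := writesOnly_writeSpecial (W := {a | 1 ≤ a ∧ a < 20 ∧ a ≠ 11 ∧ a ≠ 12 ∧ a ≠ 13})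
    (R := {1, 2}) 18 (t := 2) (by simp) r
  have h3 := writesOnly_writeSpecial (W := {a | 1 ≤ a ∧ a < 20 ∧ a ≠ 11 ∧ a ≠ 12 ∧ a ≠ 13})
    (R := {1, 2}) 19 (t := 3) (by simp) r
  simp [guardedAttempt, attempt, prepare, fill, computeLabels, addRow, mergeClass, writeFactors,
    writeFactor, writeMatrix, WritesOnly, h2, h3]

end Cmd

open BExpr Cmd

/-- The variables contain a right guess. -/
def ContainsGuess (strict : Bool) (k : ℕ) (S : Matrix (Fin m) (Fin n) ℝ) (ρ : ℕ → ℕ) : Prop :=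
  ∃ (z : Fin (k - 1) → Fin m) (w : Fin m) (c₁ : Fin n), (∀ l : Fin (k - 1), ρ (50 + l) = z l) ∧
    ρ 11 = w ∧ ρ 12 = c₁ ∧ ρ 13 < n ∧ IsRightGuess strict S z w c₁ (ρ 13 + 1)

/-- The starting point of the search: the set of written arrays contains none of the variables that
hold the guess, so the guess is the one found in the memory. The enclosing loops then release these
variables one by one. -/
theorem finds_guardedAttempt (strict : Bool) (k : ℕ) (S : Matrix (Fin m) (Fin n) ℝ) :
    Finds strict k S (ContainsGuess strict k S)
      {a | 1 ≤ a ∧ a < 20 ∧ a ≠ 11 ∧ a ≠ 12 ∧ a ≠ 13} (guardedAttempt strict (k - 1)) := by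
  have key : ∀ s : State, s.IsConsistent strict k S →
      ((guardedAttempt strict (k - 1)).exec s).IsConsistent strict k S ∧
      (s.nat 1 0 = 1 → ((guardedAttempt strict (k - 1)).exec s).nat 1 0 = 1) ∧
      (ContainsGuess strict k S (fun v => s.nat v 0) →
        ((guardedAttempt strict (k - 1)).exec s).nat 1 0 = 1) := by
    intro s hs
    have hin := hs.1
    have htest : (conj (neg (.read 1 (.const 0))) (conj (.lt (var 11) (.read 0 (.const 0)))
        (conj (.lt (var 12) (.read 0 (.const 1))) (allOf ((List.finRange (k - 1)).map
          fun l : Fin (k - 1) => .lt (var (50 + l)) (.read 0 (.const 0))))))).Holds s ↔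
        s.nat 1 0 = 0 ∧ s.nat 11 0 < m ∧ s.nat 12 0 < n ∧
          ∀ l : Fin (k - 1), s.nat (50 + l) 0 < m := by
      rw [holds_conj, holds_conj, holds_conj, holds_allOf_map]
      simp [hin.rows, hin.cols]
    by_cases ht : s.nat 1 0 = 0 ∧ s.nat 11 0 < m ∧ s.nat 12 0 < n ∧
        ∀ l : Fin (k - 1), s.nat (50 + l) 0 < m
    · have hexec : (guardedAttempt strict (k - 1)).exec s = (attempt strict (k - 1)).exec s :=
        exec_ite_of_holds (htest.mpr ht)
      have hw := (writesOnly_guardedAttempt strict (k - 1)).1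
      have hin' := hin.congr (exec_sameOutside _ hw s) (by simp) (by simp)
      rw [hexec]
      obtain ⟨h1, h2, h3, h4⟩ := ht
      have := exec_attempt (strict := strict) (k := k) (z := fun l => ⟨_, h4 l⟩) (w := ⟨_, h2⟩)
        (c₁ := ⟨_, h3⟩) hin (fun _ => rfl) rfl rfl
      rcases this with ⟨h5, h6⟩ | ⟨h5, h6⟩
      · exact ⟨⟨hin', .inr ⟨h5, h6⟩⟩, fun _ => h5, fun _ => h5⟩
      · refine ⟨⟨hin', .inl (h5.trans h1)⟩, fun h => by omega, ?_⟩
        rintro ⟨z, w, c₁, hz, hw, hc₁, _, hg⟩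
        obtain rfl : (fun l => ⟨_, h4 l⟩) = z := funext fun l => Fin.ext (hz l)
        obtain rfl : (⟨_, h2⟩ : Fin m) = w := Fin.ext hw
        obtain rfl : (⟨_, h3⟩ : Fin n) = c₁ := Fin.ext hc₁
        exact absurd hg h6
    · have hexec : (guardedAttempt strict (k - 1)).exec s = s :=
        exec_ite_of_not_holds (fun h => ht (htest.mp h))
      rw [hexec]
      refine ⟨hs, id, ?_⟩
      rintro ⟨z, w, c₁, hz, hw, hc₁, _, -⟩
      rcases hs.2 with h0 | h1
      · refine absurd ⟨h0, ?_, ?_, fun l => ?_⟩ ht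
        · exact hw.trans_lt w.2
        · exact hc₁.trans_lt c₁.2
        · exact (hz l).trans_lt (z l).2
      · exact h1.1
  refine ⟨writesOnly_guardedAttempt strict _, fun s hs => (key s hs).1, fun s hs => (key s hs).2.1, ?_⟩
  rintro s ρ hs hρ ⟨z, w, c₁, hz, hw, hc₁, hb, hg⟩
  refine (key s hs).2.2 ⟨z, w, c₁, fun l => ?_, ?_, ?_, ?_, ?_⟩
  · exact (hρ _ (by simp; omega)).symm.trans (hz l)
  · exact (hρ _ (by simp)).symm.trans hw
  · exact (hρ _ (by simp)).symm.trans hc₁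
  · exact (hρ 13 (by simp)).symm.trans_lt hb
  · rwa [hρ 13 (by simp)] at hg

theorem finds_search (strict : Bool) (k : ℕ) (S : Matrix (Fin m) (Fin n) ℝ) :
    Finds strict k S (ContainsGuess strict k S)
      {a | 1 ≤ a ∧ a < 20 ∨ 50 ≤ a ∧ a < 50 + (k - 1)} (search strict (k - 1)) := by
  have h₀ := finds_guardedAttempt strict k S
  have h₁ := h₀.loop (v := 13) (by simp) 1 (by
    rintro s hs ρ ⟨z, w, c₁, hz, hw, hc₁, hb, hg⟩
    exact hb.trans_eq hs.cols.symm)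
  have h₂ := h₁.loop (v := 12) (by simp) 1 (by
    rintro s hs ρ ⟨z, w, c₁, hz, hw, hc₁, hb, hg⟩
    rw [hc₁]
    exact c₁.2.trans_eq hs.cols.symm)
  have h₃ := h₂.loop (v := 11) (by simp) 0 (by
    rintro s hs ρ ⟨z, w, c₁, hz, hw, hc₁, hb, hg⟩
    rw [hw]
    exact w.2.trans_eq hs.rows.symm)
  have hW : ∀ {W W' : Set ℕ} {c : Cmd}, Finds strict k S (ContainsGuess strict k S) W c → W = W' →
      Finds strict k S (ContainsGuess strict k S) W' c := fun h e => e ▸ h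
  suffices H : ∀ r ≤ k - 1, Finds strict k S (ContainsGuess strict k S)
      {a | 1 ≤ a ∧ a < 20 ∨ 50 ≤ a ∧ a < 50 + r} (forSpecial (.loop 11 0 (.loop 12 1 (.loop 13 1
        (guardedAttempt strict (k - 1))))) r) from H (k - 1) le_rfl
  intro r
  induction r with
  | zero =>
    refine fun _ => hW h₃ ?_
    ext a
    simp only [Set.mem_insert_iff, Set.mem_ofPred_eq]
    omega
  | succ r ih =>
    intro hr
    refine hW ((ih (by omega)).loop (v := 50 + r) (by omega) 0 ?_) ?_
    · rintro s hs ρ ⟨z, w, c₁, hz, hw, hc₁, hb, hg⟩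
      have := hz ⟨r, hr⟩
      rw [this]
      exact (z ⟨r, hr⟩).2.trans_eq hs.rows.symm
    · ext a
      simp only [Set.mem_insert_iff, Set.mem_ofPred_eq]
      omega

/-! ### The program -/

theorem below_writeSpecial {ra t r : ℕ} (hra : ra < 50) (ht : t < 50) (ht0 : t ≠ 0) :
    (writeSpecial ra t r).Below (50 + r) := by
  induction r with
  | zero => trivial
  | succ r ih =>
    refine ⟨ih.mono (by omega), by omega, ht0, trivial, ?_⟩
    simp only [rankMarked, count, conj, BExpr.Below, and_true]
    omega

theorem below_prepare (r : ℕ) : (prepare r).Below (50 + r) := by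
  have h5 : (anyOf ((List.finRange r).map fun l : Fin r => .eq (var 16) (var (50 + l)))).Below
      (50 + r) := by
    refine below_anyOf ?_
    simp only [List.forall_mem_map, BExpr.Below, and_true]
    intro l _
    omega
  have h4 : computeLabels.Below 50 := by
    simp [computeLabels, addRow, mergeClass, fill, indep, agree, blockSize, jointSize, sideSize,
      entryAt, count, all, imp, conj, neg, BExpr.Below, Cmd.Below]
  have h8 : (fill 8 1 (guess (var 16))).Below 50 := by
    simp [fill, guess, smallest, valid, BExpr.dvd, any, agree, blockSize, sideSize,
      entryAt, count, all, imp, conj, neg, BExpr.Below, Cmd.Below]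
  have h9 : (fill 9 1 (leftCol (var 16))).Below 50 := by
    simp [fill, leftCol, BExpr.rank, agree, sideSize, entryAt, count, all, imp, conj, neg, BExpr.Below,
      Cmd.Below]
  have h10 : (fill 10 1 (rightCol (var 16))).Below 50 := by
    simp [fill, rightCol, BExpr.rank, agree, blockSize, sideSize, entryAt, count, all, imp, conj, neg,
      BExpr.Below, Cmd.Below]
  have hfill : ∀ {a : ℕ} {e : BExpr}, a < 50 → a ≠ 0 → e.Below (50 + r) →
      (fill a 0 e).Below (50 + r) := fun ha ha0 he =>
    ⟨by omega, by omega, by omega, ha0, ⟨by omega, trivial⟩, he⟩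
  have hle : 50 ≤ 50 + r := by omega
  refine ⟨hfill (by simp) (by simp) h5, h4.mono hle, hfill (by simp) (by simp) ?_,
    hfill (by simp) (by simp) ?_, h8.mono hle, h9.mono hle, h10.mono hle,
    hfill (by simp) (by simp) ?_, hfill (by simp) (by simp) ?_⟩ <;>
  · refine BExpr.Below.mono hle ?_
    simp [conj, disj, neg, BExpr.Below]

theorem below_split (r : ℕ) : (split r).Below (50 + r) := by
  have hle : 50 ≤ 50 + r := by omega
  have hv : ∀ j : Option (Fin r), (isVertex j (var 23)).Below (50 + r) := by
    intro j
    refine below_allOf ?_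
    simp only [List.forall_mem_map]
    intro l _
    split_ifs <;> simp only [entryAt, BExpr.Below, and_true] <;> omega
  have h1 : (special r).Below (50 + r) := by
    refine ⟨⟨⟨by omega, by omega, below_anyOf ?_, trivial⟩, trivial⟩, below_allOf ?_, trivial⟩
    · rw [List.forall_mem_map]
      exact fun j _ => hv j
    · rw [List.forall_mem_map]
      exact fun j _ => ⟨by omega, by omega, hv j⟩
  refine ⟨h1, BExpr.Below.mono hle ?_, trivial⟩
  simp [valid, BExpr.dvd, any, agree, blockSize, sideSize, entryAt, count, all, imp, conj, neg,
    BExpr.Below]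

theorem below_writeFactors (r : ℕ) : (writeFactors r).Below (50 + r) := by
  have hle : 50 ≤ 50 + r := by omega
  have hm : ∀ ra ca t : ℕ, ra < 50 → ca < 50 → t ≠ 0 → (writeMatrix ra ca t).Below 50 := by
    intro ra ca t h1 h2 h3
    simp [writeMatrix, rankMarked, countMarked, entryAt, count, conj, Cmd.Below, BExpr.Below, h1, h2,
      h3]
  have hc : ∀ a < 50, ∀ b, (countMarked a b).Below (50 + r) := by
    intro a ha b
    refine BExpr.Below.mono hle ?_
    simp [countMarked, count, BExpr.Below, ha]
  have hf : ∀ ra ca o t : ℕ, ra < 50 → ca < 50 → t < 20 → t ≠ 0 →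
      (writeFactor r ra ca o t).Below (50 + r) := fun ra ca o t h1 h2 h3 h4 =>
    ⟨(hm ra ca t h1 h2 h4).mono hle, below_writeSpecial h1 (by omega) (by omega),
      ⟨by omega, by omega, trivial, hc _ h1 _⟩, ⟨by omega, by omega, trivial, hc _ h2 _⟩⟩
  exact ⟨hf _ _ _ _ (by simp) (by simp) (by simp) (by simp),
    hf _ _ _ _ (by simp) (by simp) (by simp) (by simp), by omega, by omega, trivial, trivial⟩

theorem below_search (strict : Bool) (r : ℕ) : (search strict r).Below (50 + r) := by
  have hle : 50 ≤ 50 + r := by omega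
  have hfew : (if strict then fewerCols else .const 1).Below (50 + r) := by
    refine BExpr.Below.mono hle ?_
    cases strict <;> simp [fewerCols, countMarked, count, conj, BExpr.Below]
  have hatt : (attempt strict r).Below (50 + r) :=
    ⟨below_prepare r, ⟨below_split r, hfew, trivial⟩, below_writeFactors r, trivial⟩
  have hguard : (guardedAttempt strict r).Below (50 + r) := by
    refine ⟨⟨?_, ⟨?_, ⟨?_, below_allOf ?_, trivial⟩, trivial⟩, trivial⟩, hatt, trivial⟩
    · simp only [neg, BExpr.Below, and_true]
      omega
    · simp only [BExpr.Below, and_true]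
      omega
    · simp only [BExpr.Below, and_true]
      omega
    · simp only [List.forall_mem_map, BExpr.Below, and_true]
      intro l _
      omega
  suffices H : ∀ c : Cmd, c.Below (50 + r) → ∀ j ≤ r, (forSpecial c j).Below (50 + r) from
    H (.loop 11 0 (.loop 12 1 (.loop 13 1 (guardedAttempt strict r))))
      ⟨by omega, by omega, by omega, by omega, by omega, by omega, hguard⟩ r le_rfl
  intro c hc j
  induction j with
  | zero => exact fun _ => hc
  | succ j ih => exact fun hj => ⟨by omega, by omega, ih (by omega)⟩

theorem holdsInput_inputState (S : Matrix (Fin m) (Fin n) ℝ) : (inputState S).HoldsInput S where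
  rows := rfl
  cols := rfl
  entry i j := by
    have hn : 0 < n := by have := j.2; omega
    have h1 : ((i : ℕ) * n + j) / n = i := by
      rw [mul_comm, Nat.mul_add_div hn, Nat.div_eq_of_lt j.2, add_zero]
    have h2 : ((i : ℕ) * n + j) % n = j := by
      rw [mul_comm, Nat.mul_add_mod, Nat.mod_eq_of_lt j.2]
    have h : ((i : ℕ) * n + j) / n < m := by rw [h1]; exact i.2
    simp only [inputState, h, hn, and_self, dite_true]
    congr 1 <;> exact Fin.ext (by assumption)

theorem Finds.of_exists_solution {strict : Bool} {k : ℕ} {S : Matrix (Fin m) (Fin n) ℝ}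
    (h : ∃ F : Factors k, IsSolution strict S F) :
    ((search strict (k - 1)).exec (inputState S)).nat 1 0 = 1 := by
  obtain ⟨F, hF⟩ := h
  obtain ⟨z, w, c₁, b₁, hb, hg⟩ := hF.exists_rightGuess
  -- The assignment consists of the right guess; at all variables that the search does not write, it
  -- must agree with the initial memory.
  refine (finds_search strict k S).finds _ (fun v => if v = 11 then w else if v = 12 then c₁ else
    if v = 13 then b₁ else if h : v - 50 < k - 1 ∧ 50 ≤ v then z ⟨v - 50, h.1⟩ else
      (inputState S).nat v 0) ⟨holdsInput_inputState S, .inl rfl⟩ ?_ ?_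
  · intro v hv
    simp only [Set.mem_ofPred_eq] at hv
    rw [if_neg (by omega), if_neg (by omega), if_neg (by omega), dif_neg (by omega)]
  · refine ⟨z, w, c₁, fun l => ?_, by simp, by simp, by simpa using hb, by simpa using hg⟩
    have h1 : 50 + (l : ℕ) ≠ 11 := by omega
    have h2 : 50 + (l : ℕ) ≠ 12 := by omega
    have h3 : 50 + (l : ℕ) ≠ 13 := by omega
    simp [h1, h2, h3]

theorem State.HoldsFactors.congr {s s' : State} {k : ℕ} {F : Factors k} (h : s.HoldsFactors F)
    {L : ℕ} (hs : s.AgreeBelow L s') (hL : 4 ≤ L) : s'.HoldsFactors F := by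
  have hn : ∀ a < 4, ∀ i, s'.nat a i = s.nat a i := fun a ha i => hs.1 a (by omega) i
  have hr : s'.real = s.real := hs.2
  simp only [State.HoldsFactors, State.HoldsMatrix] at h ⊢
  simpa only [hn 1 (by simp), hn 2 (by simp), hn 3 (by simp), hr] using h

/-- Consistency of the final memory gives soundness, and the existence of a right guess gives
completeness. The scratch arrays of the compiled program lie above the variables of the search, so
the output is not affected by them. -/
theorem exists_program (strict : Bool) (k : ℕ)
    (Q : ∀ {m n : ℕ}, Matrix (Fin m) (Fin n) ℝ → Factors k → Prop)
    (hQ : ∀ {m n : ℕ} (S : Matrix (Fin m) (Fin n) ℝ) (F : Factors k), Q S F ↔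
      IsSolution strict S F) : ∃ p : Program, p.FindsFactorsInPolyTime k Q := by
  obtain ⟨p, T, ⟨C, d, hT⟩, hp⟩ := (search strict (k - 1)).executable (50 + (k - 1)) (by omega)
    (below_search strict (k - 1))
  refine ⟨p, C, d, fun m n S => ?_⟩
  obtain ⟨s, ⟨t, ht, hrun⟩, hs⟩ := hp (inputState S)
  have hin := holdsInput_inputState S
  rw [hin.size_eq] at ht
  have hans : s.nat 1 0 = ((search strict (k - 1)).exec (inputState S)).nat 1 0 :=
    hs.1 1 (by omega) 0
  simp only [hQ]
  have hcons := ((finds_search strict k S).consistent _ ⟨hin, .inl rfl⟩).2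
  rw [← hans] at hcons
  refine ⟨s, t, hrun, ht.trans (hT _ (by omega)), fun h => ?_, fun h => ?_⟩
  · have h1 : s.nat 1 0 = 1 := hans.trans (Finds.of_exists_solution h)
    obtain ⟨-, F, hF, hF'⟩ := hcons.resolve_left (by omega)
    exact ⟨h1, F, hF.congr hs (by omega), hF'⟩
  · exact hcons.resolve_right fun ⟨_, F, _, hF⟩ => h ⟨F, hF⟩

end Search

end KProd

/-- For every constant `k ≥ 1`, recognizing `k`-products and computing factors with special rows
is possible in polynomial time, both when the factors only have to have fewer rows than the given
matrix and when they have to have fewer rows and fewer columns. -/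
theorem theorem1 (k : ℕ) (hk : 1 ≤ k) :
    (∃ p : KProd.Program, p.FindsFactorsInPolyTime k KProd.IsFactorization) ∧
    (∃ p : KProd.Program, p.FindsFactorsInPolyTime k KProd.IsStrictFactorization) :=
  ⟨KProd.exists_program false k _ fun S F => by simp [KProd.IsSolution],
    KProd.exists_program true k _ fun S F => by
      simp [KProd.IsSolution, KProd.IsStrictFactorization]⟩
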